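/- **Setting.** Fix a set $R$ of roles. *Statics:* a simply typed $\lambda$-calculus over the sorts $int$, $bool$, $role$, $set$ (sets of roles), $type$ (non-linear types), $vtype$ (linear types; every type is one), $stype$ (session types) and $\sigma_1\to\sigma_2$. Static terms over $int,bool,role,set$ have their standard meaning; entailment $\Sigma;\vec P\models P_0$ is truth of $P_0$ under all valuations of $\Sigma$ satisfying $\vec P$; equality of types is the congruence generated by $\beta$ and by provable equality of data terms. Types are built from unit, singleton integer and boolean types, strings, pairs ($\times,\otimes$), functions ($\to,\multimap$), guarded types $P\supset\tau$, asserting types $P\wedge\tau$, quantifiers $\forall a{:}\sigma.\tau$, $\exists a{:}\sigma.\tau$, and endpoint types $\mathrm{chan}(rs,\pi)$; session types are $\mathrm{end}(r)$, the broadcast $\mathrm{msg}(r,\tau)::\pi$ ($\tau$ non-linear), the point-to-point message $\mathrm{msg}(r_1,r_2,\hat\tau)::\pi$ ($\hat\tau$ linear) and $\mathrm{quan}(r,f)$ with $f:\sigma\to stype$. *Dynamics:* the call-by-value, left-to-right $\lambda$-calculus with introduction and elimination forms for these types, endpoints $c^{A}$ (channel $c$, role set $A\subseteq R$), and the session operations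 below, typed with split non-linear/linear contexts (each linear variable is used exactly once; non-linear functions capture no linear variable and no endpoint), where $c^A:\mathrm{chan}(A,\pi)$ if the signature assigns $\pi$ to $c$: * thread creation $(\mathrm{unit}\multimap\mathrm{unit})\Rightarrow\mathrm{unit}$; $\mathrm{fork}:(\mathrm{chan}(rs_1,\pi)\multimap\mathrm{unit})\Rightarrow\mathrm{chan}(rs_2,\pi)$ if $rs_1\uplus rs_2=R$; $\mathrm{cut}:(\mathrm{chan}(rs_1,\pi),\mathrm{chan}(rs_2,\pi))\Rightarrow\mathrm{chan}(rs_1\cap rs_2,\pi)$ if $rs_1\cup rs_2=R$; $\mathrm{elim}:\mathrm{chan}(\varnothing,\pi)\Rightarrow\mathrm{unit}$; $\mathrm{split}:(\mathrm{chan}(rs_1\uplus rs_2,\pi),\mathrm{chan}(rs_1,\pi)\multimap\mathrm{unit})\Rightarrow\mathrm{chan}(rs_2,\pi)$ if $rs_1\cap rs_2=\varnothing$; * on $\mathrm{chan}(rs,\mathrm{msg}(r,\tau)::\pi)$: $\mathrm{bsend}$ (with a $\tau$, returning $\mathrm{chan}(rs,\pi)$) if $r\in rs$, $\mathrm{brecv}$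 (returning $\mathrm{chan}(rs,\pi)\otimes\tau$) if $r\notin rs$; * on $\mathrm{chan}(rs,\mathrm{msg}(r_1,r_2,\hat\tau)::\pi)$: $\mathrm{send}$ (with a $\hat\tau$, returning $\mathrm{chan}(rs,\pi)$) if $r_1\in rs,r_2\notin rs$; $\mathrm{recv}$ (returning $\mathrm{chan}(rs,\pi)\otimes\hat\tau$) if $r_1\notin rs,r_2\in rs$; $\mathrm{skip}$ (returning $\mathrm{chan}(rs,\pi)$) if $r_1,r_2\in rs$ or $r_1,r_2\notin rs$; * on $\mathrm{chan}(rs,\mathrm{end}(r))$, returning unit: $\mathrm{close}$ if $r\in rs$, $\mathrm{wait}$ if $r\notin rs$; * on $\mathrm{chan}(rs,\mathrm{quan}(r,f))$: $\mathrm{unify}$ (returning $\forall a.\mathrm{chan}(rs,f(a))$) if $r\in rs$, $\mathrm{exify}$ (returning $\exists a.\mathrm{chan}(rs,f(a))$) if $r\notin rs$. A *pool* $\Pi$ is a finite map from thread identifiers to closed terms. It is *well-typed* if, under some signature, thread $0$ (which exists) has some type and all other threads have type unit. A *partial redex* is one of $\mathrm{bsend}(c^A,v)$, $\mathrm{brecv}(c^A)$,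 $\mathrm{send}(c^A,v)$, $\mathrm{recv}(c^A)$, $\mathrm{skip}(c^A)$, $\mathrm{close}(c^A)$, $\mathrm{wait}(c^A)$, $\mathrm{unify}(c^A)$, $\mathrm{exify}(c^A)$ with $v$ a value; a term is *blocked* if it is $E[e']$ with $E$ an evaluation context and $e'$ a partial redex. Distinct threads $t_1,\dots,t_n$ of $\Pi$ *match*, $\mathrm{match}(\{\Pi(t_1),\dots,\Pi(t_n)\})$, if for some channel $c$ and role sets $A_1,\dots,A_n$ that partition $R$ (blocks may be empty), $c^{A_1},\dots,c^{A_n}$ are exactly all endpoints of $c$ occurring in $\Pi$ (with multiplicity), $\Pi(t_i)=E_i[e_i]$ with $e_i$ a partial redex on $c^{A_i}$, and, up to order, $e_1,\dots,e_n$ are (i) one $\mathrm{bsend}$ and otherwise $\mathrm{brecv}$; (ii) one $\mathrm{send}$, one $\mathrm{recv}$ and otherwise $\mathrm{skip}$; (ii′) only $\mathrm{skip}$ (the case in which one endpoint plays both the sender and the receiver); (iii) one $\mathrm{close}$ and otherwise $\mathrm{wait}$; or (iv) one $\mathrm{unify}$ and otherwise $\mathrm{exify}$, all at the same sort. *Pool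 reduction:* a thread performs a local reduction; a finished thread $t>0$ is removed; a thread is created; $\mathrm{fork}(\lambda x.e)$ creates a fresh channel $c$, returns $c^{rs_2}$ and starts $e[x\mapsto c^{rs_1}]$; $\mathrm{cut}(c_1^{A_1},c_2^{A_2})$ returns $c^{A_1\cap A_2}$ and renames $c_1\neq c_2$ to a fresh $c$ in the whole pool (and the arguments of $\mathrm{cut}$ may be exchanged); $\mathrm{elim}(c^\varnothing)$ returns unit; $\mathrm{split}(c^{rs_1\uplus rs_2},\lambda x.e)$ returns $c^{rs_2}$ and starts $e[x\mapsto c^{rs_1}]$; and matching threads synchronise, with $c^{A_i}$ returned by each thread (paired with the value for a receiver, unit for $\mathrm{close}/\mathrm{wait}$, and for a quantifier together with the witness of the instantiation, i.e. as an existential package for $\mathrm{exify}$ and as a value of universal type, which can be instantiated only with that witness, for $\mathrm{unify}$). **Lemma (Deadlock-free).** Let $\Pi_0$ be a well-typed pool in which no endpoint occurs, let $\Pi_0$ reduce to $\Pi$ in finitely many (possibly zero) steps, and let $\Pi$ be well-typed. Suppose that $\Pi(0)$ is a value in which no endpoint occurs or is blocked, that $\Pi(t)$ is blocked for every $t\in\mathrm{dom}(\Pi)$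 with $t\neq 0$, and that at least one thread of $\Pi$ is blocked. Then there are threads $t_1,\dots,t_n\in\mathrm{dom}(\Pi)$ such that $\mathrm{match}(\{\Pi(t_1),\dots,\Pi(t_n)\})$. -/

import Mathlib

namespace MPST

/-! # Statics: a simply typed lambda calculus

Everything is parametrised by the type `R` of all roles, so the full role set is `Set.univ`. -/

/-- Sorts. `ty false` is the sort *type* of (non-linear) types and `ty true` is the sort *vtype* of
linear types; `stype` is the sort of session types, `set` the sort of role sets. -/
inductive Srt : Type
  | int | bool | role | set
  | ty (l : Bool)
  | stype
  | arr (a b : Srt)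

/-- The sorts of the constraint domain: base data sorts, and functions between them. -/
def Srt.Data : Srt → Prop
  | .int => True
  | .bool => True
  | .role => True
  | .set => True
  | .ty _ => False
  | .stype => False
  | .arr a b => a.Data ∧ b.Data

/-- Standard interpretation of sorts in the constraint domain. No static constant inspects a type or
a session type, so those sorts carry no information here. -/
def Srt.Den (R : Type) : Srt → Type
  | .int => ℤ
  | .bool => Prop
  | .role => R
  | .set => Set R
  | .ty _ => Unit
  | .stype => Unit
  | .arr a b => a.Den R → b.Den R

/-- Well-sorted de Bruijn variables. -/
inductive Var : List Srt → Srt → Type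
  | z {Γ : List Srt} {a : Srt} : Var (a :: Γ) a
  | s {Γ : List Srt} {a b : Srt} (x : Var Γ a) : Var (b :: Γ) a

/-- Static terms, well-sorted by construction. The terms of sort `ty l` are the types, those of sort
`stype` the session types. -/
inductive STm (R : Type) : List Srt → Srt → Type
  | var {Γ : List Srt} {a : Srt} (x : Var Γ a) : STm R Γ a
  | lam {Γ : List Srt} {a b : Srt} (t : STm R (a :: Γ) b) : STm R Γ (.arr a b)
  | app {Γ : List Srt} {a b : Srt} (t : STm R Γ (.arr a b)) (u : STm R Γ a) : STm R Γ b
  /-- static constants: integers, roles, role sets, propositions, and operations on them -/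
  | cst {Γ : List Srt} (a : Srt) (h : a.Data) (d : a.Den R) : STm R Γ a
  /-- every type is a linear type -/
  | emb {Γ : List Srt} (t : STm R Γ (.ty false)) : STm R Γ (.ty true)
  | unit {Γ : List Srt} : STm R Γ (.ty false)
  /-- the singleton type of an integer -/
  | tint {Γ : List Srt} (i : STm R Γ .int) : STm R Γ (.ty false)
  /-- the singleton type of a boolean -/
  | tbool {Γ : List Srt} (p : STm R Γ .bool) : STm R Γ (.ty false)
  | tstr {Γ : List Srt} : STm R Γ (.ty false)
  /-- `τ₁ × τ₂` (`l = false`) and `τ₁ ⊗ τ₂` (`l = true`) -/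
  | pair {Γ : List Srt} {l : Bool} (t u : STm R Γ (.ty l)) : STm R Γ (.ty l)
  /-- `τ₁ → τ₂` (`l = false`) and `τ₁ ⊸ τ₂` (`l = true`) -/
  | fn {Γ : List Srt} {l : Bool} (t u : STm R Γ (.ty true)) : STm R Γ (.ty l)
  /-- the guarded type `P ⊃ τ` -/
  | guard {Γ : List Srt} {l : Bool} (p : STm R Γ .bool) (t : STm R Γ (.ty l)) : STm R Γ (.ty l)
  /-- the asserting type `P ∧ τ` -/
  | asrt {Γ : List Srt} {l : Bool} (p : STm R Γ .bool) (t : STm R Γ (.ty l)) : STm R Γ (.ty l)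
  | all {Γ : List Srt} {l : Bool} {a : Srt} (t : STm R (a :: Γ) (.ty l)) : STm R Γ (.ty l)
  | ex {Γ : List Srt} {l : Bool} {a : Srt} (t : STm R (a :: Γ) (.ty l)) : STm R Γ (.ty l)
  /-- the endpoint type `chan(rs, π)` -/
  | chan {Γ : List Srt} (rs : STm R Γ .set) (π : STm R Γ .stype) : STm R Γ (.ty true)
  /-- `end(r)` -/
  | fin {Γ : List Srt} (r : STm R Γ .role) : STm R Γ .stype
  /-- broadcast `msg(r, τ) :: π` of a non-linear value -/
  | bmsg {Γ : List Srt} (r : STm R Γ .role) (t : STm R Γ (.ty false)) (π : STm R Γ .stype) :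
      STm R Γ .stype
  /-- point-to-point message `msg(r₁, r₂, τ) :: π` of a linear value -/
  | msg {Γ : List Srt} (r₁ r₂ : STm R Γ .role) (t : STm R Γ (.ty true)) (π : STm R Γ .stype) :
      STm R Γ .stype
  /-- `quan(r, f)`, with `f` a static function into session types -/
  | quan {Γ : List Srt} {a : Srt} (r : STm R Γ .role) (f : STm R Γ (.arr a .stype)) :
      STm R Γ .stype

section Statics

variable {R : Type}

/-- Static renamings. -/
abbrev SRen (Γ Δ : List Srt) : Type := ∀ a : Srt, Var Γ a → Var Δ a

def SRen.lift {Γ Δ : List Srt} (f : SRen Γ Δ) (b : Srt) : SRen (b :: Γ) (b :: Δ)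
  | _, .z => .z
  | _, .s x => .s (f _ x)

def STm.ren : {Γ : List Srt} → {a : Srt} → STm R Γ a → {Δ : List Srt} → SRen Γ Δ → STm R Δ a
  | _, _, .var x, _, f => .var (f _ x)
  | _, _, .lam t, _, f => .lam (t.ren (f.lift _))
  | _, _, .app t u, _, f => .app (t.ren f) (u.ren f)
  | _, _, .cst a h d, _, _ => .cst a h d
  | _, _, .emb t, _, f => .emb (t.ren f)
  | _, _, .unit, _, _ => .unit
  | _, _, .tint i, _, f => .tint (i.ren f)
  | _, _, .tbool p, _, f => .tbool (p.ren f)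
  | _, _, .tstr, _, _ => .tstr
  | _, _, .pair t u, _, f => .pair (t.ren f) (u.ren f)
  | _, _, .fn t u, _, f => .fn (t.ren f) (u.ren f)
  | _, _, .guard p t, _, f => .guard (p.ren f) (t.ren f)
  | _, _, .asrt p t, _, f => .asrt (p.ren f) (t.ren f)
  | _, _, .all t, _, f => .all (t.ren (f.lift _))
  | _, _, .ex t, _, f => .ex (t.ren (f.lift _))
  | _, _, .chan rs π, _, f => .chan (rs.ren f) (π.ren f)
  | _, _, .fin r, _, f => .fin (r.ren f)
  | _, _, .bmsg r t π, _, f => .bmsg (r.ren f) (t.ren f) (π.ren f)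
  | _, _, .msg r₁ r₂ t π, _, f => .msg (r₁.ren f) (r₂.ren f) (t.ren f) (π.ren f)
  | _, _, .quan r g, _, f => .quan (r.ren f) (g.ren f)

/-- Weakening by one static variable. -/
def STm.wk {Γ : List Srt} {a : Srt} (b : Srt) (t : STm R Γ a) : STm R (b :: Γ) a :=
  t.ren fun _ x => .s x

/-- Weakening of a closed static term. -/
def STm.wkc {a : Srt} (Γ : List Srt) (t : STm R [] a) : STm R Γ a :=
  t.ren fun _ x => nomatch x

/-- Static substitutions. -/
abbrev SSub (R : Type) (Γ Δ : List Srt) : Type := ∀ a : Srt, Var Γ a → STm R Δ a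

def SSub.lift {Γ Δ : List Srt} (f : SSub R Γ Δ) (b : Srt) : SSub R (b :: Γ) (b :: Δ)
  | _, .z => .var .z
  | _, .s x => (f _ x).wk b

def STm.sub : {Γ : List Srt} → {a : Srt} → STm R Γ a → {Δ : List Srt} → SSub R Γ Δ → STm R Δ a
  | _, _, .var x, _, f => f _ x
  | _, _, .lam t, _, f => .lam (t.sub (f.lift _))
  | _, _, .app t u, _, f => .app (t.sub f) (u.sub f)
  | _, _, .cst a h d, _, _ => .cst a h d
  | _, _, .emb t, _, f => .emb (t.sub f)
  | _, _, .unit, _, _ => .unit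
  | _, _, .tint i, _, f => .tint (i.sub f)
  | _, _, .tbool p, _, f => .tbool (p.sub f)
  | _, _, .tstr, _, _ => .tstr
  | _, _, .pair t u, _, f => .pair (t.sub f) (u.sub f)
  | _, _, .fn t u, _, f => .fn (t.sub f) (u.sub f)
  | _, _, .guard p t, _, f => .guard (p.sub f) (t.sub f)
  | _, _, .asrt p t, _, f => .asrt (p.sub f) (t.sub f)
  | _, _, .all t, _, f => .all (t.sub (f.lift _))
  | _, _, .ex t, _, f => .ex (t.sub (f.lift _))
  | _, _, .chan rs π, _, f => .chan (rs.sub f) (π.sub f)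
  | _, _, .fin r, _, f => .fin (r.sub f)
  | _, _, .bmsg r t π, _, f => .bmsg (r.sub f) (t.sub f) (π.sub f)
  | _, _, .msg r₁ r₂ t π, _, f => .msg (r₁.sub f) (r₂.sub f) (t.sub f) (π.sub f)
  | _, _, .quan r g, _, f => .quan (r.sub f) (g.sub f)

/-- The substitution of `s` for the last static variable. -/
def SSub.single {Γ : List Srt} {b : Srt} (s : STm R Γ b) : SSub R (b :: Γ) Γ
  | _, .z => s
  | _, .s x => .var x

/-- `t[a ↦ s]` for the last static variable `a`. -/
def STm.inst {Γ : List Srt} {a b : Srt} (t : STm R (b :: Γ) a) (s : STm R Γ b) : STm R Γ a :=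
  t.sub (SSub.single s)

/-- Every type of sort `ty l`, seen as a linear type. -/
def STm.up {Γ : List Srt} : {l : Bool} → STm R Γ (.ty l) → STm R Γ (.ty true)
  | false, t => .emb t
  | true, t => t

/-- Valuations of static variables in the constraint domain. -/
abbrev Env (R : Type) (Γ : List Srt) : Type := ∀ a : Srt, Var Γ a → a.Den R

def Env.cons {Γ : List Srt} {b : Srt} (d : b.Den R) (v : Env R Γ) : Env R (b :: Γ)
  | _, .z => d
  | _, .s x => v _ x

/-- The value of a static term in the constraint domain. -/
def STm.eval : {Γ : List Srt} → {a : Srt} → STm R Γ a → Env R Γ → a.Den R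
  | _, _, .var x, v => v _ x
  | _, _, .lam t, v => fun d => t.eval (Env.cons d v)
  | _, _, .app t u, v => (t.eval v) (u.eval v)
  | _, _, .cst _ _ d, _ => d
  | _, _, .emb _, _ => ()
  | _, _, .unit, _ => ()
  | _, _, .tint _, _ => ()
  | _, _, .tbool _, _ => ()
  | _, _, .tstr, _ => ()
  | _, _, .pair _ _, _ => ()
  | _, _, .fn _ _, _ => ()
  | _, _, .guard _ _, _ => ()
  | _, _, .asrt _ _, _ => ()
  | _, _, .all _, _ => ()
  | _, _, .ex _, _ => ()
  | _, _, .chan _ _, _ => ()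
  | _, _, .fin _, _ => ()
  | _, _, .bmsg _ _ _, _ => ()
  | _, _, .msg _ _ _ _, _ => ()
  | _, _, .quan _ _, _ => ()

/-- The value of a closed static term. -/
def STm.val {a : Srt} (t : STm R [] a) : a.Den R := t.eval fun _ x => nomatch x

/-- A proposition holds under a valuation. -/
def STm.Holds {Γ : List Srt} (p : STm R Γ .bool) (v : Env R Γ) : Prop := p.eval v

/-- Constraint solving: `Σ; P ⊨ q`. -/
def Entails {Γ : List Srt} (P : List (STm R Γ .bool)) (q : STm R Γ .bool) : Prop :=
  ∀ v : Env R Γ, (∀ p ∈ P, p.Holds v) → q.Holds v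

/-- A binary operation of the constraint domain, applied to static terms. -/
def STm.op₂ {Γ : List Srt} {a b c : Srt} (ha : a.Data) (hb : b.Data) (hc : c.Data)
    (f : a.Den R → b.Den R → c.Den R) (s : STm R Γ a) (t : STm R Γ b) : STm R Γ c :=
  .app (.app (.cst (.arr a (.arr b c)) ⟨ha, hb, hc⟩ f) s) t

/-- The literal role set `A`. -/
def STm.setLit {Γ : List Srt} (A : Set R) : STm R Γ .set := .cst .set trivial A

/-- The literal integer `n`. -/
def STm.intLit {Γ : List Srt} (n : ℤ) : STm R Γ .int := .cst .int trivial n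

/-- The proposition `r ∈ rs`. -/
def STm.mem {Γ : List Srt} (r : STm R Γ .role) (rs : STm R Γ .set) : STm R Γ .bool :=
  .op₂ (a := .role) (b := .set) (c := .bool) trivial trivial trivial
    (fun (x : R) (A : Set R) => x ∈ A) r rs

/-- The proposition `r ∉ rs`. -/
def STm.notMem {Γ : List Srt} (r : STm R Γ .role) (rs : STm R Γ .set) : STm R Γ .bool :=
  .op₂ (a := .role) (b := .set) (c := .bool) trivial trivial trivial
    (fun (x : R) (A : Set R) => x ∉ A) r rs

def STm.conj {Γ : List Srt} (p q : STm R Γ .bool) : STm R Γ .bool :=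
  .op₂ (a := .bool) (b := .bool) (c := .bool) trivial trivial trivial
    (fun p q : Prop => p ∧ q) p q

def STm.disj {Γ : List Srt} (p q : STm R Γ .bool) : STm R Γ .bool :=
  .op₂ (a := .bool) (b := .bool) (c := .bool) trivial trivial trivial
    (fun p q : Prop => p ∨ q) p q

def STm.inter {Γ : List Srt} (s t : STm R Γ .set) : STm R Γ .set :=
  .op₂ (a := .set) (b := .set) (c := .set) trivial trivial trivial
    (fun A B : Set R => (A ∩ B : Set R)) s t

def STm.union {Γ : List Srt} (s t : STm R Γ .set) : STm R Γ .set :=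
  .op₂ (a := .set) (b := .set) (c := .set) trivial trivial trivial
    (fun A B : Set R => (A ∪ B : Set R)) s t

/-- The proposition that the union of two role sets is the full set. -/
def STm.cover {Γ : List Srt} (s t : STm R Γ .set) : STm R Γ .bool :=
  .op₂ (a := .set) (b := .set) (c := .bool) trivial trivial trivial
    (fun A B : Set R => A ∪ B = Set.univ) s t

/-- The proposition that two role sets are disjoint. -/
def STm.disjoint {Γ : List Srt} (s t : STm R Γ .set) : STm R Γ .bool :=
  .op₂ (a := .set) (b := .set) (c := .bool) trivial trivial trivial
    (fun A B : Set R => A ∩ B = ∅) s t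

/-- Equality of static terms (in particular of types and of session types) under assumptions: the
congruence generated by beta conversion and by provable equality in the constraint domain. -/
inductive SEq : {Γ : List Srt} → {a : Srt} → List (STm R Γ .bool) → STm R Γ a → STm R Γ a → Prop
  | refl {Γ : List Srt} {a : Srt} {P : List (STm R Γ .bool)} (t : STm R Γ a) : SEq P t t
  | symm {Γ : List Srt} {a : Srt} {P : List (STm R Γ .bool)} {t u : STm R Γ a} :
      SEq P t u → SEq P u t
  | trans {Γ : List Srt} {a : Srt} {P : List (STm R Γ .bool)} {t u w : STm R Γ a} :
      SEq P t u → SEq P u w → SEq P t w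
  | beta {Γ : List Srt} {a b : Srt} {P : List (STm R Γ .bool)} (t : STm R (a :: Γ) b)
      (u : STm R Γ a) : SEq P (.app (.lam t) u) (t.inst u)
  | data {Γ : List Srt} {a : Srt} {P : List (STm R Γ .bool)} {t u : STm R Γ a} (ha : a.Data)
      (h : ∀ v : Env R Γ, (∀ p ∈ P, p.Holds v) → t.eval v = u.eval v) : SEq P t u
  | lam {Γ : List Srt} {a b : Srt} {P : List (STm R Γ .bool)} {t t' : STm R (a :: Γ) b} :
      SEq (P.map (STm.wk a)) t t' → SEq P (.lam t) (.lam t')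
  | app {Γ : List Srt} {a b : Srt} {P : List (STm R Γ .bool)} {t t' : STm R Γ (.arr a b)}
      {u u' : STm R Γ a} : SEq P t t' → SEq P u u' → SEq P (.app t u) (.app t' u')
  | emb {Γ : List Srt} {P : List (STm R Γ .bool)} {t t' : STm R Γ (.ty false)} :
      SEq P t t' → SEq P (.emb t) (.emb t')
  | tint {Γ : List Srt} {P : List (STm R Γ .bool)} {i i' : STm R Γ .int} :
      SEq P i i' → SEq P (.tint i) (.tint i')
  | tbool {Γ : List Srt} {P : List (STm R Γ .bool)} {p p' : STm R Γ .bool} :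
      SEq P p p' → SEq P (.tbool p) (.tbool p')
  | pair {Γ : List Srt} {l : Bool} {P : List (STm R Γ .bool)} {t t' u u' : STm R Γ (.ty l)} :
      SEq P t t' → SEq P u u' → SEq P (.pair t u) (.pair t' u')
  | fn {Γ : List Srt} {l : Bool} {P : List (STm R Γ .bool)} {t t' u u' : STm R Γ (.ty true)} :
      SEq P t t' → SEq P u u' → SEq P (.fn (l := l) t u) (.fn t' u')
  | guard {Γ : List Srt} {l : Bool} {P : List (STm R Γ .bool)} {p p' : STm R Γ .bool}
      {t t' : STm R Γ (.ty l)} : SEq P p p' → SEq P t t' → SEq P (.guard p t) (.guard p' t')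
  | asrt {Γ : List Srt} {l : Bool} {P : List (STm R Γ .bool)} {p p' : STm R Γ .bool}
      {t t' : STm R Γ (.ty l)} : SEq P p p' → SEq P t t' → SEq P (.asrt p t) (.asrt p' t')
  | all {Γ : List Srt} {l : Bool} {a : Srt} {P : List (STm R Γ .bool)}
      {t t' : STm R (a :: Γ) (.ty l)} :
      SEq (P.map (STm.wk a)) t t' → SEq P (.all t) (.all t')
  | ex {Γ : List Srt} {l : Bool} {a : Srt} {P : List (STm R Γ .bool)}
      {t t' : STm R (a :: Γ) (.ty l)} :
      SEq (P.map (STm.wk a)) t t' → SEq P (.ex t) (.ex t')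
  | chan {Γ : List Srt} {P : List (STm R Γ .bool)} {s s' : STm R Γ .set} {π π' : STm R Γ .stype} :
      SEq P s s' → SEq P π π' → SEq P (.chan s π) (.chan s' π')
  | fin {Γ : List Srt} {P : List (STm R Γ .bool)} {r r' : STm R Γ .role} :
      SEq P r r' → SEq P (.fin r) (.fin r')
  | bmsg {Γ : List Srt} {P : List (STm R Γ .bool)} {r r' : STm R Γ .role}
      {t t' : STm R Γ (.ty false)} {π π' : STm R Γ .stype} :
      SEq P r r' → SEq P t t' → SEq P π π' → SEq P (.bmsg r t π) (.bmsg r' t' π')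
  | msg {Γ : List Srt} {P : List (STm R Γ .bool)} {r r' q q' : STm R Γ .role}
      {t t' : STm R Γ (.ty true)} {π π' : STm R Γ .stype} :
      SEq P r r' → SEq P q q' → SEq P t t' → SEq P π π' → SEq P (.msg r q t π) (.msg r' q' t' π')
  | quan {Γ : List Srt} {a : Srt} {P : List (STm R Γ .bool)} {r r' : STm R Γ .role}
      {f f' : STm R Γ (.arr a .stype)} :
      SEq P r r' → SEq P f f' → SEq P (.quan r f) (.quan r' f')

end Statics

/-! # Dynamics: terms -/

/-- Unary term formers. Where a rule of the dynamic semantics depends on the static arguments of a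
term former, they are recorded in the term. -/
inductive UOp (R : Type) (Γ : List Srt) : Type
  | fst | snd
  | guardE
  | asrtI
  | allE (a : Srt) (s : STm R Γ a)
  | exI (a : Srt) (s : STm R Γ a)
  /-- `fork : (unit ⊸ unit) ⇒ unit`, the thread creation without a channel -/
  | spawn
  | fork (rs₁ rs₂ : STm R Γ .set)
  | elim
  | brecv | recv | skip | close | wait
  | unify (a : Srt)
  | exify (a : Srt)

/-- Binary term formers. `arith p f` is a pure function constant on integers, which computes `f` and
is defined on the pairs that satisfy `p`. -/
inductive BOp (R : Type) (Γ : List Srt) : Type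
  | app | pair
  | arith (p : ℤ → ℤ → Prop) (f : ℤ → ℤ → ℤ)
  | bsend | send
  | cut
  | split (rs₁ rs₂ : STm R Γ .set)

/-- Dynamic terms over static variables `Γ` and `n` dynamic variables. A channel is a natural number.
`ep c A` is the endpoint of the channel `c` with roles `A`. `opn c A s` is that endpoint as returned
by `unify`: a universally quantified value still waiting for the (already determined) witness `s`
of the quantifier. -/
inductive Tm (R : Type) : List Srt → ℕ → Type
  | var {Γ : List Srt} {n : ℕ} (i : Fin n) : Tm R Γ n
  | ep {Γ : List Srt} {n : ℕ} (c : ℕ) (A : Set R) : Tm R Γ n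
  | opn {Γ : List Srt} {n : ℕ} {a : Srt} (c : ℕ) (A : Set R) (s : STm R Γ a) : Tm R Γ n
  | unit {Γ : List Srt} {n : ℕ} : Tm R Γ n
  | ilit {Γ : List Srt} {n : ℕ} (k : ℤ) : Tm R Γ n
  | blit {Γ : List Srt} {n : ℕ} (b : Bool) : Tm R Γ n
  | slit {Γ : List Srt} {n : ℕ} (x : String) : Tm R Γ n
  /-- `lam x. e` -/
  | lam {Γ : List Srt} {n : ℕ} (e : Tm R Γ (n + 1)) : Tm R Γ n
  | un {Γ : List Srt} {n : ℕ} (o : UOp R Γ) (e : Tm R Γ n) : Tm R Γ n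
  | bin {Γ : List Srt} {n : ℕ} (o : BOp R Γ) (e₁ e₂ : Tm R Γ n) : Tm R Γ n
  /-- `let ⟨x₁, x₂⟩ = e₁ in e₂` -/
  | letP {Γ : List Srt} {n : ℕ} (e₁ : Tm R Γ n) (e₂ : Tm R Γ (n + 2)) : Tm R Γ n
  /-- `⊃⁺(v)` -/
  | guardI {Γ : List Srt} {n : ℕ} (v : Tm R Γ n) : Tm R Γ n
  /-- `let ∧(x) = e₁ in e₂` -/
  | letA {Γ : List Srt} {n : ℕ} (e₁ : Tm R Γ n) (e₂ : Tm R Γ (n + 1)) : Tm R Γ n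
  /-- `∀⁺(v)`, binding a static variable -/
  | allI {Γ : List Srt} {n : ℕ} (a : Srt) (v : Tm R (a :: Γ) n) : Tm R Γ n
  /-- `let ∃(x) = e₁ in e₂`, binding a static variable and `x` -/
  | letE {Γ : List Srt} {n : ℕ} (a : Srt) (e₁ : Tm R Γ n) (e₂ : Tm R (a :: Γ) (n + 1)) : Tm R Γ n

section Dynamics

variable {R : Type}

def UOp.ssub {Γ Δ : List Srt} (f : SSub R Γ Δ) : UOp R Γ → UOp R Δ
  | .fst => .fst
  | .snd => .snd
  | .guardE => .guardE
  | .asrtI => .asrtI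
  | .allE a s => .allE a (s.sub f)
  | .exI a s => .exI a (s.sub f)
  | .spawn => .spawn
  | .fork s t => .fork (s.sub f) (t.sub f)
  | .elim => .elim
  | .brecv => .brecv
  | .recv => .recv
  | .skip => .skip
  | .close => .close
  | .wait => .wait
  | .unify a => .unify a
  | .exify a => .exify a

def BOp.ssub {Γ Δ : List Srt} (f : SSub R Γ Δ) : BOp R Γ → BOp R Δ
  | .app => .app
  | .pair => .pair
  | .arith p g => .arith p g
  | .bsend => .bsend
  | .send => .send
  | .cut => .cut
  | .split s t => .split (s.sub f) (t.sub f)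

/-- Substitution of static terms in a dynamic term. -/
def Tm.ssub : {Γ : List Srt} → {n : ℕ} → Tm R Γ n → {Δ : List Srt} → SSub R Γ Δ → Tm R Δ n
  | _, _, .var i, _, _ => .var i
  | _, _, .ep c A, _, _ => .ep c A
  | _, _, .opn c A s, _, f => .opn c A (s.sub f)
  | _, _, .unit, _, _ => .unit
  | _, _, .ilit k, _, _ => .ilit k
  | _, _, .blit b, _, _ => .blit b
  | _, _, .slit x, _, _ => .slit x
  | _, _, .lam e, _, f => .lam (e.ssub f)
  | _, _, .un o e, _, f => .un (o.ssub f) (e.ssub f)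
  | _, _, .bin o e₁ e₂, _, f => .bin (o.ssub f) (e₁.ssub f) (e₂.ssub f)
  | _, _, .letP e₁ e₂, _, f => .letP (e₁.ssub f) (e₂.ssub f)
  | _, _, .guardI v, _, f => .guardI (v.ssub f)
  | _, _, .letA e₁ e₂, _, f => .letA (e₁.ssub f) (e₂.ssub f)
  | _, _, .allI a v, _, f => .allI a (v.ssub (f.lift a))
  | _, _, .letE a e₁ e₂, _, f => .letE a (e₁.ssub f) (e₂.ssub (f.lift a))

/-- Weakening by one static variable. -/
def Tm.swk {Γ : List Srt} {n : ℕ} (b : Srt) (e : Tm R Γ n) : Tm R (b :: Γ) n :=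
  e.ssub fun _ x => .var (.s x)

/-- The renaming under one more binder. -/
def liftRen {n m : ℕ} (f : Fin n → Fin m) : Fin (n + 1) → Fin (m + 1) :=
  Fin.cons 0 fun i => (f i).succ

/-- Renaming of dynamic variables. -/
def Tm.ren : {Γ : List Srt} → {n : ℕ} → Tm R Γ n → {m : ℕ} → (Fin n → Fin m) → Tm R Γ m
  | _, _, .var i, _, f => .var (f i)
  | _, _, .ep c A, _, _ => .ep c A
  | _, _, .opn c A s, _, _ => .opn c A s
  | _, _, .unit, _, _ => .unit
  | _, _, .ilit k, _, _ => .ilit k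
  | _, _, .blit b, _, _ => .blit b
  | _, _, .slit x, _, _ => .slit x
  | _, _, .lam e, _, f => .lam (e.ren (liftRen f))
  | _, _, .un o e, _, f => .un o (e.ren f)
  | _, _, .bin o e₁ e₂, _, f => .bin o (e₁.ren f) (e₂.ren f)
  | _, _, .letP e₁ e₂, _, f => .letP (e₁.ren f) (e₂.ren (liftRen (liftRen f)))
  | _, _, .guardI v, _, f => .guardI (v.ren f)
  | _, _, .letA e₁ e₂, _, f => .letA (e₁.ren f) (e₂.ren (liftRen f))
  | _, _, .allI a v, _, f => .allI a (v.ren f)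
  | _, _, .letE a e₁ e₂, _, f => .letE a (e₁.ren f) (e₂.ren (liftRen f))

/-- The substitution under one more binder. -/
def liftSub {Γ : List Srt} {n m : ℕ} (f : Fin n → Tm R Γ m) : Fin (n + 1) → Tm R Γ (m + 1) :=
  Fin.cons (.var 0) fun i => (f i).ren Fin.succ

/-- Simultaneous substitution for dynamic variables. -/
def Tm.sub : {Γ : List Srt} → {n : ℕ} → Tm R Γ n → {m : ℕ} → (Fin n → Tm R Γ m) → Tm R Γ m
  | _, _, .var i, _, f => f i
  | _, _, .ep c A, _, _ => .ep c A
  | _, _, .opn c A s, _, _ => .opn c A s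
  | _, _, .unit, _, _ => .unit
  | _, _, .ilit k, _, _ => .ilit k
  | _, _, .blit b, _, _ => .blit b
  | _, _, .slit x, _, _ => .slit x
  | _, _, .lam e, _, f => .lam (e.sub (liftSub f))
  | _, _, .un o e, _, f => .un o (e.sub f)
  | _, _, .bin o e₁ e₂, _, f => .bin o (e₁.sub f) (e₂.sub f)
  | _, _, .letP e₁ e₂, _, f => .letP (e₁.sub f) (e₂.sub (liftSub (liftSub f)))
  | _, _, .guardI v, _, f => .guardI (v.sub f)
  | _, _, .letA e₁ e₂, _, f => .letA (e₁.sub f) (e₂.sub (liftSub f))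
  | _, _, .allI a v, _, f => .allI a (v.sub fun i => (f i).swk a)
  | _, _, .letE a e₁ e₂, _, f => .letE a (e₁.sub f) (e₂.sub (liftSub fun i => (f i).swk a))

/-- `e[x ↦ v]` for the only dynamic variable `x`. -/
def Tm.inst {Γ : List Srt} (e : Tm R Γ 1) (v : Tm R Γ 0) : Tm R Γ 0 := e.sub fun _ => v

/-- Renaming of channels. -/
def Tm.chren (f : ℕ → ℕ) : {Γ : List Srt} → {n : ℕ} → Tm R Γ n → Tm R Γ n
  | _, _, .var i => .var i
  | _, _, .ep c A => .ep (f c) A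
  | _, _, .opn c A s => .opn (f c) A s
  | _, _, .unit => .unit
  | _, _, .ilit k => .ilit k
  | _, _, .blit b => .blit b
  | _, _, .slit x => .slit x
  | _, _, .lam e => .lam (e.chren f)
  | _, _, .un o e => .un o (e.chren f)
  | _, _, .bin o e₁ e₂ => .bin o (e₁.chren f) (e₂.chren f)
  | _, _, .letP e₁ e₂ => .letP (e₁.chren f) (e₂.chren f)
  | _, _, .guardI v => .guardI (v.chren f)
  | _, _, .letA e₁ e₂ => .letA (e₁.chren f) (e₂.chren f)
  | _, _, .allI a v => .allI a (v.chren f)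
  | _, _, .letE a e₁ e₂ => .letE a (e₁.chren f) (e₂.chren f)

/-- `ρ(e)`: the multiset of all endpoints (channel and role set) that occur in `e`. -/
def Tm.rho : {Γ : List Srt} → {n : ℕ} → Tm R Γ n → Multiset (ℕ × Set R)
  | _, _, .var _ => 0
  | _, _, .ep c A => {(c, A)}
  | _, _, .opn c A _ => {(c, A)}
  | _, _, .unit => 0
  | _, _, .ilit _ => 0
  | _, _, .blit _ => 0
  | _, _, .slit _ => 0
  | _, _, .lam e => e.rho
  | _, _, .un _ e => e.rho
  | _, _, .bin _ e₁ e₂ => e₁.rho + e₂.rho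
  | _, _, .letP e₁ e₂ => e₁.rho + e₂.rho
  | _, _, .guardI v => v.rho
  | _, _, .letA e₁ e₂ => e₁.rho + e₂.rho
  | _, _, .allI _ v => v.rho
  | _, _, .letE _ e₁ e₂ => e₁.rho + e₂.rho

/-- Values. -/
inductive Value : {Γ : List Srt} → {n : ℕ} → Tm R Γ n → Prop
  | var {Γ : List Srt} {n : ℕ} (i : Fin n) : Value (.var i : Tm R Γ n)
  | ep {Γ : List Srt} {n : ℕ} (c : ℕ) (A : Set R) : Value (.ep c A : Tm R Γ n)
  | opn {Γ : List Srt} {n : ℕ} {a : Srt} (c : ℕ) (A : Set R) (s : STm R Γ a) :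
      Value (.opn c A s : Tm R Γ n)
  | unit {Γ : List Srt} {n : ℕ} : Value (.unit : Tm R Γ n)
  | ilit {Γ : List Srt} {n : ℕ} (k : ℤ) : Value (.ilit k : Tm R Γ n)
  | blit {Γ : List Srt} {n : ℕ} (b : Bool) : Value (.blit b : Tm R Γ n)
  | slit {Γ : List Srt} {n : ℕ} (x : String) : Value (.slit x : Tm R Γ n)
  | lam {Γ : List Srt} {n : ℕ} (e : Tm R Γ (n + 1)) : Value (.lam e)
  | pair {Γ : List Srt} {n : ℕ} {v w : Tm R Γ n} : Value v → Value w → Value (.bin .pair v w)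
  | guardI {Γ : List Srt} {n : ℕ} {v : Tm R Γ n} : Value v → Value (.guardI v)
  | asrtI {Γ : List Srt} {n : ℕ} {v : Tm R Γ n} : Value v → Value (.un .asrtI v)
  | allI {Γ : List Srt} {n : ℕ} {a : Srt} {v : Tm R (a :: Γ) n} : Value v → Value (.allI a v)
  | exI {Γ : List Srt} {n : ℕ} {a : Srt} {s : STm R Γ a} {v : Tm R Γ n} :
      Value v → Value (.un (.exI a s) v)

/-! # Typing -/

/-- What a typing context says of a variable: it has a type (a linear one for `l = true`), or it is a
linear variable that is available only elsewhere. -/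
inductive Bnd (R : Type) (Γ : List Srt) : Type
  | has (l : Bool) (t : STm R Γ (.ty l))
  | gone

/-- The non-linear and the linear typing context, merged. -/
abbrev Ctx (R : Type) (Γ : List Srt) (n : ℕ) : Type := Fin n → Bnd R Γ

def Bnd.wk {Γ : List Srt} (b : Srt) : Bnd R Γ → Bnd R (b :: Γ)
  | .has l t => .has l (t.wk b)
  | .gone => .gone

/-- Weakening of a typing context by a static variable. -/
def Ctx.wk {Γ : List Srt} {n : ℕ} (b : Srt) (G : Ctx R Γ n) : Ctx R (b :: Γ) n :=
  fun i => (G i).wk b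

/-- Extension of a typing context: a variable of a non-linear type goes to the non-linear part, a
variable of a linear type to the linear part. -/
def Ctx.cons {Γ : List Srt} {n : ℕ} (G : Ctx R Γ n) {l : Bool} (t : STm R Γ (.ty l)) :
    Ctx R Γ (n + 1) :=
  Fin.cons (.has l t) G

/-- The linear part of the context is empty. -/
def Ctx.Unr {Γ : List Srt} {n : ℕ} (G : Ctx R Γ n) : Prop := ∀ i t, G i ≠ .has true t

inductive Bnd.Split {Γ : List Srt} : Bnd R Γ → Bnd R Γ → Bnd R Γ → Prop
  | nonlin (t : STm R Γ (.ty false)) : Bnd.Split (.has false t) (.has false t) (.has false t)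
  | left (t : STm R Γ (.ty true)) : Bnd.Split (.has true t) (.has true t) .gone
  | right (t : STm R Γ (.ty true)) : Bnd.Split (.has true t) .gone (.has true t)
  | gone : Bnd.Split .gone .gone .gone

/-- Both parts share the non-linear variables; every linear variable goes to exactly one part. -/
def Ctx.Split {Γ : List Srt} {n : ℕ} (G G₁ G₂ : Ctx R Γ n) : Prop :=
  ∀ i, Bnd.Split (G i) (G₁ i) (G₂ i)

/-- A signature: it assigns a closed session type to (some of) the channels. -/
abbrev Sig (R : Type) : Type := ℕ → Option (STm R [] .stype)

/-- The unit type as a linear type. -/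
abbrev unitT {Γ : List Srt} : STm R Γ (.ty true) := .emb .unit

/-- The typing judgement `Σ; P; Γ; Δ ⊢ e : τ` under the signature `S`. -/
inductive HasTy (S : Sig R) : {Γ : List Srt} → {n : ℕ} → List (STm R Γ .bool) → Ctx R Γ n →
    Tm R Γ n → STm R Γ (.ty true) → Prop
  | conv {Γ : List Srt} {n : ℕ} {P : List (STm R Γ .bool)} {G : Ctx R Γ n} {e : Tm R Γ n}
      {t u : STm R Γ (.ty true)} : HasTy S P G e t → SEq P t u → HasTy S P G e u
  | var {Γ : List Srt} {n : ℕ} {P : List (STm R Γ .bool)} {G : Ctx R Γ n} {i : Fin n} {l : Bool}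
      {t : STm R Γ (.ty l)} (hi : G i = .has l t) (hG : ∀ j, j ≠ i → ∀ u, G j ≠ .has true u) :
      HasTy S P G (.var i) t.up
  -- an endpoint has the session type of its channel
  | ep {Γ : List Srt} {n : ℕ} {P : List (STm R Γ .bool)} {G : Ctx R Γ n} {c : ℕ} {A : Set R}
      {π : STm R [] .stype} (hG : G.Unr) (hc : S c = some π) :
      HasTy S P G (.ep c A) (.chan (.setLit A) (π.wkc Γ))
  -- after `unify`, the channel follows `f(s)`
  | opn {Γ : List Srt} {n : ℕ} {P : List (STm R Γ .bool)} {G : Ctx R Γ n} {c : ℕ} {A : Set R}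
      {a : Srt} {s : STm R Γ a} {f : STm R Γ (.arr a .stype)} {π : STm R [] .stype} (hG : G.Unr)
      (hc : S c = some π) (hf : SEq P (π.wkc Γ) (.app f s)) :
      HasTy S P G (.opn c A s) (.all (.chan (.setLit A) (.app (f.wk a) (.var .z))))
  | unit {Γ : List Srt} {n : ℕ} {P : List (STm R Γ .bool)} {G : Ctx R Γ n} (hG : G.Unr) :
      HasTy S P G .unit unitT
  | ilit {Γ : List Srt} {n : ℕ} {P : List (STm R Γ .bool)} {G : Ctx R Γ n} (hG : G.Unr) (k : ℤ) :
      HasTy S P G (.ilit k) (.emb (.tint (.intLit k)))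
  | blit {Γ : List Srt} {n : ℕ} {P : List (STm R Γ .bool)} {G : Ctx R Γ n} (hG : G.Unr) (b : Bool) :
      HasTy S P G (.blit b) (.emb (.tbool (.cst .bool trivial (b = true))))
  | slit {Γ : List Srt} {n : ℕ} {P : List (STm R Γ .bool)} {G : Ctx R Γ n} (hG : G.Unr)
      (x : String) : HasTy S P G (.slit x) (.emb .tstr)
  | arith {Γ : List Srt} {n : ℕ} {P : List (STm R Γ .bool)} {G G₁ G₂ : Ctx R Γ n}
      {p : ℤ → ℤ → Prop} {f : ℤ → ℤ → ℤ} {e₁ e₂ : Tm R Γ n} {i j : STm R Γ .int}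
      (hG : G.Split G₁ G₂)
      (hp : Entails P (.op₂ (a := .int) (b := .int) (c := .bool) trivial trivial trivial p i j)) :
      HasTy S P G₁ e₁ (.emb (.tint i)) → HasTy S P G₂ e₂ (.emb (.tint j)) →
      HasTy S P G (.bin (.arith p f) e₁ e₂)
        (.emb (.tint (.op₂ (a := .int) (b := .int) (c := .int) trivial trivial trivial f i j)))
  -- a non-linear function captures no linear variable and no resource
  | lam {Γ : List Srt} {n : ℕ} {P : List (STm R Γ .bool)} {G : Ctx R Γ n} {e : Tm R Γ (n + 1)}
      {l k : Bool} {t : STm R Γ (.ty k)} {u : STm R Γ (.ty true)}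
      (hl : l = false → G.Unr ∧ e.rho = 0) :
      HasTy S P (G.cons t) e u → HasTy S P G (.lam e) (STm.fn (l := l) t.up u).up
  | app {Γ : List Srt} {n : ℕ} {P : List (STm R Γ .bool)} {G G₁ G₂ : Ctx R Γ n} {e₁ e₂ : Tm R Γ n}
      {l : Bool} {t u : STm R Γ (.ty true)} (hG : G.Split G₁ G₂) :
      HasTy S P G₁ e₁ (STm.fn (l := l) t u).up → HasTy S P G₂ e₂ t →
      HasTy S P G (.bin .app e₁ e₂) u
  | pair {Γ : List Srt} {n : ℕ} {P : List (STm R Γ .bool)} {G G₁ G₂ : Ctx R Γ n} {e₁ e₂ : Tm R Γ n}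
      {l : Bool} {t u : STm R Γ (.ty l)} (hG : G.Split G₁ G₂) :
      HasTy S P G₁ e₁ t.up → HasTy S P G₂ e₂ u.up →
      HasTy S P G (.bin .pair e₁ e₂) (STm.pair t u).up
  | fst {Γ : List Srt} {n : ℕ} {P : List (STm R Γ .bool)} {G : Ctx R Γ n} {e : Tm R Γ n}
      {t u : STm R Γ (.ty false)} :
      HasTy S P G e (.emb (.pair t u)) → HasTy S P G (.un .fst e) (.emb t)
  | snd {Γ : List Srt} {n : ℕ} {P : List (STm R Γ .bool)} {G : Ctx R Γ n} {e : Tm R Γ n}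
      {t u : STm R Γ (.ty false)} :
      HasTy S P G e (.emb (.pair t u)) → HasTy S P G (.un .snd e) (.emb u)
  -- in the three `let` rules, `t'` is a component type `t`, possibly seen as a non-linear type
  | letP {Γ : List Srt} {n : ℕ} {P : List (STm R Γ .bool)} {G G₁ G₂ : Ctx R Γ n} {e₁ : Tm R Γ n}
      {e₂ : Tm R Γ (n + 2)} {l l₁ l₂ : Bool} {t₁ t₂ : STm R Γ (.ty l)} {t₁' : STm R Γ (.ty l₁)}
      {t₂' : STm R Γ (.ty l₂)} {u : STm R Γ (.ty true)} (hG : G.Split G₁ G₂)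
      (h₁ : t₁'.up = t₁.up) (h₂ : t₂'.up = t₂.up) :
      HasTy S P G₁ e₁ (STm.pair t₁ t₂).up → HasTy S P ((G₂.cons t₁').cons t₂') e₂ u →
      HasTy S P G (.letP e₁ e₂) u
  | guardI {Γ : List Srt} {n : ℕ} {P : List (STm R Γ .bool)} {G : Ctx R Γ n} {v : Tm R Γ n}
      {p : STm R Γ .bool} {l : Bool} {t : STm R Γ (.ty l)} (hv : Value v) :
      HasTy S (p :: P) G v t.up → HasTy S P G (.guardI v) (STm.guard p t).up
  | guardE {Γ : List Srt} {n : ℕ} {P : List (STm R Γ .bool)} {G : Ctx R Γ n} {e : Tm R Γ n}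
      {p : STm R Γ .bool} {l : Bool} {t : STm R Γ (.ty l)} (hp : Entails P p) :
      HasTy S P G e (STm.guard p t).up → HasTy S P G (.un .guardE e) t.up
  | asrtI {Γ : List Srt} {n : ℕ} {P : List (STm R Γ .bool)} {G : Ctx R Γ n} {e : Tm R Γ n}
      {p : STm R Γ .bool} {l : Bool} {t : STm R Γ (.ty l)} (hp : Entails P p) :
      HasTy S P G e t.up → HasTy S P G (.un .asrtI e) (STm.asrt p t).up
  | letA {Γ : List Srt} {n : ℕ} {P : List (STm R Γ .bool)} {G G₁ G₂ : Ctx R Γ n} {e₁ : Tm R Γ n}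
      {e₂ : Tm R Γ (n + 1)} {p : STm R Γ .bool} {l l' : Bool} {t : STm R Γ (.ty l)}
      {t' : STm R Γ (.ty l')} {u : STm R Γ (.ty true)} (hG : G.Split G₁ G₂) (h : t'.up = t.up) :
      HasTy S P G₁ e₁ (STm.asrt p t).up → HasTy S (p :: P) (G₂.cons t') e₂ u →
      HasTy S P G (.letA e₁ e₂) u
  | allI {Γ : List Srt} {n : ℕ} {P : List (STm R Γ .bool)} {G : Ctx R Γ n} {a : Srt}
      {v : Tm R (a :: Γ) n} {l : Bool} {t : STm R (a :: Γ) (.ty l)} (hv : Value v) :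
      HasTy S (P.map (STm.wk a)) (G.wk a) v t.up → HasTy S P G (.allI a v) (STm.all t).up
  | allE {Γ : List Srt} {n : ℕ} {P : List (STm R Γ .bool)} {G : Ctx R Γ n} {e : Tm R Γ n}
      {a : Srt} {s : STm R Γ a} {l : Bool} {t : STm R (a :: Γ) (.ty l)} :
      HasTy S P G e (STm.all t).up → HasTy S P G (.un (.allE a s) e) (t.inst s).up
  | exI {Γ : List Srt} {n : ℕ} {P : List (STm R Γ .bool)} {G : Ctx R Γ n} {e : Tm R Γ n}
      {a : Srt} {s : STm R Γ a} {l : Bool} {t : STm R (a :: Γ) (.ty l)} :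
      HasTy S P G e (t.inst s).up → HasTy S P G (.un (.exI a s) e) (STm.ex t).up
  | letE {Γ : List Srt} {n : ℕ} {P : List (STm R Γ .bool)} {G G₁ G₂ : Ctx R Γ n} {a : Srt}
      {e₁ : Tm R Γ n} {e₂ : Tm R (a :: Γ) (n + 1)} {l l' : Bool} {t : STm R (a :: Γ) (.ty l)}
      {t' : STm R (a :: Γ) (.ty l')} {u : STm R Γ (.ty true)} (hG : G.Split G₁ G₂)
      (h : t'.up = t.up) :
      HasTy S P G₁ e₁ (STm.ex t).up →
      HasTy S (P.map (STm.wk a)) ((G₂.wk a).cons t') e₂ (u.wk a) →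
      HasTy S P G (.letE a e₁ e₂) u
  | spawn {Γ : List Srt} {n : ℕ} {P : List (STm R Γ .bool)} {G : Ctx R Γ n} {e : Tm R Γ n} :
      HasTy S P G e (.fn unitT unitT) → HasTy S P G (.un .spawn e) unitT
  | fork {Γ : List Srt} {n : ℕ} {P : List (STm R Γ .bool)} {G : Ctx R Γ n} {e : Tm R Γ n}
      {rs₁ rs₂ : STm R Γ .set} {π : STm R Γ .stype}
      (h : Entails P (.conj (.disjoint rs₁ rs₂) (.cover rs₁ rs₂))) :
      HasTy S P G e (.fn (.chan rs₁ π) unitT) → HasTy S P G (.un (.fork rs₁ rs₂) e) (.chan rs₂ π)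
  | cut {Γ : List Srt} {n : ℕ} {P : List (STm R Γ .bool)} {G G₁ G₂ : Ctx R Γ n} {e₁ e₂ : Tm R Γ n}
      {rs₁ rs₂ : STm R Γ .set} {π : STm R Γ .stype} (hG : G.Split G₁ G₂)
      (h : Entails P (.cover rs₁ rs₂)) :
      HasTy S P G₁ e₁ (.chan rs₁ π) → HasTy S P G₂ e₂ (.chan rs₂ π) →
      HasTy S P G (.bin .cut e₁ e₂) (.chan (.inter rs₁ rs₂) π)
  | elim {Γ : List Srt} {n : ℕ} {P : List (STm R Γ .bool)} {G : Ctx R Γ n} {e : Tm R Γ n}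
      {π : STm R Γ .stype} :
      HasTy S P G e (.chan (.setLit ∅) π) → HasTy S P G (.un .elim e) unitT
  | split {Γ : List Srt} {n : ℕ} {P : List (STm R Γ .bool)} {G G₁ G₂ : Ctx R Γ n}
      {e₁ e₂ : Tm R Γ n} {rs₁ rs₂ : STm R Γ .set} {π : STm R Γ .stype} (hG : G.Split G₁ G₂)
      (h : Entails P (.disjoint rs₁ rs₂)) :
      HasTy S P G₁ e₁ (.chan (.union rs₁ rs₂) π) →
      HasTy S P G₂ e₂ (.fn (.chan rs₁ π) unitT) →
      HasTy S P G (.bin (.split rs₁ rs₂) e₁ e₂) (.chan rs₂ π)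
  | bsend {Γ : List Srt} {n : ℕ} {P : List (STm R Γ .bool)} {G G₁ G₂ : Ctx R Γ n}
      {e₁ e₂ : Tm R Γ n} {rs : STm R Γ .set} {r : STm R Γ .role} {π : STm R Γ .stype}
      {t : STm R Γ (.ty false)} (hG : G.Split G₁ G₂) (h : Entails P (.mem r rs)) :
      HasTy S P G₁ e₁ (.chan rs (.bmsg r t π)) → HasTy S P G₂ e₂ (.emb t) →
      HasTy S P G (.bin .bsend e₁ e₂) (.chan rs π)
  | brecv {Γ : List Srt} {n : ℕ} {P : List (STm R Γ .bool)} {G : Ctx R Γ n} {e : Tm R Γ n}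
      {rs : STm R Γ .set} {r : STm R Γ .role} {π : STm R Γ .stype} {t : STm R Γ (.ty false)}
      (h : Entails P (.notMem r rs)) :
      HasTy S P G e (.chan rs (.bmsg r t π)) →
      HasTy S P G (.un .brecv e) (.pair (.chan rs π) (.emb t))
  | send {Γ : List Srt} {n : ℕ} {P : List (STm R Γ .bool)} {G G₁ G₂ : Ctx R Γ n}
      {e₁ e₂ : Tm R Γ n} {rs : STm R Γ .set} {r₁ r₂ : STm R Γ .role} {π : STm R Γ .stype}
      {t : STm R Γ (.ty true)} (hG : G.Split G₁ G₂)
      (h : Entails P (.conj (.mem r₁ rs) (.notMem r₂ rs))) :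
      HasTy S P G₁ e₁ (.chan rs (.msg r₁ r₂ t π)) → HasTy S P G₂ e₂ t →
      HasTy S P G (.bin .send e₁ e₂) (.chan rs π)
  | recv {Γ : List Srt} {n : ℕ} {P : List (STm R Γ .bool)} {G : Ctx R Γ n} {e : Tm R Γ n}
      {rs : STm R Γ .set} {r₁ r₂ : STm R Γ .role} {π : STm R Γ .stype} {t : STm R Γ (.ty true)}
      (h : Entails P (.conj (.notMem r₁ rs) (.mem r₂ rs))) :
      HasTy S P G e (.chan rs (.msg r₁ r₂ t π)) →
      HasTy S P G (.un .recv e) (.pair (.chan rs π) t)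
  | skip {Γ : List Srt} {n : ℕ} {P : List (STm R Γ .bool)} {G : Ctx R Γ n} {e : Tm R Γ n}
      {rs : STm R Γ .set} {r₁ r₂ : STm R Γ .role} {π : STm R Γ .stype} {t : STm R Γ (.ty true)}
      (h : Entails P (.disj (.conj (.mem r₁ rs) (.mem r₂ rs))
        (.conj (.notMem r₁ rs) (.notMem r₂ rs)))) :
      HasTy S P G e (.chan rs (.msg r₁ r₂ t π)) → HasTy S P G (.un .skip e) (.chan rs π)
  | close {Γ : List Srt} {n : ℕ} {P : List (STm R Γ .bool)} {G : Ctx R Γ n} {e : Tm R Γ n}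
      {rs : STm R Γ .set} {r : STm R Γ .role} (h : Entails P (.mem r rs)) :
      HasTy S P G e (.chan rs (.fin r)) → HasTy S P G (.un .close e) unitT
  | wait {Γ : List Srt} {n : ℕ} {P : List (STm R Γ .bool)} {G : Ctx R Γ n} {e : Tm R Γ n}
      {rs : STm R Γ .set} {r : STm R Γ .role} (h : Entails P (.notMem r rs)) :
      HasTy S P G e (.chan rs (.fin r)) → HasTy S P G (.un .wait e) unitT
  | unify {Γ : List Srt} {n : ℕ} {P : List (STm R Γ .bool)} {G : Ctx R Γ n} {e : Tm R Γ n} {a : Srt}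
      {rs : STm R Γ .set} {r : STm R Γ .role} {f : STm R Γ (.arr a .stype)}
      (h : Entails P (.mem r rs)) :
      HasTy S P G e (.chan rs (.quan r f)) →
      HasTy S P G (.un (.unify a) e) (.all (.chan (rs.wk a) (.app (f.wk a) (.var .z))))
  | exify {Γ : List Srt} {n : ℕ} {P : List (STm R Γ .bool)} {G : Ctx R Γ n} {e : Tm R Γ n} {a : Srt}
      {rs : STm R Γ .set} {r : STm R Γ .role} {f : STm R Γ (.arr a .stype)}
      (h : Entails P (.notMem r rs)) :
      HasTy S P G e (.chan rs (.quan r f)) →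
      HasTy S P G (.un (.exify a) e) (.ex (.chan (rs.wk a) (.app (f.wk a) (.var .z))))

/-! # Reduction of a single thread -/

/-- Closed terms. -/
abbrev CTm (R : Type) : Type := Tm R [] 0

/-- Contraction of the redexes that concern only one thread. -/
inductive Contract : CTm R → CTm R → Prop
  | beta {e : Tm R [] 1} {v : CTm R} : Value v → Contract (.bin .app (.lam e) v) (e.inst v)
  | letP {v w : CTm R} {e : Tm R [] 2} : Value v → Value w →
      Contract (.letP (.bin .pair v w) e) (e.sub ![w, v])
  | fst {v w : CTm R} : Value v → Value w → Contract (.un .fst (.bin .pair v w)) v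
  | snd {v w : CTm R} : Value v → Value w → Contract (.un .snd (.bin .pair v w)) w
  | guard {v : CTm R} : Value v → Contract (.un .guardE (.guardI v)) v
  | asrt {v : CTm R} {e : Tm R [] 1} : Value v → Contract (.letA (.un .asrtI v) e) (e.inst v)
  | all {a : Srt} {s : STm R [] a} {v : Tm R [a] 0} : Value v →
      Contract (.un (.allE a s) (.allI a v)) (v.ssub (SSub.single s))
  | allOpn {a : Srt} {s : STm R [] a} {c : ℕ} {A : Set R} :
      Contract (.un (.allE a s) (.opn c A s)) (.ep c A)
  | ex {a : Srt} {s : STm R [] a} {v : CTm R} {e : Tm R [a] 1} : Value v →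
      Contract (.letE a (.un (.exI a s) v) e) ((e.ssub (SSub.single s)).inst v)
  | arith {p : ℤ → ℤ → Prop} {f : ℤ → ℤ → ℤ} {i j : ℤ} : p i j →
      Contract (.bin (.arith p f) (.ilit i) (.ilit j)) (.ilit (f i j))

/-- One layer of a call-by-value, left-to-right evaluation context. -/
inductive Frame (R : Type) : Type
  | un (o : UOp R [])
  | binL (o : BOp R []) (e : CTm R)
  | binR (o : BOp R []) (v : CTm R) (hv : Value v)
  | letP (e : Tm R [] 2)
  | letA (e : Tm R [] 1)
  | letE (a : Srt) (e : Tm R [a] 1)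

def Frame.fill : Frame R → CTm R → CTm R
  | .un o, x => .un o x
  | .binL o e, x => .bin o x e
  | .binR o v _, x => .bin o v x
  | .letP e, x => .letP x e
  | .letA e, x => .letA x e
  | .letE a e, x => .letE a x e

/-- Evaluation contexts, with the outermost layer first. -/
abbrev ECtx (R : Type) : Type := List (Frame R)

/-- `E[e]` -/
def ECtx.plug (E : ECtx R) (e : CTm R) : CTm R := E.foldr Frame.fill e

/-! # Thread pools -/

/-- A thread pool: the term `thr t` runs in the thread `t ∈ dom`. -/
structure Pool (R : Type) : Type where
  dom : Finset ℕ
  thr : ℕ → CTm R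

/-- Typing of pools. -/
def Pool.HasTy (S : Sig R) (Q : Pool R) (t : STm R [] (.ty true)) : Prop :=
  0 ∈ Q.dom ∧ MPST.HasTy S [] Fin.elim0 (Q.thr 0) t ∧
    ∀ i ∈ Q.dom, i ≠ 0 → MPST.HasTy S [] Fin.elim0 (Q.thr i) unitT

/-- A pool is well-typed if it has some type under some signature. -/
def Pool.WellTyped (Q : Pool R) : Prop := ∃ S t, Q.HasTy S t

/-- All endpoints in a pool. -/
def Pool.rho (Q : Pool R) : Multiset (ℕ × Set R) := ∑ t ∈ Q.dom, (Q.thr t).rho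

/-- All endpoints of the channel `c` in a pool. -/
def Pool.endpoints (Q : Pool R) (c : ℕ) : Multiset (ℕ × Set R) := Q.rho.filter fun x => x.1 = c

/-- The channel `c` does not occur in the pool. -/
def Pool.Fresh (Q : Pool R) (c : ℕ) : Prop := Q.endpoints c = 0

/-- Set the thread `t` (present or new) to `e`. -/
def Pool.set (Q : Pool R) (t : ℕ) (e : CTm R) : Pool R where
  dom := insert t Q.dom
  thr := Function.update Q.thr t e

/-- Remove the thread `t`. -/
def Pool.del (Q : Pool R) (t : ℕ) : Pool R where
  dom := Q.dom.erase t
  thr := Q.thr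

/-- Replace the terms of the threads in `T`. -/
def Pool.upd (Q : Pool R) (T : Finset ℕ) (f : ℕ → CTm R) : Pool R where
  dom := Q.dom
  thr t := if t ∈ T then f t else Q.thr t

/-- Rename the channels in all threads. -/
def Pool.chren (Q : Pool R) (f : ℕ → ℕ) : Pool R where
  dom := Q.dom
  thr t := (Q.thr t).chren f

/-- What a partial redex wants to do with its endpoint. -/
inductive Act (R : Type) : Type
  | bsend (v : CTm R) | brecv
  | send (v : CTm R) | recv | skip
  | close | wait
  | unify (a : Srt) | exify (a : Srt)

/-- The partial redex of the action on the endpoint of `c` with roles `A`. -/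
def Act.redex (c : ℕ) (A : Set R) : Act R → CTm R
  | .bsend v => .bin .bsend (.ep c A) v
  | .brecv => .un .brecv (.ep c A)
  | .send v => .bin .send (.ep c A) v
  | .recv => .un .recv (.ep c A)
  | .skip => .un .skip (.ep c A)
  | .close => .un .close (.ep c A)
  | .wait => .un .wait (.ep c A)
  | .unify a => .un (.unify a) (.ep c A)
  | .exify a => .un (.exify a) (.ep c A)

/-- The message, if there is one, is a value. -/
def Act.Valid : Act R → Prop
  | .bsend v => Value v
  | .send v => Value v
  | _ => True

/-- A term that is blocked: a partial redex in an evaluation context. -/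
def Blocked (e : CTm R) : Prop :=
  ∃ (E : ECtx R) (c : ℕ) (A : Set R) (a : Act R), a.Valid ∧ e = E.plug (a.redex c A)

/-- The threads in `T` are blocked, each `t ∈ T` with the action `a t` on the endpoint of `c` with
roles `A t`; these are all the endpoints of `c` in the pool, and their role sets partition the full
role set (blocks may be empty). -/
structure Pool.AllBlockedOn (Q : Pool R) (c : ℕ) (T : Finset ℕ) (E : ℕ → ECtx R) (A : ℕ → Set R)
    (a : ℕ → Act R) : Prop where
  nonempty : T.Nonempty
  sub : T ⊆ Q.dom
  valid : ∀ t ∈ T, (a t).Valid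
  thr : ∀ t ∈ T, Q.thr t = (E t).plug ((a t).redex c (A t))
  endpoints : Q.endpoints c = T.val.map fun t => (c, A t)
  partition : ∀ r : R, ∃! t, t ∈ T ∧ r ∈ A t

/-- One thread broadcasts and all others receive. -/
def IsBcast (T : Finset ℕ) (a : ℕ → Act R) (t₁ : ℕ) (v : CTm R) : Prop :=
  t₁ ∈ T ∧ a t₁ = .bsend v ∧ ∀ t ∈ T, t ≠ t₁ → a t = .brecv

/-- One thread sends, another one receives, and all others skip. -/
def IsMsg (T : Finset ℕ) (a : ℕ → Act R) (t₁ t₂ : ℕ) (v : CTm R) : Prop :=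
  t₁ ∈ T ∧ t₂ ∈ T ∧ t₁ ≠ t₂ ∧ a t₁ = .send v ∧ a t₂ = .recv ∧
    ∀ t ∈ T, t ≠ t₁ → t ≠ t₂ → a t = .skip

/-- All threads skip: sender and receiver of the message are played by the same endpoint. -/
def IsSkip (T : Finset ℕ) (a : ℕ → Act R) : Prop := ∀ t ∈ T, a t = .skip

/-- One thread closes and all others wait. -/
def IsEnd (T : Finset ℕ) (a : ℕ → Act R) (t₁ : ℕ) : Prop :=
  t₁ ∈ T ∧ a t₁ = .close ∧ ∀ t ∈ T, t ≠ t₁ → a t = .wait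

/-- One thread interprets the quantifier as universal and all others as existential. -/
def IsQuan (T : Finset ℕ) (a : ℕ → Act R) (t₁ : ℕ) (b : Srt) : Prop :=
  t₁ ∈ T ∧ a t₁ = .unify b ∧ ∀ t ∈ T, t ≠ t₁ → a t = .exify b

/-- The actions of the threads in `T` match. -/
def Matching (T : Finset ℕ) (a : ℕ → Act R) : Prop :=
  (∃ t₁ v, IsBcast T a t₁ v) ∨ (∃ t₁ t₂ v, IsMsg T a t₁ t₂ v) ∨ IsSkip T a ∨
    (∃ t₁, IsEnd T a t₁) ∨ ∃ t₁ b, IsQuan T a t₁ b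

/-- The threads `T` of the pool hold a matching set of partial redexes on all endpoints of one
channel. -/
def Pool.Match (Q : Pool R) (T : Finset ℕ) : Prop :=
  ∃ c E A a, Q.AllBlockedOn c T E A a ∧ Matching T a

/-- Pool reduction. -/
inductive Step : Pool R → Pool R → Prop
  | lift {Q : Pool R} {t : ℕ} {E : ECtx R} {e e' : CTm R} (ht : t ∈ Q.dom)
      (h : Q.thr t = E.plug e) (he : Contract e e') : Step Q (Q.set t (E.plug e'))
  | gc {Q : Pool R} {t : ℕ} (ht : t ∈ Q.dom) (h0 : t ≠ 0) (h : Q.thr t = .unit) : Step Q (Q.del t)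
  | spawn {Q : Pool R} {t t' : ℕ} {E : ECtx R} {e : Tm R [] 1} (ht : t ∈ Q.dom)
      (ht' : t' ∉ Q.dom) (h : Q.thr t = E.plug (.un .spawn (.lam e))) :
      Step Q ((Q.set t (E.plug .unit)).set t' (e.inst .unit))
  | fork {Q : Pool R} {t t' c : ℕ} {E : ECtx R} {e : Tm R [] 1} {rs₁ rs₂ : STm R [] .set}
      (ht : t ∈ Q.dom) (ht' : t' ∉ Q.dom) (hc : Q.Fresh c)
      (h : Q.thr t = E.plug (.un (.fork rs₁ rs₂) (.lam e))) :
      Step Q ((Q.set t (E.plug (.ep c rs₂.val))).set t' (e.inst (.ep c rs₁.val)))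
  | cut {Q : Pool R} {t c₁ c₂ c : ℕ} {E : ECtx R} {A₁ A₂ : Set R} (ht : t ∈ Q.dom)
      (hne : c₁ ≠ c₂) (hc : Q.Fresh c)
      (h : Q.thr t = E.plug (.bin .cut (.ep c₁ A₁) (.ep c₂ A₂))) :
      Step Q ((Q.set t (E.plug (.ep c (A₁ ∩ A₂)))).chren
        fun x => if x = c₁ ∨ x = c₂ then c else x)
  | cutComm {Q : Pool R} {t : ℕ} {E : ECtx R} {v w : CTm R} (ht : t ∈ Q.dom) (hv : Value v)
      (hw : Value w) (h : Q.thr t = E.plug (.bin .cut v w)) :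
      Step Q (Q.set t (E.plug (.bin .cut w v)))
  | elim {Q : Pool R} {t c : ℕ} {E : ECtx R} (ht : t ∈ Q.dom)
      (h : Q.thr t = E.plug (.un .elim (.ep c ∅))) : Step Q (Q.set t (E.plug .unit))
  | split {Q : Pool R} {t t' c : ℕ} {E : ECtx R} {e : Tm R [] 1} {rs₁ rs₂ : STm R [] .set}
      {A : Set R} (ht : t ∈ Q.dom) (ht' : t' ∉ Q.dom) (hA : A = (STm.union rs₁ rs₂).val)
      (h : Q.thr t = E.plug (.bin (.split rs₁ rs₂) (.ep c A) (.lam e))) :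
      Step Q ((Q.set t (E.plug (.ep c rs₂.val))).set t' (e.inst (.ep c rs₁.val)))
  | bmsg {Q : Pool R} {c t₁ : ℕ} {T : Finset ℕ} {E : ℕ → ECtx R} {A : ℕ → Set R} {a : ℕ → Act R}
      {v : CTm R} (h : Q.AllBlockedOn c T E A a) (hm : IsBcast T a t₁ v) :
      Step Q (Q.upd T fun t => (E t).plug
        (if t = t₁ then .ep c (A t) else .bin .pair (.ep c (A t)) v))
  | msg {Q : Pool R} {c t₁ t₂ : ℕ} {T : Finset ℕ} {E : ℕ → ECtx R} {A : ℕ → Set R} {a : ℕ → Act R}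
      {v : CTm R} (h : Q.AllBlockedOn c T E A a) (hm : IsMsg T a t₁ t₂ v) :
      Step Q (Q.upd T fun t => (E t).plug
        (if t = t₂ then .bin .pair (.ep c (A t)) v else .ep c (A t)))
  | skip {Q : Pool R} {c : ℕ} {T : Finset ℕ} {E : ℕ → ECtx R} {A : ℕ → Set R} {a : ℕ → Act R}
      (h : Q.AllBlockedOn c T E A a) (hm : IsSkip T a) :
      Step Q (Q.upd T fun t => (E t).plug (.ep c (A t)))
  | fin {Q : Pool R} {c t₁ : ℕ} {T : Finset ℕ} {E : ℕ → ECtx R} {A : ℕ → Set R} {a : ℕ → Act R}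
      (h : Q.AllBlockedOn c T E A a) (hm : IsEnd T a t₁) :
      Step Q (Q.upd T fun t => (E t).plug .unit)
  -- the witness `s` is the one with which the universal side will instantiate the quantifier
  | quan {Q : Pool R} {c t₁ : ℕ} {T : Finset ℕ} {E : ℕ → ECtx R} {A : ℕ → Set R} {a : ℕ → Act R}
      {b : Srt} (h : Q.AllBlockedOn c T E A a) (hm : IsQuan T a t₁ b) (s : STm R [] b) :
      Step Q (Q.upd T fun t => (E t).plug
        (if t = t₁ then .opn c (A t) s else .un (.exI b s) (.ep c (A t))))

end Dynamics

end MPST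

/-! Reduction preserves three properties of a pool, collected in `Pool.Inv`: the pool is typed under
some signature; the role sets of the endpoints of each channel in use partition `R`; and the
bipartite multigraph whose vertices are threads and channels and whose edges are endpoints has no
cycle. Initially there are no endpoints, so the last two hold vacuously (`Pool.WellTyped.inv`), and
`Step.inv` carries all three through each step.

Acyclicity is expressed by degrees. A finite multigraph is a forest exactly when every nonempty set
of its edges has a vertex of degree one, so the forbidden configuration is a nonempty edge set
without such a vertex (`IsCore`). Every pool step is then a small operation on the graph: a vertex
is split in two, two neighbours of a thread are merged, edges are moved from one neighbour of a
channel to another, or edges are deleted. In each case a core of the new graph gives one of the old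
graph, after the choice of the few edges involved, and the verification is arithmetic of degrees.

Deadlock is excluded by `Acyc.exists_channel`. Every thread with an endpoint is blocked on one of
its own channels. If each channel `c` had a neighbour `g c` blocked on a different channel, then
following `c` to the channel on which `g c` is blocked would, by finiteness, eventually run in a
circle, which is a cycle of the graph. Hence all neighbours of some channel are blocked on it.
Acyclicity also prevents a thread from holding two endpoints of one channel, so these threads
account for all its endpoints. Their actions are typed at the same session type: its head fixes the
kind of action, and membership of the mentioned roles in the role set fixes the side. As the role
sets partition `R`, each mentioned role lies in exactly one of them, and the actions match
(`matching_of_hasTy`).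

Preservation of typing rests on two facts. First, type equality is generated by beta and by truth in
the constraint domain, so injectivity and distinctness of type formers are not evident; they follow
from a logical relation over weak head reduction (`SEq.rel`). Secondly, endpoints are neither copied
nor lost. The judgement `Ty` replaces splitting of contexts by counting of occurrences, `Tm.rho_sub`
computes the endpoints after a substitution, and values of non-linear types hold no endpoints
(`Ty.rho_eq_zero`). -/

namespace MPST

variable {R : Type}

/-! ## Renaming and substitution of static terms -/

theorem STm.ren_ren {Γ : List Srt} {a : Srt} (t : STm R Γ a) {Δ Θ : List Srt} (f : SRen Γ Δ)
    (g : SRen Δ Θ) : (t.ren f).ren g = t.ren fun b x => g b (f b x) := by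
  have hl : ∀ {Γ Δ Θ : List Srt} (f : SRen Γ Δ) (g : SRen Δ Θ) (c : Srt),
      (fun b x => g.lift c b (f.lift c b x)) = SRen.lift (fun b x => g b (f b x)) c := by
    intro Γ Δ Θ f g c; funext b x; cases x <;> rfl
  induction t generalizing Δ Θ with
  | _ => simp only [STm.ren, *]

theorem STm.ren_eq_sub {Γ : List Srt} {a : Srt} (t : STm R Γ a) {Δ : List Srt} (f : SRen Γ Δ) :
    t.ren f = t.sub fun b x => .var (f b x) := by
  have hl : ∀ {Γ Δ : List Srt} (f : SRen Γ Δ) (c : Srt),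
      SSub.lift (fun b x => (.var (f b x) : STm R Δ b)) c = fun b x => .var (f.lift c b x) := by
    intro Γ Δ f c; funext b x; cases x <;> rfl
  induction t generalizing Δ with
  | _ => simp only [STm.ren, STm.sub, *]

theorem STm.sub_ren {Γ : List Srt} {a : Srt} (t : STm R Γ a) {Δ Θ : List Srt} (f : SRen Γ Δ)
    (g : SSub R Δ Θ) : (t.ren f).sub g = t.sub fun b x => g b (f b x) := by
  have hl : ∀ {Γ Δ Θ : List Srt} (f : SRen Γ Δ) (g : SSub R Δ Θ) (c : Srt),
      (fun b x => g.lift c b (f.lift c b x)) = SSub.lift (fun b x => g b (f b x)) c := by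
    intro Γ Δ Θ f g c; funext b x; cases x <;> rfl
  induction t generalizing Δ Θ with
  | _ => simp only [STm.ren, STm.sub, *]

theorem STm.ren_sub {Γ : List Srt} {a : Srt} (t : STm R Γ a) {Δ Θ : List Srt} (f : SSub R Γ Δ)
    (g : SRen Δ Θ) : (t.sub f).ren g = t.sub fun b x => (f b x).ren g := by
  have hl : ∀ {Γ Δ Θ : List Srt} (f : SSub R Γ Δ) (g : SRen Δ Θ) (c : Srt),
      (fun b x => (f.lift c b x).ren (g.lift c)) = SSub.lift (fun b x => (f b x).ren g) c := by
    intro Γ Δ Θ f g c; funext b x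
    cases x with
    | z => rfl
    | s x => simp [SSub.lift, STm.wk, STm.ren_ren, SRen.lift]
  induction t generalizing Δ Θ with
  | _ => simp only [STm.ren, STm.sub, *]

theorem SSub.lift_comp {Γ Δ Θ : List Srt} (f : SSub R Γ Δ) (g : SSub R Δ Θ) (c : Srt) :
    (fun b x => (f.lift c b x).sub (g.lift c)) = SSub.lift (fun b x => (f b x).sub g) c := by
  funext b x
  cases x with
  | z => rfl
  | s x => simp [SSub.lift, STm.wk, STm.sub_ren, STm.ren_sub]

theorem STm.sub_sub {Γ : List Srt} {a : Srt} (t : STm R Γ a) {Δ Θ : List Srt} (f : SSub R Γ Δ)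
    (g : SSub R Δ Θ) : (t.sub f).sub g = t.sub fun b x => (f b x).sub g := by
  induction t generalizing Δ Θ with
  | _ => simp only [STm.sub, SSub.lift_comp, *]

theorem SSub.lift_var {Γ : List Srt} (c : Srt) :
    SSub.lift (fun b x => (.var x : STm R Γ b)) c = fun _ x => .var x := by
  funext b x; cases x <;> rfl

theorem STm.sub_var {Γ : List Srt} {a : Srt} (t : STm R Γ a) : t.sub (fun _ x => .var x) = t := by
  induction t with
  | _ => simp only [STm.sub, SSub.lift_var, *]

theorem STm.wk_eq_sub {Γ : List Srt} {a : Srt} (b : Srt) (t : STm R Γ a) :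
    t.wk b = t.sub fun _ x => .var (.s x) := t.ren_eq_sub _

theorem STm.wk_sub_lift {Γ Δ : List Srt} {a : Srt} (b : Srt) (t : STm R Γ a) (σ : SSub R Γ Δ) :
    (t.wk b).sub (σ.lift b) = (t.sub σ).wk b := by
  simp [STm.wk, STm.sub_ren, STm.ren_sub, SSub.lift]

/-- Extension of a substitution by a static term. -/
def SSub.cons {Γ Δ : List Srt} {b : Srt} (s : STm R Δ b) (σ : SSub R Γ Δ) : SSub R (b :: Γ) Δ
  | _, .z => s
  | _, .s x => σ _ x

/-- This puts the contractum of a beta redex under a substitution into the form of an extended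
substitution, on which inductions over open terms can proceed. -/
theorem STm.lift_inst {Γ Δ : List Srt} {a b : Srt} (t : STm R (b :: Γ) a) (σ : SSub R Γ Δ)
    (s : STm R Δ b) : (t.sub (σ.lift b)).inst s = t.sub (SSub.cons s σ) := by
  rw [STm.inst, STm.sub_sub]
  congr 1; funext c x
  cases x with
  | z => rfl
  | s x => simp [SSub.lift, STm.wk, STm.sub_ren, SSub.single, SSub.cons, STm.sub_var]

theorem STm.inst_sub {Γ Δ : List Srt} {a b : Srt} (t : STm R (b :: Γ) a) (σ : SSub R Γ Δ)
    (s : STm R Γ b) : (t.inst s).sub σ = (t.sub (σ.lift b)).inst (s.sub σ) := by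
  rw [STm.lift_inst, STm.inst, STm.sub_sub]
  congr 1; funext c x; cases x <;> rfl

theorem STm.wk_inst {Γ : List Srt} {a b : Srt} (t : STm R Γ a) (s : STm R Γ b) :
    (t.wk b).inst s = t := by
  simp [STm.wk, STm.inst, STm.sub_ren, SSub.single, STm.sub_var]

theorem STm.sub_nil {a : Srt} (t : STm R [] a) (σ : SSub R [] []) : t.sub σ = t := by
  have : σ = fun _ x => .var x := by funext b x; cases x
  rw [this, STm.sub_var]

theorem STm.wkc_sub {Γ Δ : List Srt} {a : Srt} (t : STm R [] a) (σ : SSub R Γ Δ) :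
    (t.wkc Γ).sub σ = t.wkc Δ := by
  rw [STm.wkc, STm.wkc, STm.sub_ren, STm.ren_eq_sub]
  congr 1; funext c x; cases x

theorem STm.wkc_nil {a : Srt} (t : STm R [] a) : t.wkc [] = t := by
  rw [STm.wkc, STm.ren_eq_sub, STm.sub_nil]

theorem STm.up_sub {Γ Δ : List Srt} {l : Bool} (t : STm R Γ (.ty l)) (σ : SSub R Γ Δ) :
    t.up.sub σ = (t.sub σ).up := by cases l <;> rfl

/-! ## Evaluation and substitution -/

theorem STm.eval_ren {Γ : List Srt} {a : Srt} (t : STm R Γ a) {Δ : List Srt} (f : SRen Γ Δ)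
    (v : Env R Δ) : (t.ren f).eval v = t.eval fun b x => v b (f b x) := by
  have hl : ∀ {Γ Δ : List Srt} (f : SRen Γ Δ) (c : Srt) (d : c.Den R) (v : Env R Δ),
      (fun b x => Env.cons d v b (f.lift c b x)) = Env.cons d fun b x => v b (f b x) := by
    intro Γ Δ f c d v; funext b x; cases x <;> rfl
  induction t generalizing Δ with
  | _ => simp only [STm.ren, STm.eval, *] <;> rfl

theorem STm.eval_wk {Γ : List Srt} {a b : Srt} (t : STm R Γ a) (d : b.Den R) (v : Env R Γ) :
    (t.wk b).eval (Env.cons d v) = t.eval v := by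
  rw [STm.wk, STm.eval_ren]; rfl

theorem STm.eval_wk' {Γ : List Srt} {a b : Srt} (t : STm R Γ a) (v : Env R (b :: Γ)) :
    (t.wk b).eval v = t.eval fun c x => v c (.s x) := by
  rw [STm.wk, STm.eval_ren]

theorem STm.eval_sub {Γ : List Srt} {a : Srt} (t : STm R Γ a) {Δ : List Srt} (f : SSub R Γ Δ)
    (v : Env R Δ) : (t.sub f).eval v = t.eval fun b x => (f b x).eval v := by
  have hl : ∀ {Γ Δ : List Srt} (f : SSub R Γ Δ) (c : Srt) (d : c.Den R) (v : Env R Δ),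
      (fun b x => (f.lift c b x).eval (Env.cons d v)) = Env.cons d fun b x => (f b x).eval v := by
    intro Γ Δ f c d v; funext b x
    cases x with
    | z => rfl
    | s x => simp [SSub.lift, STm.eval_wk, Env.cons]
  induction t generalizing Δ with
  | _ => simp only [STm.sub, STm.eval, *] <;> rfl

theorem STm.eval_inst {Γ : List Srt} {a b : Srt} (t : STm R (b :: Γ) a) (s : STm R Γ b)
    (v : Env R Γ) : (t.inst s).eval v = t.eval (Env.cons (s.eval v) v) := by
  rw [STm.inst, STm.eval_sub]
  congr 1; funext c x; cases x <;> rfl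

theorem STm.eval_nil {a : Srt} (t : STm R [] a) (v : Env R []) : t.eval v = t.val := by
  rw [STm.val]; congr 1; funext c x; cases x

/-- The assumptions `Q` entail the assumptions `P` under the substitution `σ`. -/
def EntailsSub {Γ Δ : List Srt} (P : List (STm R Γ .bool)) (Q : List (STm R Δ .bool))
    (σ : SSub R Γ Δ) : Prop := ∀ p ∈ P, Entails Q (p.sub σ)

theorem EntailsSub.holds {Γ Δ : List Srt} {P : List (STm R Γ .bool)} {Q : List (STm R Δ .bool)}
    {σ : SSub R Γ Δ} (h : EntailsSub P Q σ) {v : Env R Δ} (hv : ∀ q ∈ Q, q.Holds v) :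
    ∀ p ∈ P, p.Holds fun b x => (σ b x).eval v := by
  intro p hp
  have := h p hp v hv
  rwa [STm.Holds, STm.eval_sub] at this

theorem EntailsSub.lift {Γ Δ : List Srt} {P : List (STm R Γ .bool)} {Q : List (STm R Δ .bool)}
    {σ : SSub R Γ Δ} (h : EntailsSub P Q σ) (b : Srt) :
    EntailsSub (P.map (STm.wk b)) (Q.map (STm.wk b)) (σ.lift b) := by
  intro p hp v hv
  obtain ⟨p, hp', rfl⟩ := List.mem_map.1 hp
  rw [STm.wk_sub_lift, STm.Holds, STm.eval_wk']
  refine h p hp' _ fun q hq => ?_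
  have := hv _ (List.mem_map_of_mem hq)
  rwa [STm.Holds, STm.eval_wk'] at this

theorem EntailsSub.entails {Γ Δ : List Srt} {P : List (STm R Γ .bool)} {Q : List (STm R Δ .bool)}
    {σ : SSub R Γ Δ} (h : EntailsSub P Q σ) {p : STm R Γ .bool} (hp : Entails P p) :
    Entails Q (p.sub σ) := by
  intro v hv
  rw [STm.Holds, STm.eval_sub]
  exact hp _ (h.holds hv)

theorem EntailsSub.cons {Γ Δ : List Srt} {P : List (STm R Γ .bool)} {Q : List (STm R Δ .bool)}
    {σ : SSub R Γ Δ} (h : EntailsSub P Q σ) (p : STm R Γ .bool) :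
    EntailsSub (p :: P) (p.sub σ :: Q) σ := by
  intro q hq v hv
  rcases List.mem_cons.1 hq with rfl | hq
  · exact hv _ (List.mem_cons_self)
  · exact h q hq v fun r hr => hv r (List.mem_cons_of_mem _ hr)

theorem EntailsSub.wk {Γ : List Srt} (P : List (STm R Γ .bool)) (b : Srt) :
    EntailsSub P (P.map (STm.wk b)) fun _ x => .var (.s x) := by
  intro p hp v hv
  rw [← STm.wk_eq_sub]
  exact hv _ (List.mem_map_of_mem hp)

theorem EntailsSub.nil {Γ Δ : List Srt} (Q : List (STm R Δ .bool)) (σ : SSub R Γ Δ) :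
    EntailsSub [] Q σ := by intro p hp; simp at hp

theorem entails_nil {p : STm R [] .bool} : Entails [] p ↔ p.val := by
  constructor
  · intro h; exact h (fun _ x => nomatch x) (by simp)
  · intro h v _; rw [STm.Holds, STm.eval_nil]; exact h

/-! ## Substitution and equality of static terms -/

/-- The data rule is the only one that looks at the assumptions: a valuation of the target
satisfying `Q` pulls back along `σ` to a valuation satisfying `P`. -/
theorem SEq.sub {Γ : List Srt} {a : Srt} {P : List (STm R Γ .bool)} {t u : STm R Γ a}
    (h : SEq P t u) {Δ : List Srt} {Q : List (STm R Δ .bool)} {σ : SSub R Γ Δ}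
    (hσ : EntailsSub P Q σ) : SEq Q (t.sub σ) (u.sub σ) := by
  induction h generalizing Δ with
  | refl t => exact .refl _
  | symm _ ih => exact (ih hσ).symm
  | trans _ _ ih₁ ih₂ => exact (ih₁ hσ).trans (ih₂ hσ)
  | beta t u => rw [STm.inst_sub]; exact .beta _ _
  | data ha h =>
    refine .data ha fun v hv => ?_
    rw [STm.eval_sub, STm.eval_sub]; exact h _ (hσ.holds hv)
  | lam _ ih => exact .lam (ih (hσ.lift _))
  | app _ _ ih₁ ih₂ => exact .app (ih₁ hσ) (ih₂ hσ)
  | emb _ ih => exact .emb (ih hσ)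
  | tint _ ih => exact .tint (ih hσ)
  | tbool _ ih => exact .tbool (ih hσ)
  | pair _ _ ih₁ ih₂ => exact .pair (ih₁ hσ) (ih₂ hσ)
  | fn _ _ ih₁ ih₂ => exact .fn (ih₁ hσ) (ih₂ hσ)
  | guard _ _ ih₁ ih₂ => exact .guard (ih₁ hσ) (ih₂ hσ)
  | asrt _ _ ih₁ ih₂ => exact .asrt (ih₁ hσ) (ih₂ hσ)
  | all _ ih => exact .all (ih (hσ.lift _))
  | ex _ ih => exact .ex (ih (hσ.lift _))
  | chan _ _ ih₁ ih₂ => exact .chan (ih₁ hσ) (ih₂ hσ)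
  | fin _ ih => exact .fin (ih hσ)
  | bmsg _ _ _ ih₁ ih₂ ih₃ => exact .bmsg (ih₁ hσ) (ih₂ hσ) (ih₃ hσ)
  | msg _ _ _ _ ih₁ ih₂ ih₃ ih₄ => exact .msg (ih₁ hσ) (ih₂ hσ) (ih₃ hσ) (ih₄ hσ)
  | quan _ _ ih₁ ih₂ => exact .quan (ih₁ hσ) (ih₂ hσ)

theorem SEq.wk {Γ : List Srt} {a : Srt} {P : List (STm R Γ .bool)} {t u : STm R Γ a}
    (h : SEq P t u) (b : Srt) : SEq (P.map (STm.wk b)) (t.wk b) (u.wk b) := by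
  rw [STm.wk_eq_sub, STm.wk_eq_sub]; exact h.sub (EntailsSub.wk P b)

theorem SEq.wkc {a : Srt} {t u : STm R [] a} (h : SEq [] t u) {Γ : List Srt}
    (P : List (STm R Γ .bool)) : SEq P (t.wkc Γ) (u.wkc Γ) := by
  rw [STm.wkc, STm.wkc, STm.ren_eq_sub, STm.ren_eq_sub]; exact h.sub (EntailsSub.nil _ _)

theorem SEq.inst {a b : Srt} {t u : STm R [b] a} (h : SEq [] t u) (s : STm R [] b) :
    SEq [] (t.inst s) (u.inst s) := h.sub (EntailsSub.nil _ _)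

theorem SEq.up {Γ : List Srt} {P : List (STm R Γ .bool)} {l : Bool} {t u : STm R Γ (.ty l)}
    (h : SEq P t u) : SEq P t.up u.up := by
  cases l
  · exact .emb h
  · exact h

theorem SEq.sub_congr {Γ : List Srt} {a : Srt} (t : STm R Γ a) {Δ : List Srt}
    {Q : List (STm R Δ .bool)} {σ σ' : SSub R Γ Δ} (hσ : ∀ b x, SEq Q (σ b x) (σ' b x)) :
    SEq Q (t.sub σ) (t.sub σ') := by
  have hl : ∀ {Γ Δ : List Srt} {Q : List (STm R Δ .bool)} {σ σ' : SSub R Γ Δ} (c : Srt),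
      (∀ b x, SEq Q (σ b x) (σ' b x)) →
      ∀ b x, SEq (Q.map (STm.wk c)) (σ.lift c b x) (σ'.lift c b x) := by
    intro Γ Δ Q σ σ' c h b x
    cases x with
    | z => exact .refl _
    | s x => exact (h _ x).wk c
  induction t generalizing Δ with
  | var x => exact hσ _ x
  | lam _ ih => exact .lam (ih (hl _ hσ))
  | app _ _ ih₁ ih₂ => exact .app (ih₁ hσ) (ih₂ hσ)
  | cst => exact .refl _
  | emb _ ih => exact .emb (ih hσ)
  | unit => exact .refl _
  | tint _ ih => exact .tint (ih hσ)
  | tbool _ ih => exact .tbool (ih hσ)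
  | tstr => exact .refl _
  | pair _ _ ih₁ ih₂ => exact .pair (ih₁ hσ) (ih₂ hσ)
  | fn _ _ ih₁ ih₂ => exact .fn (ih₁ hσ) (ih₂ hσ)
  | guard _ _ ih₁ ih₂ => exact .guard (ih₁ hσ) (ih₂ hσ)
  | asrt _ _ ih₁ ih₂ => exact .asrt (ih₁ hσ) (ih₂ hσ)
  | all _ ih => exact .all (ih (hl _ hσ))
  | ex _ ih => exact .ex (ih (hl _ hσ))
  | chan _ _ ih₁ ih₂ => exact .chan (ih₁ hσ) (ih₂ hσ)
  | fin _ ih => exact .fin (ih hσ)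
  | bmsg _ _ _ ih₁ ih₂ ih₃ => exact .bmsg (ih₁ hσ) (ih₂ hσ) (ih₃ hσ)
  | msg _ _ _ _ ih₁ ih₂ ih₃ ih₄ => exact .msg (ih₁ hσ) (ih₂ hσ) (ih₃ hσ) (ih₄ hσ)
  | quan _ _ ih₁ ih₂ => exact .quan (ih₁ hσ) (ih₂ hσ)

/-- Soundness of equality for the standard model. Through it, equal role sets, roles and
propositions inside types become equal mathematical objects. -/
theorem SEq.eval_eq {Γ : List Srt} {a : Srt} {P : List (STm R Γ .bool)} {t u : STm R Γ a}
    (h : SEq P t u) (v : Env R Γ) (hv : ∀ p ∈ P, p.Holds v) : t.eval v = u.eval v := by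
  induction h with
  | refl t => rfl
  | symm _ ih => exact (ih v hv).symm
  | trans _ _ ih₁ ih₂ => exact (ih₁ v hv).trans (ih₂ v hv)
  | beta t u => rw [STm.eval_inst]; rfl
  | data ha h => exact h v hv
  | lam _ ih =>
    funext d
    refine ih _ fun p hp => ?_
    obtain ⟨p, hp', rfl⟩ := List.mem_map.1 hp
    rw [STm.Holds, STm.eval_wk]; exact hv p hp'
  | app _ _ ih₁ ih₂ => simp only [STm.eval]; rw [ih₁ v hv, ih₂ v hv]
  | _ => rfl

theorem SEq.val_eq {a : Srt} {t u : STm R [] a} (h : SEq [] t u) : t.val = u.val :=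
  h.eval_eq _ (by simp)

/-! ## Weak head reduction of closed static terms -/

/-- One step of weak head reduction. -/
inductive WH : {a : Srt} → STm R [] a → STm R [] a → Prop
  | beta {a b : Srt} (t : STm R [a] b) (u : STm R [] a) : WH (.app (.lam t) u) (t.inst u)
  | app {a b : Srt} {t t' : STm R [] (.arr a b)} (u : STm R [] a) :
      WH t t' → WH (.app t u) (.app t' u)

theorem WH.det {a : Srt} {t u w : STm R [] a} (h : WH t u) (h' : WH t w) : u = w := by
  induction h with
  | beta t u =>
    cases h' with
    | beta => rfl
    | app _ h => cases h
  | app u h ih =>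
    cases h' with
    | beta => cases h
    | app _ h' => rw [ih h']

theorem WH.val_eq {a : Srt} {t u : STm R [] a} (h : WH t u) : t.val = u.val := by
  induction h with
  | beta t u => exact (SEq.beta t u).val_eq
  | app u _ ih =>
    simp only [STm.val, STm.eval] at ih ⊢
    rw [ih]

/-- Two closed types or session types with the same head and equal components. -/
inductive HeadEq : {a : Srt} → STm R [] a → STm R [] a → Prop
  | emb {t t' : STm R [] (.ty false)} : SEq [] t t' → HeadEq (.emb t) (.emb t')
  | unit : HeadEq .unit .unit
  | tint {i i' : STm R [] .int} : SEq [] i i' → HeadEq (.tint i) (.tint i')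
  | tbool {p p' : STm R [] .bool} : SEq [] p p' → HeadEq (.tbool p) (.tbool p')
  | tstr : HeadEq .tstr .tstr
  | pair {l : Bool} {t t' u u' : STm R [] (.ty l)} :
      SEq [] t t' → SEq [] u u' → HeadEq (.pair t u) (.pair t' u')
  | fn {l : Bool} {t t' u u' : STm R [] (.ty true)} :
      SEq [] t t' → SEq [] u u' → HeadEq (.fn (l := l) t u) (.fn t' u')
  | guard {l : Bool} {p p' : STm R [] .bool} {t t' : STm R [] (.ty l)} :
      SEq [] p p' → SEq [] t t' → HeadEq (.guard p t) (.guard p' t')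
  | asrt {l : Bool} {p p' : STm R [] .bool} {t t' : STm R [] (.ty l)} :
      SEq [] p p' → SEq [] t t' → HeadEq (.asrt p t) (.asrt p' t')
  | all {l : Bool} {a : Srt} {t t' : STm R [a] (.ty l)} :
      SEq [] t t' → HeadEq (.all t) (.all t')
  | ex {l : Bool} {a : Srt} {t t' : STm R [a] (.ty l)} :
      SEq [] t t' → HeadEq (.ex t) (.ex t')
  | chan {s s' : STm R [] .set} {π π' : STm R [] .stype} :
      SEq [] s s' → SEq [] π π' → HeadEq (.chan s π) (.chan s' π')
  | fin {r r' : STm R [] .role} : SEq [] r r' → HeadEq (.fin r) (.fin r')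
  | bmsg {r r' : STm R [] .role} {t t' : STm R [] (.ty false)} {π π' : STm R [] .stype} :
      SEq [] r r' → SEq [] t t' → SEq [] π π' → HeadEq (.bmsg r t π) (.bmsg r' t' π')
  | msg {r r' q q' : STm R [] .role} {t t' : STm R [] (.ty true)} {π π' : STm R [] .stype} :
      SEq [] r r' → SEq [] q q' → SEq [] t t' → SEq [] π π' →
      HeadEq (.msg r q t π) (.msg r' q' t' π')
  | quan {a : Srt} {r r' : STm R [] .role} {f f' : STm R [] (.arr a .stype)} :
      SEq [] r r' → SEq [] f f' → HeadEq (.quan r f) (.quan r' f')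

theorem HeadEq.symm {a : Srt} {t u : STm R [] a} (h : HeadEq t u) : HeadEq u t := by
  cases h with
  | emb h => exact .emb h.symm
  | unit => exact .unit
  | tint h => exact .tint h.symm
  | tbool h => exact .tbool h.symm
  | tstr => exact .tstr
  | pair h₁ h₂ => exact .pair h₁.symm h₂.symm
  | fn h₁ h₂ => exact .fn h₁.symm h₂.symm
  | guard h₁ h₂ => exact .guard h₁.symm h₂.symm
  | asrt h₁ h₂ => exact .asrt h₁.symm h₂.symm
  | all h => exact .all h.symm
  | ex h => exact .ex h.symm
  | chan h₁ h₂ => exact .chan h₁.symm h₂.symm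
  | fin h => exact .fin h.symm
  | bmsg h₁ h₂ h₃ => exact .bmsg h₁.symm h₂.symm h₃.symm
  | msg h₁ h₂ h₃ h₄ => exact .msg h₁.symm h₂.symm h₃.symm h₄.symm
  | quan h₁ h₂ => exact .quan h₁.symm h₂.symm

theorem HeadEq.trans {a : Srt} {t u w : STm R [] a} (h : HeadEq t u) (h' : HeadEq u w) :
    HeadEq t w := by
  cases h with
  | emb h => cases h' with | emb k => exact .emb (h.trans k)
  | unit => exact h'
  | tint h => cases h' with | tint k => exact .tint (h.trans k)
  | tbool h => cases h' with | tbool k => exact .tbool (h.trans k)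
  | tstr => exact h'
  | pair h₁ h₂ => cases h' with | pair k₁ k₂ => exact .pair (h₁.trans k₁) (h₂.trans k₂)
  | fn h₁ h₂ => cases h' with | fn k₁ k₂ => exact .fn (h₁.trans k₁) (h₂.trans k₂)
  | guard h₁ h₂ => cases h' with | guard k₁ k₂ => exact .guard (h₁.trans k₁) (h₂.trans k₂)
  | asrt h₁ h₂ => cases h' with | asrt k₁ k₂ => exact .asrt (h₁.trans k₁) (h₂.trans k₂)
  | all h => cases h' with | all k => exact .all (h.trans k)
  | ex h => cases h' with | ex k => exact .ex (h.trans k)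
  | chan h₁ h₂ => cases h' with | chan k₁ k₂ => exact .chan (h₁.trans k₁) (h₂.trans k₂)
  | fin h => cases h' with | fin k => exact .fin (h.trans k)
  | bmsg h₁ h₂ h₃ =>
    cases h' with | bmsg k₁ k₂ k₃ => exact .bmsg (h₁.trans k₁) (h₂.trans k₂) (h₃.trans k₃)
  | msg h₁ h₂ h₃ h₄ =>
    cases h' with
    | msg k₁ k₂ k₃ k₄ => exact .msg (h₁.trans k₁) (h₂.trans k₂) (h₃.trans k₃) (h₄.trans k₄)
  | quan h₁ h₂ => cases h' with | quan k₁ k₂ => exact .quan (h₁.trans k₁) (h₂.trans k₂)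

theorem HeadEq.not_wh {a : Srt} {t u w : STm R [] a} (h : HeadEq t u) : ¬ WH t w := by
  intro h'
  cases h' <;> cases h

/-- Two closed static terms reduce to terms with the same head and equal components. -/
def HeadRel {a : Srt} (t u : STm R [] a) : Prop :=
  ∃ h h', Relation.ReflTransGen WH t h ∧ Relation.ReflTransGen WH u h' ∧ HeadEq h h'

theorem HeadEq.rel {a : Srt} {t u : STm R [] a} (h : HeadEq t u) : HeadRel t u :=
  ⟨t, u, .refl, .refl, h⟩

theorem HeadRel.symm {a : Srt} {t u : STm R [] a} : HeadRel t u → HeadRel u t := by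
  rintro ⟨h, h', H, H', e⟩
  exact ⟨h', h, H', H, e.symm⟩

/-- Head forms are irreducible and weak head reduction is deterministic, so a term reaches at most
one head form. -/
theorem HeadEq.of_reduces {a : Srt} {t u w w' : STm R [] a} (h : Relation.ReflTransGen WH t u)
    (h' : Relation.ReflTransGen WH t w) (hu : HeadEq u u) (hw : HeadEq w w') : u = w := by
  induction h using Relation.ReflTransGen.head_induction_on with
  | refl =>
    rcases h'.cases_head with h' | ⟨x, hx, _⟩
    · exact h'
    · exact absurd hx hu.not_wh
  | head hx _ ih =>
    rcases h'.cases_head with rfl | ⟨y, hy, h'⟩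
    · exact absurd hx hw.not_wh
    · exact ih (by rwa [hx.det hy])

theorem HeadRel.trans {a : Srt} {t u w : STm R [] a} :
    HeadRel t u → HeadRel u w → HeadRel t w := by
  rintro ⟨h, h', H, H', e⟩ ⟨k, k', K, K', e'⟩
  obtain rfl := HeadEq.of_reduces H' K (e.symm.trans e) e'
  exact ⟨h, k', H, K', e.trans e'⟩

/-- A term that is already a head form reduces only to itself. -/
theorem HeadRel.headEq {a : Srt} {t u t' u' : STm R [] a} (h : HeadRel t u) (ht : HeadEq t t')
    (hu : HeadEq u u') : HeadEq t u := by
  obtain ⟨k, k', K, K', e⟩ := h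
  obtain rfl := HeadEq.of_reduces K .refl (e.trans e.symm) ht
  obtain rfl := HeadEq.of_reduces K' .refl (e.symm.trans e) hu
  exact e

/-! ## A logical relation for the equality of closed static terms -/

/-- The logical relation. -/
def Rel : (a : Srt) → STm R [] a → STm R [] a → Prop
  | .ty _, t, u => HeadRel t u
  | .stype, t, u => HeadRel t u
  -- Equality of values is demanded because a function sort may be a data sort. Arguments must be
  -- provably equal as well as related, since the components of head forms are compared by `SEq` and
  -- not by the relation itself.
  | .arr a b, t, u => t.val = u.val ∧
      ∀ s s', Rel a s s' → SEq [] s s' → Rel b (.app t s) (.app u s')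
  | .int, t, u => t.val = u.val
  | .bool, t, u => t.val = u.val
  | .role, t, u => t.val = u.val
  | .set, t, u => t.val = u.val

theorem Rel.val_eq {a : Srt} {t u : STm R [] a} (h : Rel a t u) : t.val = u.val := by
  cases a with
  | ty l => rfl
  | stype => rfl
  | arr a b => exact h.1
  | _ => exact h

/-- At a data sort the relation is no finer than the model, also for functions; this handles the
constants and the data rule of equality. -/
theorem Rel.of_val_eq {a : Srt} (ha : a.Data) {t u : STm R [] a} (h : t.val = u.val) :
    Rel a t u := by
  induction a with
  | ty l => exact ha.elim
  | stype => exact ha.elim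
  | arr a b _ ih =>
    refine ⟨h, fun s s' hs _ => ih ha.2 ?_⟩
    have := hs.val_eq
    simp only [STm.val, STm.eval] at h this ⊢
    rw [h, this]
  | _ => exact h

theorem Rel.symm {a : Srt} {t u : STm R [] a} (h : Rel a t u) : Rel a u t := by
  induction a with
  | ty l => exact HeadRel.symm h
  | stype => exact HeadRel.symm h
  | arr a b iha ihb => exact ⟨h.1.symm, fun s s' hs e => ihb (h.2 _ _ (iha hs) e.symm)⟩
  | _ => exact Eq.symm h

theorem Rel.trans {a : Srt} {t u w : STm R [] a} (h : Rel a t u) (h' : Rel a u w) :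
    Rel a t w := by
  induction a with
  | ty l => exact HeadRel.trans h h'
  | stype => exact HeadRel.trans h h'
  | arr a b iha ihb =>
    exact ⟨h.1.trans h'.1, fun s s' hs e => ihb (h.2 _ _ (iha hs hs.symm) (.refl _)) (h'.2 _ _ hs e)⟩
  | _ => exact Eq.trans h h'

/-- Closure under weak head expansion, the property that makes beta redexes and abstractions
related. -/
theorem Rel.wh {a : Srt} {t t' u : STm R [] a} (h : WH t t') (h' : Rel a t' u) : Rel a t u := by
  induction a with
  | ty l => obtain ⟨k, k', K, K', e⟩ := h'; exact ⟨k, k', .head h K, K', e⟩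
  | stype => obtain ⟨k, k', K, K', e⟩ := h'; exact ⟨k, k', .head h K, K', e⟩
  | arr a b iha ihb =>
    exact ⟨h.val_eq.trans h'.1, fun s s' hs e => ihb (.app s h) (h'.2 s s' hs e)⟩
  | _ => exact h.val_eq.trans h'

/-- Related closed substitutions. -/
def RelSub {Γ : List Srt} (σ σ' : SSub R Γ []) : Prop :=
  ∀ b x, Rel b (σ b x) (σ' b x) ∧ SEq [] (σ b x) (σ' b x)

theorem RelSub.symm {Γ : List Srt} {σ σ' : SSub R Γ []} (h : RelSub σ σ') : RelSub σ' σ :=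
  fun b x => ⟨(h b x).1.symm, (h b x).2.symm⟩

theorem RelSub.left {Γ : List Srt} {σ σ' : SSub R Γ []} (h : RelSub σ σ') : RelSub σ σ :=
  fun b x => ⟨(h b x).1.trans (h b x).1.symm, .refl _⟩

theorem RelSub.cons {Γ : List Srt} {σ σ' : SSub R Γ []} (h : RelSub σ σ') {b : Srt}
    {s s' : STm R [] b} (hs : Rel b s s') (e : SEq [] s s') :
    RelSub (SSub.cons s σ) (SSub.cons s' σ') := by
  intro c x
  cases x with
  | z => exact ⟨hs, e⟩
  | s x => exact h _ x

theorem RelSub.seq {Γ : List Srt} {σ σ' : SSub R Γ []} (h : RelSub σ σ') {a : Srt}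
    (t : STm R Γ a) : SEq [] (t.sub σ) (t.sub σ') := SEq.sub_congr t fun b x => (h b x).2

theorem RelSub.lift {Γ : List Srt} {σ σ' : SSub R Γ []} (h : RelSub σ σ') (b : Srt) {a : Srt}
    (t : STm R (b :: Γ) a) : SEq [] (t.sub (σ.lift b)) (t.sub (σ'.lift b)) := by
  refine SEq.sub_congr t fun c x => ?_
  cases x with
  | z => exact .refl _
  | s x => exact ((h _ x).2.wk b)

/-- Applied to an argument, each abstraction weak head reduces to its body under the extended
substitution; expansion on both sides gives the claim. -/
theorem Rel.lam {Γ : List Srt} {σ σ' : SSub R Γ []} {a b : Srt} {t t' : STm R (a :: Γ) b}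
    (h : ∀ s s', Rel a s s' → SEq [] s s' →
      Rel b (t.sub (SSub.cons s σ)) (t'.sub (SSub.cons s' σ')))
    (he : SEq [] ((STm.lam t).sub σ) ((STm.lam t').sub σ')) :
    Rel (.arr a b) ((STm.lam t).sub σ) ((STm.lam t').sub σ') := by
  refine ⟨he.val_eq, fun s s' hs e => ?_⟩
  have := h s s' hs e
  rw [← STm.lift_inst, ← STm.lift_inst] at this
  exact Rel.wh (.beta _ _) (Rel.symm (Rel.wh (.beta _ _) this.symm))

/-- Every term maps related substitutions to related results. At type formers only provable equality
of the components is needed, and this comes from the second half of `RelSub`. -/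
theorem Rel.refl_sub {Γ : List Srt} {a : Srt} (t : STm R Γ a) {σ σ' : SSub R Γ []}
    (h : RelSub σ σ') : Rel a (t.sub σ) (t.sub σ') := by
  induction t with
  | var x => exact (h _ x).1
  | lam t ih => exact Rel.lam (fun s s' hs e => ih (h.cons hs e)) (h.seq _)
  | app t u ih₁ ih₂ => exact (ih₁ h).2 _ _ (ih₂ h) (h.seq u)
  | cst a ha d => exact Rel.of_val_eq ha rfl
  | emb t => exact (HeadEq.emb (h.seq t)).rel
  | unit => exact HeadEq.unit.rel
  | tint t => exact (HeadEq.tint (h.seq t)).rel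
  | tbool t => exact (HeadEq.tbool (h.seq t)).rel
  | tstr => exact HeadEq.tstr.rel
  | pair t u => exact (HeadEq.pair (h.seq t) (h.seq u)).rel
  | fn t u => exact (HeadEq.fn (h.seq t) (h.seq u)).rel
  | guard t u => exact (HeadEq.guard (h.seq t) (h.seq u)).rel
  | asrt t u => exact (HeadEq.asrt (h.seq t) (h.seq u)).rel
  | all t => exact (HeadEq.all (h.lift _ t)).rel
  | ex t => exact (HeadEq.ex (h.lift _ t)).rel
  | chan t u => exact (HeadEq.chan (h.seq t) (h.seq u)).rel
  | fin t => exact (HeadEq.fin (h.seq t)).rel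
  | bmsg t u w => exact (HeadEq.bmsg (h.seq t) (h.seq u) (h.seq w)).rel
  | msg t u w z => exact (HeadEq.msg (h.seq t) (h.seq u) (h.seq w) (h.seq z)).rel
  | quan t u => exact (HeadEq.quan (h.seq t) (h.seq u)).rel

theorem EntailsSub.congr {Γ : List Srt} {P : List (STm R Γ .bool)} {σ σ' : SSub R Γ []}
    (h : RelSub σ σ') (hP : EntailsSub P [] σ) : EntailsSub P [] σ' := by
  intro p hp
  have := hP p hp
  rw [entails_nil] at this ⊢
  rwa [← (h.seq p).val_eq]

/-- The weakened assumptions do not mention the new variable, so it may be given any value. -/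
theorem EntailsSub.map_wk {Γ : List Srt} {P : List (STm R Γ .bool)} {σ : SSub R Γ []}
    (hP : EntailsSub P [] σ) {b : Srt} (s : STm R [] b) :
    EntailsSub (P.map (STm.wk b)) [] (SSub.cons s σ) := by
  intro p hp
  obtain ⟨p, hp', rfl⟩ := List.mem_map.1 hp
  have := hP p hp'
  rwa [← STm.lift_inst, STm.wk_sub_lift, STm.wk_inst]

/-- The fundamental theorem: provable equality implies relatedness under closing substitutions. Two
different substitutions are needed for the abstraction case, where the arguments may differ. -/
theorem SEq.rel {Γ : List Srt} {a : Srt} {P : List (STm R Γ .bool)} {t u : STm R Γ a}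
    (h : SEq P t u) {σ σ' : SSub R Γ []} (hσ : RelSub σ σ') (hP : EntailsSub P [] σ) :
    Rel a (t.sub σ) (u.sub σ') := by
  -- Provably equal terms stay provably equal under the two substitutions, with or without one more
  -- binder; this compares the components of head forms.
  have key : ∀ {b : Srt} {t u : STm R _ b}, SEq P t u → SEq [] (t.sub σ) (u.sub σ') :=
    fun h => (h.sub hP).trans (hσ.seq _)
  have keyl : ∀ {b c : Srt} {t u : STm R (c :: _) b}, SEq (P.map (STm.wk c)) t u →
      SEq [] (t.sub (σ.lift c)) (u.sub (σ'.lift c)) :=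
    fun h => (h.sub (hP.lift _)).trans (hσ.lift _ _)
  induction h with
  | refl t => exact Rel.refl_sub t hσ
  | symm h ih =>
    refine (ih hσ.symm (hP.congr hσ) (fun h => ?_) fun h => ?_).symm
    · exact (h.sub (hP.congr hσ)).trans (hσ.symm.seq _)
    · exact (h.sub ((hP.congr hσ).lift _)).trans (hσ.symm.lift _ _)
  | trans h₁ h₂ ih₁ ih₂ =>
    -- The change from `σ` to `σ'` is made in the first equation; the second one is used with `σ'`
    -- on both sides.
    refine (ih₁ hσ hP key keyl).trans (ih₂ hσ.symm.left (hP.congr hσ) (fun h => ?_) fun h => ?_)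
    · exact h.sub (hP.congr hσ)
    · exact h.sub ((hP.congr hσ).lift _)
  | beta t u =>
    refine Rel.wh (.beta _ _) ?_
    rw [← STm.inst_sub]
    exact Rel.refl_sub _ hσ
  | data ha h => exact Rel.of_val_eq ha (key (.data ha h)).val_eq
  | lam h ih =>
    refine Rel.lam (fun s s' hs e => ih (hσ.cons hs e) (hP.map_wk s) (fun h => ?_) fun h => ?_)
      (key (.lam h))
    · exact (h.sub (hP.map_wk s)).trans ((hσ.cons hs e).seq _)
    · exact (h.sub ((hP.map_wk s).lift _)).trans ((hσ.cons hs e).lift _ _)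
  | app h₁ h₂ ih₁ ih₂ => exact (ih₁ hσ hP key keyl).2 _ _ (ih₂ hσ hP key keyl) (key h₂)
  | emb h => exact (HeadEq.emb (key h)).rel
  | tint h => exact (HeadEq.tint (key h)).rel
  | tbool h => exact (HeadEq.tbool (key h)).rel
  | pair h₁ h₂ => exact (HeadEq.pair (key h₁) (key h₂)).rel
  | fn h₁ h₂ => exact (HeadEq.fn (key h₁) (key h₂)).rel
  | guard h₁ h₂ => exact (HeadEq.guard (key h₁) (key h₂)).rel
  | asrt h₁ h₂ => exact (HeadEq.asrt (key h₁) (key h₂)).rel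
  | all h => exact (HeadEq.all (keyl h)).rel
  | ex h => exact (HeadEq.ex (keyl h)).rel
  | chan h₁ h₂ => exact (HeadEq.chan (key h₁) (key h₂)).rel
  | fin h => exact (HeadEq.fin (key h)).rel
  | bmsg h₁ h₂ h₃ => exact (HeadEq.bmsg (key h₁) (key h₂) (key h₃)).rel
  | msg h₁ h₂ h₃ h₄ => exact (HeadEq.msg (key h₁) (key h₂) (key h₃) (key h₄)).rel
  | quan h₁ h₂ => exact (HeadEq.quan (key h₁) (key h₂)).rel

/-- For closed terms the identity substitution is vacuously related to itself. -/
theorem SEq.headRel_ty {l : Bool} {t u : STm R [] (.ty l)} (h : SEq [] t u) : HeadRel t u := by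
  have := h.rel (σ := fun _ x => .var x) (σ' := fun _ x => .var x) (fun b x => nomatch x)
    (EntailsSub.nil _ _)
  rw [STm.sub_nil, STm.sub_nil] at this
  exact this

theorem SEq.headRel_stype {t u : STm R [] .stype} (h : SEq [] t u) : HeadRel t u := by
  have := h.rel (σ := fun _ x => .var x) (σ' := fun _ x => .var x) (fun b x => nomatch x)
    (EntailsSub.nil _ _)
  rw [STm.sub_nil, STm.sub_nil] at this
  exact this

/-- The term is headed by a type or session type former. -/
def IsHead {a : Srt} (t : STm R [] a) : Prop := HeadEq t t

/-- Type formers are injective and pairwise distinct. -/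
theorem SEq.head_ty {l : Bool} {t u : STm R [] (.ty l)} (h : SEq [] t u) (ht : IsHead t)
    (hu : IsHead u) : HeadEq t u := h.headRel_ty.headEq ht hu

/-- Session type formers are injective and pairwise distinct. -/
theorem SEq.head_stype {t u : STm R [] .stype} (h : SEq [] t u) (ht : IsHead t)
    (hu : IsHead u) : HeadEq t u := h.headRel_stype.headEq ht hu

/-! ## Non-linear types are distinct from linear ones under all assumptions -/

/-- A model of static terms that only tells embedded non-linear types from other linear types. -/
def Srt.Tag : Srt → Type
  | .ty _ => Bool
  | .arr a b => a.Tag → b.Tag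
  | _ => Unit

/-- An arbitrary point of each sort; it interprets the constants and stands for a bound static
variable about which nothing is known. -/
def Srt.tag0 : (a : Srt) → a.Tag
  | .ty _ => false
  | .arr _ b => fun _ => b.tag0
  | .int | .bool | .role | .set | .stype => ()

theorem Srt.Tag.subsingleton {a : Srt} (ha : a.Data) (x y : a.Tag) : x = y := by
  induction a with
  | ty l => exact ha.elim
  | arr a b _ ih => funext z; exact ih ha.2 _ _
  | _ => rfl

/-- Environments for the tag model. -/
abbrev TagEnv (Γ : List Srt) : Type := ∀ a : Srt, Var Γ a → a.Tag

def TagEnv.cons {Γ : List Srt} {b : Srt} (d : b.Tag) (v : TagEnv Γ) : TagEnv (b :: Γ)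
  | _, .z => d
  | _, .s x => v _ x

def STm.tag : {Γ : List Srt} → {a : Srt} → STm R Γ a → TagEnv Γ → a.Tag
  | _, _, .var x, v => v _ x
  | _, _, .lam t, v => fun d => t.tag (TagEnv.cons d v)
  | _, _, .app t u, v => (t.tag v) (u.tag v)
  | _, a, .cst _ _ _, _ => a.tag0
  | _, _, .emb _, _ => true
  | _, _, .unit, _ => false
  | _, _, .tint _, _ => false
  | _, _, .tbool _, _ => false
  | _, _, .tstr, _ => false
  | _, _, .pair _ _, _ => false
  | _, _, .fn _ _, _ => false
  | _, _, .guard _ _, _ => false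
  | _, _, .asrt _ _, _ => false
  | _, _, .all _, _ => false
  | _, _, .ex _, _ => false
  | _, _, .chan _ _, _ => false
  | _, _, .fin _, _ => ()
  | _, _, .bmsg _ _ _, _ => ()
  | _, _, .msg _ _ _ _, _ => ()
  | _, _, .quan _ _, _ => ()

theorem STm.tag_ren {Γ : List Srt} {a : Srt} (t : STm R Γ a) {Δ : List Srt} (f : SRen Γ Δ)
    (v : TagEnv Δ) : (t.ren f).tag v = t.tag fun b x => v b (f b x) := by
  have hl : ∀ {Γ Δ : List Srt} (f : SRen Γ Δ) (c : Srt) (d : c.Tag) (v : TagEnv Δ),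
      (fun b x => TagEnv.cons d v b (f.lift c b x)) = TagEnv.cons d fun b x => v b (f b x) := by
    intro Γ Δ f c d v; funext b x; cases x <;> rfl
  induction t generalizing Δ with
  | _ => simp only [STm.ren, STm.tag, *] <;> rfl

theorem STm.tag_sub {Γ : List Srt} {a : Srt} (t : STm R Γ a) {Δ : List Srt} (f : SSub R Γ Δ)
    (v : TagEnv Δ) : (t.sub f).tag v = t.tag fun b x => (f b x).tag v := by
  have hl : ∀ {Γ Δ : List Srt} (f : SSub R Γ Δ) (c : Srt) (d : c.Tag) (v : TagEnv Δ),
      (fun b x => (f.lift c b x).tag (TagEnv.cons d v)) =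
        TagEnv.cons d fun b x => (f b x).tag v := by
    intro Γ Δ f c d v; funext b x
    cases x with
    | z => rfl
    | s x => simp only [SSub.lift, STm.wk, STm.tag_ren, TagEnv.cons]
  induction t generalizing Δ with
  | _ => simp only [STm.sub, STm.tag, *] <;> rfl

/-- Unlike the standard model, this one ignores the assumptions. Even contradictory assumptions,
which identify all terms of a data sort, cannot change a tag, because data sorts have at most one
tag. -/
theorem SEq.tag_eq {Γ : List Srt} {a : Srt} {P : List (STm R Γ .bool)} {t u : STm R Γ a}
    (h : SEq P t u) (v : TagEnv Γ) : t.tag v = u.tag v := by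
  induction h with
  | refl t => rfl
  | symm _ ih => exact (ih v).symm
  | trans _ _ ih₁ ih₂ => exact (ih₁ v).trans (ih₂ v)
  | beta t u =>
    rw [STm.inst, STm.tag_sub]
    simp only [STm.tag]
    congr 1; funext b x; cases x <;> rfl
  | data ha h => exact Srt.Tag.subsingleton ha _ _
  | lam _ ih => funext d; exact ih _
  | app _ _ ih₁ ih₂ => simp only [STm.tag]; rw [ih₁ v, ih₂ v]
  | _ => rfl

/-! ## Occurrences of variables and endpoints -/

/-- The number of occurrences of a dynamic variable. -/
def Tm.cnt : {Γ : List Srt} → {n : ℕ} → Tm R Γ n → Fin n → ℕ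
  | _, _, .var i, j => if i = j then 1 else 0
  | _, _, .ep _ _, _ => 0
  | _, _, .opn _ _ _, _ => 0
  | _, _, .unit, _ => 0
  | _, _, .ilit _, _ => 0
  | _, _, .blit _, _ => 0
  | _, _, .slit _, _ => 0
  | _, _, .lam e, j => e.cnt j.succ
  | _, _, .un _ e, j => e.cnt j
  | _, _, .bin _ e₁ e₂, j => e₁.cnt j + e₂.cnt j
  | _, _, .letP e₁ e₂, j => e₁.cnt j + e₂.cnt j.succ.succ
  | _, _, .guardI v, j => v.cnt j
  | _, _, .letA e₁ e₂, j => e₁.cnt j + e₂.cnt j.succ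
  | _, _, .allI _ v, j => v.cnt j
  | _, _, .letE _ e₁ e₂, j => e₁.cnt j + e₂.cnt j.succ

theorem Tm.cnt_ssub {Γ : List Srt} {n : ℕ} (e : Tm R Γ n) {Δ : List Srt} (f : SSub R Γ Δ)
    (j : Fin n) : (e.ssub f).cnt j = e.cnt j := by
  induction e generalizing Δ with
  | _ => simp only [Tm.ssub, Tm.cnt, *]

theorem Tm.rho_ssub {Γ : List Srt} {n : ℕ} (e : Tm R Γ n) {Δ : List Srt} (f : SSub R Γ Δ) :
    (e.ssub f).rho = e.rho := by
  induction e generalizing Δ with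
  | _ => simp only [Tm.ssub, Tm.rho, *]

theorem Tm.rho_ren {Γ : List Srt} {n : ℕ} (e : Tm R Γ n) {m : ℕ} (f : Fin n → Fin m) :
    (e.ren f).rho = e.rho := by
  induction e generalizing m with
  | _ => simp only [Tm.ren, Tm.rho, *]

theorem Tm.rho_chren {Γ : List Srt} {n : ℕ} (e : Tm R Γ n) (f : ℕ → ℕ) :
    (e.chren f).rho = e.rho.map fun x => (f x.1, x.2) := by
  induction e with
  | _ => simp only [Tm.chren, Tm.rho, Multiset.map_add, Multiset.map_zero,
      Multiset.map_singleton, *]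

theorem Tm.cnt_chren {Γ : List Srt} {n : ℕ} (e : Tm R Γ n) (f : ℕ → ℕ) (j : Fin n) :
    (e.chren f).cnt j = e.cnt j := by
  induction e with
  | _ => simp only [Tm.chren, Tm.cnt, *]

@[simp] theorem liftRen_zero {n m : ℕ} (f : Fin n → Fin m) : liftRen f 0 = 0 := rfl

@[simp] theorem liftRen_succ {n m : ℕ} (f : Fin n → Fin m) (i : Fin n) :
    liftRen f i.succ = (f i).succ := rfl

@[simp] theorem liftSub_zero {Γ : List Srt} {n m : ℕ} (f : Fin n → Tm R Γ m) :
    liftSub f 0 = .var 0 := rfl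

@[simp] theorem liftSub_succ {Γ : List Srt} {n m : ℕ} (f : Fin n → Tm R Γ m) (i : Fin n) :
    liftSub f i.succ = (f i).ren Fin.succ := rfl

theorem liftRen_injective {n m : ℕ} {f : Fin n → Fin m} (hf : Function.Injective f) :
    Function.Injective (liftRen f) := by
  intro i j h
  cases i using Fin.cases <;> cases j using Fin.cases
  · rfl
  · simp [Fin.ext_iff] at h
  · simp [Fin.ext_iff] at h
  · simp only [liftRen_succ, Fin.succ_inj] at h
    rw [hf h]

/-- Injectivity matters: a renaming that identifies two variables would add up their occurrences. -/
theorem Tm.cnt_ren {Γ : List Srt} {n : ℕ} (e : Tm R Γ n) {m : ℕ} {f : Fin n → Fin m}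
    (hf : Function.Injective f) (j : Fin n) : (e.ren f).cnt (f j) = e.cnt j := by
  induction e generalizing m with
  | var i => simp only [Tm.ren, Tm.cnt, hf.eq_iff]
  | lam e ih => exact ih (liftRen_injective hf) j.succ
  | letP e₁ e₂ ih₁ ih₂ =>
    exact congr (congrArg HAdd.hAdd (ih₁ hf j))
      (ih₂ (liftRen_injective (liftRen_injective hf)) j.succ.succ)
  | letA e₁ e₂ ih₁ ih₂ =>
    exact congr (congrArg HAdd.hAdd (ih₁ hf j)) (ih₂ (liftRen_injective hf) j.succ)
  | letE a e₁ e₂ ih₁ ih₂ =>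
    exact congr (congrArg HAdd.hAdd (ih₁ hf j)) (ih₂ (liftRen_injective hf) j.succ)
  | _ => simp only [Tm.ren, Tm.cnt, *]

theorem liftRen_ne_succ {n m : ℕ} {f : Fin n → Fin m} {j : Fin m} (hj : ∀ i, f i ≠ j) :
    ∀ i, liftRen f i ≠ j.succ := by
  intro i
  cases i using Fin.cases
  · simp [Fin.ext_iff]
  · simpa [Fin.succ_inj] using hj _

theorem Tm.cnt_ren_of_ne {Γ : List Srt} {n : ℕ} (e : Tm R Γ n) {m : ℕ} {f : Fin n → Fin m}
    {j : Fin m} (hj : ∀ i, f i ≠ j) : (e.ren f).cnt j = 0 := by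
  induction e generalizing m with
  | var i => simp only [Tm.ren, Tm.cnt, hj, if_false]
  | lam e ih => exact ih (liftRen_ne_succ hj)
  | letP e₁ e₂ ih₁ ih₂ =>
    simp only [Tm.ren, Tm.cnt, ih₁ hj, ih₂ (liftRen_ne_succ (liftRen_ne_succ hj))]
  | letA e₁ e₂ ih₁ ih₂ => simp only [Tm.ren, Tm.cnt, ih₁ hj, ih₂ (liftRen_ne_succ hj)]
  | letE a e₁ e₂ ih₁ ih₂ => simp only [Tm.ren, Tm.cnt, ih₁ hj, ih₂ (liftRen_ne_succ hj)]
  | un o e ih => exact ih hj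
  | bin o e₁ e₂ ih₁ ih₂ => simp only [Tm.ren, Tm.cnt, ih₁ hj, ih₂ hj]
  | guardI e ih => exact ih hj
  | allI a e ih => exact ih hj
  | _ => rfl

/-- The bound variable is replaced by itself and contributes no occurrence of an outer variable, so
the first summand vanishes. -/
theorem cnt_liftSub {Γ : List Srt} {n m : ℕ} (f : Fin n → Tm R Γ m) (g : Fin (n + 1) → ℕ)
    (j : Fin m) : ∑ i, g i * (liftSub f i).cnt j.succ = ∑ i, g i.succ * (f i).cnt j := by
  rw [Fin.sum_univ_succ]
  have : (Tm.var 0 : Tm R Γ (m + 1)).cnt j.succ = 0 := by simp [Tm.cnt, Fin.ext_iff]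
  simp [this, Tm.cnt_ren _ (Fin.succ_injective m)]

theorem cnt_liftSub_zero {Γ : List Srt} {n m : ℕ} (f : Fin n → Tm R Γ m) (g : Fin (n + 1) → ℕ) :
    ∑ i, g i * (liftSub f i).cnt 0 = g 0 := by
  rw [Fin.sum_univ_succ]
  simp [Tm.cnt, Tm.cnt_ren_of_ne _ (Fin.succ_ne_zero)]

theorem rho_liftSub {Γ : List Srt} {n m : ℕ} (f : Fin n → Tm R Γ m) (g : Fin (n + 1) → ℕ) :
    ∑ i, g i • (liftSub f i).rho = ∑ i, g i.succ • (f i).rho := by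
  rw [Fin.sum_univ_succ]
  simp [Tm.rho, Tm.rho_ren]

theorem Tm.cnt_sub {Γ : List Srt} {n : ℕ} (e : Tm R Γ n) {m : ℕ} (f : Fin n → Tm R Γ m)
    (j : Fin m) : (e.sub f).cnt j = ∑ i, e.cnt i * (f i).cnt j := by
  induction e generalizing m with
  | var i => simp [Tm.sub, Tm.cnt]
  | lam e ih => simp only [Tm.sub, Tm.cnt, ih, cnt_liftSub]
  | un o e ih => simp only [Tm.sub, Tm.cnt, ih]
  | bin o e₁ e₂ ih₁ ih₂ => simp only [Tm.sub, Tm.cnt, ih₁, ih₂, add_mul, Finset.sum_add_distrib]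
  | letP e₁ e₂ ih₁ ih₂ =>
    simp only [Tm.sub, Tm.cnt, ih₁, ih₂, add_mul, Finset.sum_add_distrib, cnt_liftSub]
  | guardI e ih => simp only [Tm.sub, Tm.cnt, ih]
  | letA e₁ e₂ ih₁ ih₂ =>
    simp only [Tm.sub, Tm.cnt, ih₁, ih₂, add_mul, Finset.sum_add_distrib, cnt_liftSub]
  | allI a e ih => simp only [Tm.sub, Tm.cnt, ih, Tm.swk, Tm.cnt_ssub]
  | letE a e₁ e₂ ih₁ ih₂ =>
    simp only [Tm.sub, Tm.cnt, ih₁, ih₂, add_mul, Finset.sum_add_distrib, cnt_liftSub, Tm.swk,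
      Tm.cnt_ssub]
  | _ => simp [Tm.sub, Tm.cnt]

/-- Substitution makes one copy of the image for each occurrence of the variable. Linearity and
emptiness of non-linear values will reduce this sum to one copy of each argument. -/
theorem Tm.rho_sub {Γ : List Srt} {n : ℕ} (e : Tm R Γ n) {m : ℕ} (f : Fin n → Tm R Γ m) :
    (e.sub f).rho = e.rho + ∑ i, e.cnt i • (f i).rho := by
  induction e generalizing m with
  | var i => simp [Tm.sub, Tm.cnt, Tm.rho, ite_smul]
  | lam e ih => simp only [Tm.sub, Tm.cnt, Tm.rho, ih, rho_liftSub]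
  | un o e ih => simp only [Tm.sub, Tm.cnt, Tm.rho, ih]
  | bin o e₁ e₂ ih₁ ih₂ =>
    simp only [Tm.sub, Tm.cnt, Tm.rho, ih₁, ih₂, add_smul, Finset.sum_add_distrib]
    abel
  | letP e₁ e₂ ih₁ ih₂ =>
    simp only [Tm.sub, Tm.cnt, Tm.rho, ih₁, ih₂, add_smul, Finset.sum_add_distrib, rho_liftSub]
    abel
  | guardI e ih => simp only [Tm.sub, Tm.cnt, Tm.rho, ih]
  | letA e₁ e₂ ih₁ ih₂ =>
    simp only [Tm.sub, Tm.cnt, Tm.rho, ih₁, ih₂, add_smul, Finset.sum_add_distrib, rho_liftSub]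
    abel
  | allI a e ih => simp only [Tm.sub, Tm.cnt, Tm.rho, ih, Tm.swk, Tm.rho_ssub]
  | letE a e₁ e₂ ih₁ ih₂ =>
    simp only [Tm.sub, Tm.cnt, Tm.rho, ih₁, ih₂, add_smul, Finset.sum_add_distrib, rho_liftSub,
      Tm.swk, Tm.rho_ssub]
    abel
  | _ => simp [Tm.sub, Tm.cnt, Tm.rho]

theorem Tm.ssub_var {Γ : List Srt} {n : ℕ} (e : Tm R Γ n) : e.ssub (fun _ x => .var x) = e := by
  have ho : ∀ {Γ : List Srt} (o : UOp R Γ), o.ssub (fun _ x => .var x) = o := by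
    intro Γ o; cases o <;> simp only [UOp.ssub, STm.sub_var]
  have ho' : ∀ {Γ : List Srt} (o : BOp R Γ), o.ssub (fun _ x => .var x) = o := by
    intro Γ o; cases o <;> simp only [BOp.ssub, STm.sub_var]
  induction e with
  | _ => simp only [Tm.ssub, SSub.lift_var, STm.sub_var, *]

theorem Tm.chren_id {Γ : List Srt} {n : ℕ} (e : Tm R Γ n) : e.chren (fun c => c) = e := by
  induction e with
  | _ => simp only [Tm.chren, *]

/-! ## A typing judgement that counts occurrences -/

/-- Typing of unary term formers. -/
inductive UTy {Γ : List Srt} (P : List (STm R Γ .bool)) :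
    UOp R Γ → STm R Γ (.ty true) → STm R Γ (.ty true) → Prop
  | fst {t u : STm R Γ (.ty false)} : UTy P .fst (.emb (.pair t u)) (.emb t)
  | snd {t u : STm R Γ (.ty false)} : UTy P .snd (.emb (.pair t u)) (.emb u)
  | guardE {p : STm R Γ .bool} {l : Bool} {t : STm R Γ (.ty l)} (hp : Entails P p) :
      UTy P .guardE (STm.guard p t).up t.up
  | asrtI {p : STm R Γ .bool} {l : Bool} {t : STm R Γ (.ty l)} (hp : Entails P p) :
      UTy P .asrtI t.up (STm.asrt p t).up
  | allE {a : Srt} {s : STm R Γ a} {l : Bool} {t : STm R (a :: Γ) (.ty l)} :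
      UTy P (.allE a s) (STm.all t).up (t.inst s).up
  | exI {a : Srt} {s : STm R Γ a} {l : Bool} {t : STm R (a :: Γ) (.ty l)} :
      UTy P (.exI a s) (t.inst s).up (STm.ex t).up
  | spawn : UTy P .spawn (.fn unitT unitT) unitT
  | fork {rs₁ rs₂ : STm R Γ .set} {π : STm R Γ .stype}
      (h : Entails P (.conj (.disjoint rs₁ rs₂) (.cover rs₁ rs₂))) :
      UTy P (.fork rs₁ rs₂) (.fn (.chan rs₁ π) unitT) (.chan rs₂ π)
  | elim {π : STm R Γ .stype} : UTy P .elim (.chan (.setLit ∅) π) unitT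
  | brecv {rs : STm R Γ .set} {r : STm R Γ .role} {π : STm R Γ .stype} {t : STm R Γ (.ty false)}
      (h : Entails P (.notMem r rs)) :
      UTy P .brecv (.chan rs (.bmsg r t π)) (.pair (.chan rs π) (.emb t))
  | recv {rs : STm R Γ .set} {r₁ r₂ : STm R Γ .role} {π : STm R Γ .stype} {t : STm R Γ (.ty true)}
      (h : Entails P (.conj (.notMem r₁ rs) (.mem r₂ rs))) :
      UTy P .recv (.chan rs (.msg r₁ r₂ t π)) (.pair (.chan rs π) t)
  | skip {rs : STm R Γ .set} {r₁ r₂ : STm R Γ .role} {π : STm R Γ .stype} {t : STm R Γ (.ty true)}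
      (h : Entails P (.disj (.conj (.mem r₁ rs) (.mem r₂ rs))
        (.conj (.notMem r₁ rs) (.notMem r₂ rs)))) :
      UTy P .skip (.chan rs (.msg r₁ r₂ t π)) (.chan rs π)
  | close {rs : STm R Γ .set} {r : STm R Γ .role} (h : Entails P (.mem r rs)) :
      UTy P .close (.chan rs (.fin r)) unitT
  | wait {rs : STm R Γ .set} {r : STm R Γ .role} (h : Entails P (.notMem r rs)) :
      UTy P .wait (.chan rs (.fin r)) unitT
  | unify {a : Srt} {rs : STm R Γ .set} {r : STm R Γ .role} {f : STm R Γ (.arr a .stype)}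
      (h : Entails P (.mem r rs)) :
      UTy P (.unify a) (.chan rs (.quan r f)) (.all (.chan (rs.wk a) (.app (f.wk a) (.var .z))))
  | exify {a : Srt} {rs : STm R Γ .set} {r : STm R Γ .role} {f : STm R Γ (.arr a .stype)}
      (h : Entails P (.notMem r rs)) :
      UTy P (.exify a) (.chan rs (.quan r f)) (.ex (.chan (rs.wk a) (.app (f.wk a) (.var .z))))

/-- Typing of binary term formers. -/
inductive BTy {Γ : List Srt} (P : List (STm R Γ .bool)) :
    BOp R Γ → STm R Γ (.ty true) → STm R Γ (.ty true) → STm R Γ (.ty true) → Prop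
  | app {l : Bool} {t u : STm R Γ (.ty true)} : BTy P .app (STm.fn (l := l) t u).up t u
  | pair {l : Bool} {t u : STm R Γ (.ty l)} : BTy P .pair t.up u.up (STm.pair t u).up
  | arith {p : ℤ → ℤ → Prop} {f : ℤ → ℤ → ℤ} {i j : STm R Γ .int} :
      BTy P (.arith p f) (.emb (.tint i)) (.emb (.tint j))
        (.emb (.tint (.op₂ (a := .int) (b := .int) (c := .int) trivial trivial trivial f i j)))
  | cut {rs₁ rs₂ : STm R Γ .set} {π : STm R Γ .stype} (h : Entails P (.cover rs₁ rs₂)) :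
      BTy P .cut (.chan rs₁ π) (.chan rs₂ π) (.chan (.inter rs₁ rs₂) π)
  | split {rs₁ rs₂ : STm R Γ .set} {π : STm R Γ .stype} (h : Entails P (.disjoint rs₁ rs₂)) :
      BTy P (.split rs₁ rs₂) (.chan (.union rs₁ rs₂) π) (.fn (.chan rs₁ π) unitT) (.chan rs₂ π)
  | bsend {rs : STm R Γ .set} {r : STm R Γ .role} {π : STm R Γ .stype}
      {t : STm R Γ (.ty false)} (h : Entails P (.mem r rs)) :
      BTy P .bsend (.chan rs (.bmsg r t π)) (.emb t) (.chan rs π)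
  | send {rs : STm R Γ .set} {r₁ r₂ : STm R Γ .role} {π : STm R Γ .stype}
      {t : STm R Γ (.ty true)} (h : Entails P (.conj (.mem r₁ rs) (.notMem r₂ rs))) :
      BTy P .send (.chan rs (.msg r₁ r₂ t π)) t (.chan rs π)

/-- Typing contexts in which every variable has a type and a flag that marks the linear ones. -/
abbrev TCtx (R : Type) (Γ : List Srt) (n : ℕ) : Type := Fin n → Bool × STm R Γ (.ty true)

def TCtx.cons {Γ : List Srt} {n : ℕ} (G : TCtx R Γ n) (k : Bool) (t : STm R Γ (.ty true)) :
    TCtx R Γ (n + 1) := Fin.cons (k, t) G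

def TCtx.ssub {Γ Δ : List Srt} {n : ℕ} (G : TCtx R Γ n) (σ : SSub R Γ Δ) : TCtx R Δ n :=
  fun i => ((G i).1, (G i).2.sub σ)

def TCtx.wk {Γ : List Srt} {n : ℕ} (b : Srt) (G : TCtx R Γ n) : TCtx R (b :: Γ) n :=
  fun i => ((G i).1, (G i).2.wk b)

/-- A bound variable with `m` occurrences: it occurs once if it is linear, and has a non-linear type
otherwise. -/
def UseOk {Γ : List Srt} (k : Bool) (t : STm R Γ (.ty true)) (m : ℕ) : Prop :=
  (k = true → m = 1) ∧ (k = false → ∃ t', t = .emb t')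

/-- Typing without splitting of contexts: linearity is expressed by counting occurrences. -/
inductive Ty (S : Sig R) : {Γ : List Srt} → {n : ℕ} → List (STm R Γ .bool) → TCtx R Γ n →
    Tm R Γ n → STm R Γ (.ty true) → Prop
  | conv {Γ : List Srt} {n : ℕ} {P : List (STm R Γ .bool)} {G : TCtx R Γ n} {e : Tm R Γ n}
      {t u : STm R Γ (.ty true)} : Ty S P G e t → SEq P t u → Ty S P G e u
  | var {Γ : List Srt} {n : ℕ} {P : List (STm R Γ .bool)} {G : TCtx R Γ n} (i : Fin n) :
      Ty S P G (.var i) (G i).2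
  | ep {Γ : List Srt} {n : ℕ} {P : List (STm R Γ .bool)} {G : TCtx R Γ n} {c : ℕ} {A : Set R}
      {π : STm R [] .stype} (hc : S c = some π) :
      Ty S P G (.ep c A) (.chan (.setLit A) (π.wkc Γ))
  | opn {Γ : List Srt} {n : ℕ} {P : List (STm R Γ .bool)} {G : TCtx R Γ n} {c : ℕ} {A : Set R}
      {a : Srt} {s : STm R Γ a} {f : STm R Γ (.arr a .stype)} {π : STm R [] .stype}
      (hc : S c = some π) (hf : SEq P (π.wkc Γ) (.app f s)) :
      Ty S P G (.opn c A s) (.all (.chan (.setLit A) (.app (f.wk a) (.var .z))))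
  | unit {Γ : List Srt} {n : ℕ} {P : List (STm R Γ .bool)} {G : TCtx R Γ n} : Ty S P G .unit unitT
  | ilit {Γ : List Srt} {n : ℕ} {P : List (STm R Γ .bool)} {G : TCtx R Γ n} (k : ℤ) :
      Ty S P G (.ilit k) (.emb (.tint (.intLit k)))
  | blit {Γ : List Srt} {n : ℕ} {P : List (STm R Γ .bool)} {G : TCtx R Γ n} (b : Bool) :
      Ty S P G (.blit b) (.emb (.tbool (.cst .bool trivial (b = true))))
  | slit {Γ : List Srt} {n : ℕ} {P : List (STm R Γ .bool)} {G : TCtx R Γ n} (x : String) :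
      Ty S P G (.slit x) (.emb .tstr)
  | lam {Γ : List Srt} {n : ℕ} {P : List (STm R Γ .bool)} {G : TCtx R Γ n} {e : Tm R Γ (n + 1)}
      {l k : Bool} {t u : STm R Γ (.ty true)} (hk : UseOk k t (e.cnt 0))
      (hl : l = false → (∀ i, (G i).1 = true → e.cnt i.succ = 0) ∧ e.rho = 0) :
      Ty S P (G.cons k t) e u → Ty S P G (.lam e) (STm.fn (l := l) t u).up
  | un {Γ : List Srt} {n : ℕ} {P : List (STm R Γ .bool)} {G : TCtx R Γ n} {o : UOp R Γ}
      {e : Tm R Γ n} {t u : STm R Γ (.ty true)} :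
      UTy P o t u → Ty S P G e t → Ty S P G (.un o e) u
  | bin {Γ : List Srt} {n : ℕ} {P : List (STm R Γ .bool)} {G : TCtx R Γ n} {o : BOp R Γ}
      {e₁ e₂ : Tm R Γ n} {t₁ t₂ u : STm R Γ (.ty true)} :
      BTy P o t₁ t₂ u → Ty S P G e₁ t₁ → Ty S P G e₂ t₂ → Ty S P G (.bin o e₁ e₂) u
  | letP {Γ : List Srt} {n : ℕ} {P : List (STm R Γ .bool)} {G : TCtx R Γ n} {e₁ : Tm R Γ n}
      {e₂ : Tm R Γ (n + 2)} {l k₁ k₂ : Bool} {t₁ t₂ : STm R Γ (.ty l)} {u : STm R Γ (.ty true)}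
      (h₁ : UseOk k₁ t₁.up (e₂.cnt 1)) (h₂ : UseOk k₂ t₂.up (e₂.cnt 0)) :
      Ty S P G e₁ (STm.pair t₁ t₂).up → Ty S P ((G.cons k₁ t₁.up).cons k₂ t₂.up) e₂ u →
      Ty S P G (.letP e₁ e₂) u
  | guardI {Γ : List Srt} {n : ℕ} {P : List (STm R Γ .bool)} {G : TCtx R Γ n} {v : Tm R Γ n}
      {p : STm R Γ .bool} {l : Bool} {t : STm R Γ (.ty l)} :
      Ty S (p :: P) G v t.up → Ty S P G (.guardI v) (STm.guard p t).up
  | letA {Γ : List Srt} {n : ℕ} {P : List (STm R Γ .bool)} {G : TCtx R Γ n} {e₁ : Tm R Γ n}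
      {e₂ : Tm R Γ (n + 1)} {p : STm R Γ .bool} {l k : Bool} {t : STm R Γ (.ty l)}
      {u : STm R Γ (.ty true)} (hk : UseOk k t.up (e₂.cnt 0)) :
      Ty S P G e₁ (STm.asrt p t).up → Ty S (p :: P) (G.cons k t.up) e₂ u →
      Ty S P G (.letA e₁ e₂) u
  | allI {Γ : List Srt} {n : ℕ} {P : List (STm R Γ .bool)} {G : TCtx R Γ n} {a : Srt}
      {v : Tm R (a :: Γ) n} {l : Bool} {t : STm R (a :: Γ) (.ty l)} :
      Ty S (P.map (STm.wk a)) (G.wk a) v t.up → Ty S P G (.allI a v) (STm.all t).up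
  | letE {Γ : List Srt} {n : ℕ} {P : List (STm R Γ .bool)} {G : TCtx R Γ n} {a : Srt}
      {e₁ : Tm R Γ n} {e₂ : Tm R (a :: Γ) (n + 1)} {l k : Bool} {t : STm R (a :: Γ) (.ty l)}
      {u : STm R Γ (.ty true)} (hk : UseOk k t.up (e₂.cnt 0)) :
      Ty S P G e₁ (STm.ex t).up →
      Ty S (P.map (STm.wk a)) ((G.wk a).cons k t.up) e₂ (u.wk a) →
      Ty S P G (.letE a e₁ e₂) u

/-! ## From contexts that split to counting -/

/-- The typing context `H` extends `G`, forgetting which variables are gone. -/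
def Ctx.Compat {Γ : List Srt} {n : ℕ} (G : Ctx R Γ n) (H : TCtx R Γ n) : Prop :=
  ∀ i l t, G i = .has l t → H i = (l, t.up)

/-- The numbers `m` of occurrences of variables agree with the linear part of the context. -/
def Ctx.Used {Γ : List Srt} {n : ℕ} (G : Ctx R Γ n) (m : Fin n → ℕ) : Prop :=
  ∀ i, (G i = .gone → m i = 0) ∧ ∀ t, G i = .has true t → m i = 1

theorem Ctx.Unr.used {Γ : List Srt} {n : ℕ} {G : Ctx R Γ n} (h : G.Unr) : G.Used fun _ => 0 :=
  fun i => ⟨fun _ => rfl, fun t ht => absurd ht (h i t)⟩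

theorem Ctx.Split.compat_left {Γ : List Srt} {n : ℕ} {G G₁ G₂ : Ctx R Γ n} {H : TCtx R Γ n}
    (h : G.Split G₁ G₂) (hH : G.Compat H) : G₁.Compat H := by
  intro i l t hi
  have := h i
  rw [hi] at this
  generalize hg : G i = g at this
  generalize G₂ i = g₂ at this
  cases this <;> exact hH i _ _ hg

theorem Ctx.Split.compat_right {Γ : List Srt} {n : ℕ} {G G₁ G₂ : Ctx R Γ n} {H : TCtx R Γ n}
    (h : G.Split G₁ G₂) (hH : G.Compat H) : G₂.Compat H := by
  intro i l t hi
  have := h i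
  rw [hi] at this
  generalize hg : G i = g at this
  generalize G₁ i = g₁ at this
  cases this <;> exact hH i _ _ hg

/-- A linear variable is available in exactly one part and is gone in the other, so the counts 1 and
0 add up to 1. -/
theorem Ctx.Split.used {Γ : List Srt} {n : ℕ} {G G₁ G₂ : Ctx R Γ n} {m₁ m₂ : Fin n → ℕ}
    (h : G.Split G₁ G₂) (h₁ : G₁.Used m₁) (h₂ : G₂.Used m₂) :
    G.Used fun i => m₁ i + m₂ i := by
  intro i
  have hs := h i
  have h₁ := h₁ i
  have h₂ := h₂ i
  generalize G i = g at *
  generalize G₁ i = g₁ at *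
  generalize G₂ i = g₂ at *
  cases hs with
  | nonlin t => exact ⟨fun h => (by cases h), fun u h => (by cases h)⟩
  | left t =>
    refine ⟨fun h => (by cases h), fun u _ => ?_⟩
    simp only [h₁.2 t rfl, h₂.1 rfl]
  | right t =>
    refine ⟨fun h => (by cases h), fun u _ => ?_⟩
    simp only [h₁.1 rfl, h₂.2 t rfl]
  | gone =>
    refine ⟨fun _ => ?_, fun u h => (by cases h)⟩
    simp only [h₁.1 rfl, h₂.1 rfl]

theorem Ctx.Compat.cons {Γ : List Srt} {n : ℕ} {G : Ctx R Γ n} {H : TCtx R Γ n}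
    (h : G.Compat H) {l : Bool} (t : STm R Γ (.ty l)) : (G.cons t).Compat (H.cons l t.up) := by
  intro i k u hi
  cases i using Fin.cases with
  | zero => cases hi; rfl
  | succ i => exact h i k u hi

theorem Ctx.Compat.wk {Γ : List Srt} {n : ℕ} {G : Ctx R Γ n} {H : TCtx R Γ n}
    (h : G.Compat H) (b : Srt) : (G.wk b).Compat (H.wk b) := by
  intro i k u hi
  simp only [Ctx.wk] at hi
  generalize hg : G i = g at hi
  cases g with
  | gone => cases hi
  | has l t =>
    cases hi
    simp only [TCtx.wk, h i _ _ hg, STm.wk_eq_sub, STm.up_sub]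

theorem Ctx.Used.of_wk {Γ : List Srt} {n : ℕ} {G : Ctx R Γ n} {m : Fin n → ℕ} {b : Srt}
    (h : (G.wk b).Used m) : G.Used m := by
  intro i
  have := h i
  simp only [Ctx.wk] at this
  exact ⟨fun hg => this.1 (by rw [hg]; rfl), fun t hg => this.2 (t.wk b) (by rw [hg]; rfl)⟩

theorem Ctx.Used.tail {Γ : List Srt} {n : ℕ} {G : Ctx R Γ n} {m : Fin (n + 1) → ℕ} {l : Bool}
    {t : STm R Γ (.ty l)} (h : (G.cons t).Used m) : G.Used fun i => m i.succ :=
  fun i => h i.succ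

theorem Ctx.Used.head {Γ : List Srt} {n : ℕ} {G : Ctx R Γ n} {m : Fin (n + 1) → ℕ} {l : Bool}
    {t : STm R Γ (.ty l)} (h : (G.cons t).Used m) : UseOk l t.up (m 0) := by
  cases l with
  | false => exact ⟨fun h => (by cases h), fun _ => ⟨t, rfl⟩⟩
  | true => exact ⟨fun _ => (h 0).2 t rfl, fun h => by cases h⟩

theorem Ctx.Used.var {Γ : List Srt} {n : ℕ} {G : Ctx R Γ n} {i : Fin n} {l : Bool}
    {t : STm R Γ (.ty l)} (hi : G i = .has l t) (hG : ∀ j, j ≠ i → ∀ u, G j ≠ .has true u) :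
    G.Used (Tm.var i : Tm R Γ n).cnt := by
  intro j
  simp only [Tm.cnt]
  by_cases hij : i = j
  · subst hij
    rw [hi]
    simp
  · simp only [hij, if_false, true_and, implies_true]
    exact fun u hu => absurd hu (hG j (Ne.symm hij) u)

/-- Splitting of contexts becomes a statement about counts: available linear variables occur once
and those that are gone do not occur. The context `H` keeps the types of the latter, so that both
premises of a binary rule can be typed in the same context. -/
theorem HasTy.ty {S : Sig R} {Γ : List Srt} {n : ℕ} {P : List (STm R Γ .bool)} {G : Ctx R Γ n}
    {e : Tm R Γ n} {t : STm R Γ (.ty true)} (h : HasTy S P G e t) {H : TCtx R Γ n}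
    (hH : G.Compat H) : Ty S P H e t ∧ G.Used e.cnt := by
  induction h with
  | conv _ he ih => exact ⟨.conv (ih hH).1 he, (ih hH).2⟩
  | var hi hG =>
    refine ⟨?_, Ctx.Used.var hi hG⟩
    have := Ty.var (S := S) (P := ‹_›) (G := H) ‹Fin _›
    rwa [hH _ _ _ hi] at this
  | ep hG hc => exact ⟨.ep hc, hG.used⟩
  | opn hG hc hf => exact ⟨.opn hc hf, hG.used⟩
  | unit hG => exact ⟨.unit, hG.used⟩
  | ilit hG => exact ⟨.ilit _, hG.used⟩
  | blit hG => exact ⟨.blit _, hG.used⟩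
  | slit hG => exact ⟨.slit _, hG.used⟩
  | arith hG _ _ _ ih₁ ih₂ =>
    have h₁ := ih₁ (hG.compat_left hH)
    have h₂ := ih₂ (hG.compat_right hH)
    exact ⟨.bin .arith h₁.1 h₂.1, hG.used h₁.2 h₂.2⟩
  | @lam _ _ _ G _ _ _ _ _ hl _ ih =>
    have h := ih (hH.cons _)
    refine ⟨.lam h.2.head (fun hl' => ⟨fun i hi => ?_, (hl hl').2⟩) h.1, h.2.tail⟩
    -- A variable that `H` marks as linear cannot be available in `G`, whose linear part is empty;
    -- hence it is gone and does not occur in the body.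
    have hu := (h.2.tail i).1
    have hn := (hl hl').1 i
    have hc := hH i
    generalize G i = g at *
    cases g with
    | gone => exact hu rfl
    | has k w =>
      rw [hc k w rfl] at hi
      cases hi
      exact absurd rfl (hn w)
  | app hG _ _ ih₁ ih₂ =>
    have h₁ := ih₁ (hG.compat_left hH)
    have h₂ := ih₂ (hG.compat_right hH)
    exact ⟨.bin .app h₁.1 h₂.1, hG.used h₁.2 h₂.2⟩
  | pair hG _ _ ih₁ ih₂ =>
    have h₁ := ih₁ (hG.compat_left hH)
    have h₂ := ih₂ (hG.compat_right hH)
    exact ⟨.bin .pair h₁.1 h₂.1, hG.used h₁.2 h₂.2⟩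
  | fst _ ih => exact ⟨.un .fst (ih hH).1, (ih hH).2⟩
  | snd _ ih => exact ⟨.un .snd (ih hH).1, (ih hH).2⟩
  | letP hG h₁ h₂ _ _ ih₁ ih₂ =>
    have k₁ := ih₁ (hG.compat_left hH)
    have k₂ := ih₂ (((hG.compat_right hH).cons _).cons _)
    have u₁ := k₂.2.tail.head
    have u₂ := k₂.2.head
    have k := k₂.1
    rw [h₁] at u₁ k
    rw [h₂] at u₂ k
    exact ⟨.letP u₁ u₂ k₁.1 k, hG.used k₁.2 k₂.2.tail.tail⟩
  | guardI _ _ ih => exact ⟨.guardI (ih hH).1, (ih hH).2⟩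
  | guardE hp _ ih => exact ⟨.un (.guardE hp) (ih hH).1, (ih hH).2⟩
  | asrtI hp _ ih => exact ⟨.un (.asrtI hp) (ih hH).1, (ih hH).2⟩
  | letA hG h _ _ ih₁ ih₂ =>
    have k₁ := ih₁ (hG.compat_left hH)
    have k₂ := ih₂ ((hG.compat_right hH).cons _)
    have u := k₂.2.head
    have k := k₂.1
    rw [h] at u k
    exact ⟨.letA u k₁.1 k, hG.used k₁.2 k₂.2.tail⟩
  | allI _ _ ih => exact ⟨.allI (ih (hH.wk _)).1, (ih (hH.wk _)).2.of_wk⟩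
  | allE _ ih => exact ⟨.un .allE (ih hH).1, (ih hH).2⟩
  | exI _ ih => exact ⟨.un .exI (ih hH).1, (ih hH).2⟩
  | letE hG h _ _ ih₁ ih₂ =>
    have k₁ := ih₁ (hG.compat_left hH)
    have k₂ := ih₂ (((hG.compat_right hH).wk _).cons _)
    have u := k₂.2.head
    have k := k₂.1
    rw [h] at u k
    exact ⟨.letE u k₁.1 k, hG.used k₁.2 k₂.2.tail.of_wk⟩
  | spawn _ ih => exact ⟨.un .spawn (ih hH).1, (ih hH).2⟩
  | fork h _ ih => exact ⟨.un (.fork h) (ih hH).1, (ih hH).2⟩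
  | cut hG h _ _ ih₁ ih₂ =>
    have h₁ := ih₁ (hG.compat_left hH)
    have h₂ := ih₂ (hG.compat_right hH)
    exact ⟨.bin (.cut h) h₁.1 h₂.1, hG.used h₁.2 h₂.2⟩
  | elim _ ih => exact ⟨.un .elim (ih hH).1, (ih hH).2⟩
  | split hG h _ _ ih₁ ih₂ =>
    have h₁ := ih₁ (hG.compat_left hH)
    have h₂ := ih₂ (hG.compat_right hH)
    exact ⟨.bin (.split h) h₁.1 h₂.1, hG.used h₁.2 h₂.2⟩
  | bsend hG h _ _ ih₁ ih₂ =>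
    have h₁ := ih₁ (hG.compat_left hH)
    have h₂ := ih₂ (hG.compat_right hH)
    exact ⟨.bin (.bsend h) h₁.1 h₂.1, hG.used h₁.2 h₂.2⟩
  | brecv h _ ih => exact ⟨.un (.brecv h) (ih hH).1, (ih hH).2⟩
  | send hG h _ _ ih₁ ih₂ =>
    have h₁ := ih₁ (hG.compat_left hH)
    have h₂ := ih₂ (hG.compat_right hH)
    exact ⟨.bin (.send h) h₁.1 h₂.1, hG.used h₁.2 h₂.2⟩
  | recv h _ ih => exact ⟨.un (.recv h) (ih hH).1, (ih hH).2⟩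
  | skip h _ ih => exact ⟨.un (.skip h) (ih hH).1, (ih hH).2⟩
  | close h _ ih => exact ⟨.un (.close h) (ih hH).1, (ih hH).2⟩
  | wait h _ ih => exact ⟨.un (.wait h) (ih hH).1, (ih hH).2⟩
  | unify h _ ih => exact ⟨.un (.unify h) (ih hH).1, (ih hH).2⟩
  | exify h _ ih => exact ⟨.un (.exify h) (ih hH).1, (ih hH).2⟩

/-! ## Static substitution preserves typing -/

theorem UTy.ssub {Γ Δ : List Srt} {P : List (STm R Γ .bool)} {Q : List (STm R Δ .bool)}
    {o : UOp R Γ} {t u : STm R Γ (.ty true)} (h : UTy P o t u) {σ : SSub R Γ Δ}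
    (hσ : EntailsSub P Q σ) : UTy Q (o.ssub σ) (t.sub σ) (u.sub σ) := by
  cases h with
  | fst => exact .fst
  | snd => exact .snd
  | guardE hp => rw [STm.up_sub, STm.up_sub]; exact .guardE (hσ.entails hp)
  | asrtI hp => rw [STm.up_sub, STm.up_sub]; exact .asrtI (hσ.entails hp)
  | allE => rw [STm.up_sub, STm.up_sub, STm.inst_sub]; exact .allE
  | exI => rw [STm.up_sub, STm.up_sub, STm.inst_sub]; exact .exI
  | spawn => exact .spawn
  | fork hp => exact .fork (hσ.entails hp)
  | elim => exact .elim
  | brecv hp => exact .brecv (hσ.entails hp)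
  | recv hp => exact .recv (hσ.entails hp)
  | skip hp => exact .skip (hσ.entails hp)
  | close hp => exact .close (hσ.entails hp)
  | wait hp => exact .wait (hσ.entails hp)
  | unify hp =>
    simp only [STm.sub, STm.wk_sub_lift]
    exact .unify (hσ.entails hp)
  | exify hp =>
    simp only [STm.sub, STm.wk_sub_lift]
    exact .exify (hσ.entails hp)

theorem BTy.ssub {Γ Δ : List Srt} {P : List (STm R Γ .bool)} {Q : List (STm R Δ .bool)}
    {o : BOp R Γ} {t₁ t₂ u : STm R Γ (.ty true)} (h : BTy P o t₁ t₂ u) {σ : SSub R Γ Δ}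
    (hσ : EntailsSub P Q σ) : BTy Q (o.ssub σ) (t₁.sub σ) (t₂.sub σ) (u.sub σ) := by
  cases h with
  | app => rw [STm.up_sub]; exact .app
  | pair => rw [STm.up_sub, STm.up_sub, STm.up_sub]; exact .pair
  | arith => exact .arith
  | cut hp => exact .cut (hσ.entails hp)
  | split hp => exact .split (hσ.entails hp)
  | bsend hp => exact .bsend (hσ.entails hp)
  | send hp => exact .send (hσ.entails hp)

theorem TCtx.ssub_cons {Γ Δ : List Srt} {n : ℕ} (G : TCtx R Γ n) (σ : SSub R Γ Δ) (k : Bool)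
    (t : STm R Γ (.ty true)) : (G.cons k t).ssub σ = (G.ssub σ).cons k (t.sub σ) := by
  funext i; cases i using Fin.cases <;> rfl

theorem TCtx.wk_ssub {Γ Δ : List Srt} {n : ℕ} (G : TCtx R Γ n) (σ : SSub R Γ Δ) (a : Srt) :
    (G.wk a).ssub (σ.lift a) = (G.ssub σ).wk a := by
  funext i; simp only [TCtx.wk, TCtx.ssub, STm.wk_sub_lift]

theorem UseOk.ssub {Γ Δ : List Srt} {k : Bool} {t : STm R Γ (.ty true)} {m : ℕ}
    (h : UseOk k t m) (σ : SSub R Γ Δ) : UseOk k (t.sub σ) m := by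
  refine ⟨h.1, fun hk => ?_⟩
  obtain ⟨t', rfl⟩ := h.2 hk
  exact ⟨t'.sub σ, rfl⟩

/-- Static substitution alters neither occurrences nor endpoints, so all linearity conditions are
inherited. Weakening by a static variable and change of assumptions are special cases. -/
theorem Ty.ssub {S : Sig R} {Γ : List Srt} {n : ℕ} {P : List (STm R Γ .bool)} {G : TCtx R Γ n}
    {e : Tm R Γ n} {t : STm R Γ (.ty true)} (h : Ty S P G e t) {Δ : List Srt}
    {Q : List (STm R Δ .bool)} {σ : SSub R Γ Δ} (hσ : EntailsSub P Q σ) :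
    Ty S Q (G.ssub σ) (e.ssub σ) (t.sub σ) := by
  induction h generalizing Δ with
  | conv _ he ih => exact .conv (ih hσ) (he.sub hσ)
  | var i => exact .var (G := TCtx.ssub _ σ) i
  | ep hc =>
    simp only [STm.sub, STm.wkc_sub]
    exact .ep hc
  | opn hc hf =>
    simp only [Tm.ssub, STm.sub, STm.wk_sub_lift]
    refine .opn hc ?_
    have := hf.sub hσ
    rwa [STm.wkc_sub] at this
  | unit => exact .unit
  | ilit k => exact .ilit k
  | blit b => exact .blit b
  | slit x => exact .slit x
  | lam hk hl _ ih =>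
    rw [STm.up_sub]
    refine .lam (by rw [Tm.cnt_ssub]; exact hk.ssub σ) (fun h => ?_) ?_
    · simp only [Tm.cnt_ssub, Tm.rho_ssub]
      exact hl h
    · rw [← TCtx.ssub_cons]; exact ih hσ
  | un ho _ ih => exact .un (ho.ssub hσ) (ih hσ)
  | bin ho _ _ ih₁ ih₂ => exact .bin (ho.ssub hσ) (ih₁ hσ) (ih₂ hσ)
  | letP h₁ h₂ _ _ ih₁ ih₂ =>
    have k₁ := ih₁ hσ
    have k₂ := ih₂ hσ
    have h₁ := h₁.ssub σ
    have h₂ := h₂.ssub σ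
    rw [STm.up_sub] at k₁ h₁ h₂
    rw [TCtx.ssub_cons, TCtx.ssub_cons, STm.up_sub, STm.up_sub] at k₂
    exact .letP (by rwa [Tm.cnt_ssub]) (by rwa [Tm.cnt_ssub]) k₁ k₂
  | guardI _ ih =>
    have := ih (hσ.cons _)
    rw [STm.up_sub] at this ⊢
    exact .guardI this
  | letA hk _ _ ih₁ ih₂ =>
    have k₁ := ih₁ hσ
    have k₂ := ih₂ (hσ.cons _)
    have hk := hk.ssub σ
    rw [STm.up_sub] at k₁ hk
    rw [TCtx.ssub_cons, STm.up_sub] at k₂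
    exact .letA (by rwa [Tm.cnt_ssub]) k₁ k₂
  | allI _ ih =>
    have := ih (hσ.lift _)
    rw [STm.up_sub, TCtx.wk_ssub] at this
    rw [STm.up_sub]
    exact .allI this
  | letE hk _ _ ih₁ ih₂ =>
    have k₁ := ih₁ hσ
    have k₂ := ih₂ (hσ.lift _)
    have hk := hk.ssub (σ.lift _)
    rw [STm.up_sub] at k₁ hk
    rw [TCtx.ssub_cons, TCtx.wk_ssub, STm.up_sub, STm.wk_sub_lift] at k₂
    exact .letE (by rwa [Tm.cnt_ssub]) k₁ k₂

theorem Ty.swk {S : Sig R} {Γ : List Srt} {n : ℕ} {P : List (STm R Γ .bool)} {G : TCtx R Γ n}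
    {e : Tm R Γ n} {t : STm R Γ (.ty true)} (h : Ty S P G e t) (a : Srt) :
    Ty S (P.map (STm.wk a)) (G.wk a) (e.swk a) (t.wk a) := by
  have := h.ssub (EntailsSub.wk P a)
  rw [← STm.wk_eq_sub] at this
  have hG : G.wk a = G.ssub fun _ x => .var (.s x) := by
    funext i; simp only [TCtx.wk, TCtx.ssub, STm.wk_eq_sub]
  rwa [hG]

theorem Ty.entails {S : Sig R} {Γ : List Srt} {n : ℕ} {P Q : List (STm R Γ .bool)}
    {G : TCtx R Γ n} {e : Tm R Γ n} {t : STm R Γ (.ty true)} (h : Ty S P G e t)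
    (hP : ∀ p ∈ P, Entails Q p) : Ty S Q G e t := by
  have := h.ssub (Q := Q) (σ := fun _ x => .var x) fun p hp => by
    rw [STm.sub_var]; exact hP p hp
  rw [STm.sub_var, Tm.ssub_var] at this
  have hG : G.ssub (fun _ x => .var x) = G := by
    funext i; simp only [TCtx.ssub, STm.sub_var]
  rwa [hG] at this

/-! ## Renaming and substitution of dynamic variables preserve typing -/

theorem TCtx.cons_liftRen {Γ : List Srt} {n m : ℕ} {G : TCtx R Γ n} {H : TCtx R Γ m}
    {f : Fin n → Fin m} (h : ∀ i, H (f i) = G i) (k : Bool) (t : STm R Γ (.ty true)) :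
    ∀ i, H.cons k t (liftRen f i) = G.cons k t i := by
  intro i
  cases i using Fin.cases with
  | zero => rfl
  | succ i => exact h i

theorem UseOk.ren {Γ : List Srt} {n m : ℕ} {e : Tm R Γ (n + 1)} {k : Bool}
    {t : STm R Γ (.ty true)} (h : UseOk k t (e.cnt 0)) {f : Fin n → Fin m}
    (hf : Function.Injective f) : UseOk k t ((e.ren (liftRen f)).cnt 0) := by
  have := e.cnt_ren (liftRen_injective hf) 0
  rw [liftRen_zero] at this
  rwa [this]

/-- Variables outside the range of `f` do not occur in the renamed term; for the others, injectivity
preserves the counts. -/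
theorem Ty.ren {S : Sig R} {Γ : List Srt} {n : ℕ} {P : List (STm R Γ .bool)} {G : TCtx R Γ n}
    {e : Tm R Γ n} {t : STm R Γ (.ty true)} (h : Ty S P G e t) {m : ℕ} {H : TCtx R Γ m}
    {f : Fin n → Fin m} (hf : Function.Injective f) (hG : ∀ i, H (f i) = G i) :
    Ty S P H (e.ren f) t := by
  induction h generalizing m with
  | conv _ he ih => exact .conv (ih hf hG) he
  | var i =>
    rw [← hG i]; exact .var _
  | ep hc => exact .ep hc
  | opn hc he => exact .opn hc he
  | unit => exact .unit
  | ilit k => exact .ilit k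
  | blit b => exact .blit b
  | slit x => exact .slit x
  | @lam _ _ _ G e _ _ _ _ hk hl _ ih =>
    refine .lam (hk.ren hf) (fun h => ?_) (ih (liftRen_injective hf) (TCtx.cons_liftRen hG _ _))
    refine ⟨fun j hj => ?_, by rw [Tm.rho_ren]; exact (hl h).2⟩
    by_cases hr : ∃ i, f i = j
    · obtain ⟨i, rfl⟩ := hr
      rw [hG i] at hj
      have := e.cnt_ren (liftRen_injective hf) i.succ
      rw [liftRen_succ] at this
      rw [this]
      exact (hl h).1 i hj
    · push Not at hr
      exact e.cnt_ren_of_ne (liftRen_ne_succ hr)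
  | un ho _ ih => exact .un ho (ih hf hG)
  | bin ho _ _ ih₁ ih₂ => exact .bin ho (ih₁ hf hG) (ih₂ hf hG)
  | @letP _ _ _ _ _ e₂ _ _ _ _ _ _ h₁ h₂ _ _ ih₁ ih₂ =>
    refine .letP ?_ (h₂.ren (liftRen_injective hf)) (ih₁ hf hG)
      (ih₂ (liftRen_injective (liftRen_injective hf))
        (TCtx.cons_liftRen (TCtx.cons_liftRen hG _ _) _ _))
    have : (e₂.ren (liftRen (liftRen f))).cnt 1 = e₂.cnt 1 :=
      e₂.cnt_ren (liftRen_injective (liftRen_injective hf)) 1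
    rwa [this]
  | guardI _ ih => exact .guardI (ih hf hG)
  | letA hk _ _ ih₁ ih₂ =>
    exact .letA (hk.ren hf) (ih₁ hf hG) (ih₂ (liftRen_injective hf) (TCtx.cons_liftRen hG _ _))
  | allI _ ih => exact .allI (ih hf fun i => by simp only [TCtx.wk, hG])
  | letE hk _ _ ih₁ ih₂ =>
    exact .letE (hk.ren hf) (ih₁ hf hG) (ih₂ (liftRen_injective hf)
      (TCtx.cons_liftRen (fun i => by simp only [TCtx.wk, hG]) _ _))

/-- The substitution `f` maps the variables of `G` to terms over `H` of the right types, and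
non-linear variables to terms without linear resources. -/
structure SubTy (S : Sig R) {Γ : List Srt} {n m : ℕ} (P : List (STm R Γ .bool)) (G : TCtx R Γ n)
    (H : TCtx R Γ m) (f : Fin n → Tm R Γ m) : Prop where
  ty : ∀ i, Ty S P H (f i) (G i).2
  rho : ∀ i, (G i).1 = false → (f i).rho = 0
  cnt : ∀ i, (G i).1 = false → ∀ j, (H j).1 = true → (f i).cnt j = 0

theorem SubTy.lift {S : Sig R} {Γ : List Srt} {n m : ℕ} {P : List (STm R Γ .bool)}
    {G : TCtx R Γ n} {H : TCtx R Γ m} {f : Fin n → Tm R Γ m} (h : SubTy S P G H f) (k : Bool)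
    (t : STm R Γ (.ty true)) : SubTy S P (G.cons k t) (H.cons k t) (liftSub f) := by
  refine ⟨fun i => ?_, fun i hi => ?_, fun i hi j hj => ?_⟩
  · cases i using Fin.cases with
    | zero => exact .var (G := H.cons k t) 0
    | succ i => exact (h.ty i).ren (Fin.succ_injective m) fun _ => rfl
  · cases i using Fin.cases with
    | zero => rfl
    | succ i => rw [liftSub_succ, Tm.rho_ren]; exact h.rho i hi
  · cases i using Fin.cases with
    | zero =>
      cases j using Fin.cases with
      | zero =>
        have hi : k = false := hi
        have hj : k = true := hj
        simp [hi] at hj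
      | succ j => simp [Tm.cnt, Fin.ext_iff]
    | succ i =>
      rw [liftSub_succ]
      cases j using Fin.cases with
      | zero => exact Tm.cnt_ren_of_ne _ Fin.succ_ne_zero
      | succ j => rw [Tm.cnt_ren _ (Fin.succ_injective m)]; exact h.cnt i hi j hj

theorem SubTy.entails {S : Sig R} {Γ : List Srt} {n m : ℕ} {P Q : List (STm R Γ .bool)}
    {G : TCtx R Γ n} {H : TCtx R Γ m} {f : Fin n → Tm R Γ m} (h : SubTy S P G H f)
    (hP : ∀ p ∈ P, Entails Q p) : SubTy S Q G H f :=
  ⟨fun i => (h.ty i).entails hP, h.rho, h.cnt⟩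

theorem SubTy.swk {S : Sig R} {Γ : List Srt} {n m : ℕ} {P : List (STm R Γ .bool)}
    {G : TCtx R Γ n} {H : TCtx R Γ m} {f : Fin n → Tm R Γ m} (h : SubTy S P G H f) (a : Srt) :
    SubTy S (P.map (STm.wk a)) (G.wk a) (H.wk a) fun i => (f i).swk a :=
  ⟨fun i => (h.ty i).swk a, fun i hi => by rw [Tm.swk, Tm.rho_ssub]; exact h.rho i hi,
    fun i hi j hj => by rw [Tm.swk, Tm.cnt_ssub]; exact h.cnt i hi j hj⟩

theorem UseOk.sub {Γ : List Srt} {n m : ℕ} {e : Tm R Γ (n + 1)} {k : Bool}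
    {t : STm R Γ (.ty true)} (h : UseOk k t (e.cnt 0)) (f : Fin n → Tm R Γ m) :
    UseOk k t ((e.sub (liftSub f)).cnt 0) := by
  rwa [Tm.cnt_sub, cnt_liftSub_zero]

theorem entails_cons_self {Γ : List Srt} (P : List (STm R Γ .bool)) (p : STm R Γ .bool) :
    ∀ q ∈ P, Entails (p :: P) q :=
  fun q hq _ hv => hv q (List.mem_cons_of_mem _ hq)

/-- The delicate case is a non-linear function. A variable that occurs in its body is not marked
linear, and the images of such variables contain no endpoint and no linear variable, so the body
remains free of both. -/
theorem Ty.sub {S : Sig R} {Γ : List Srt} {n : ℕ} {P : List (STm R Γ .bool)} {G : TCtx R Γ n}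
    {e : Tm R Γ n} {t : STm R Γ (.ty true)} (h : Ty S P G e t) {m : ℕ} {H : TCtx R Γ m}
    {f : Fin n → Tm R Γ m} (hf : SubTy S P G H f) : Ty S P H (e.sub f) t := by
  induction h generalizing m with
  | conv _ he ih => exact .conv (ih hf) he
  | var i => exact hf.ty i
  | ep hc => exact .ep hc
  | opn hc he => exact .opn hc he
  | unit => exact .unit
  | ilit k => exact .ilit k
  | blit b => exact .blit b
  | slit x => exact .slit x
  | @lam _ _ _ G e _ _ _ _ hk hl _ ih =>
    refine .lam (hk.sub f) (fun h => ?_) (ih (hf.lift _ _))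
    have hz : ∀ i, e.cnt i.succ = 0 ∨ (G i).1 = false := by
      intro i
      cases hi : (G i).1 with
      | false => exact .inr rfl
      | true => exact .inl ((hl h).1 i hi)
    constructor
    · intro j hj
      rw [Tm.cnt_sub, cnt_liftSub]
      refine Finset.sum_eq_zero fun i _ => ?_
      rcases hz i with hi | hi
      · rw [hi, zero_mul]
      · rw [hf.cnt i hi j hj, mul_zero]
    · rw [Tm.rho_sub, rho_liftSub, (hl h).2, zero_add]
      refine Finset.sum_eq_zero fun i _ => ?_
      rcases hz i with hi | hi
      · rw [hi, zero_smul]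
      · rw [hf.rho i hi, smul_zero]
  | un ho _ ih => exact .un ho (ih hf)
  | bin ho _ _ ih₁ ih₂ => exact .bin ho (ih₁ hf) (ih₂ hf)
  | @letP _ _ _ _ _ e₂ _ _ _ _ _ _ h₁ h₂ _ _ ih₁ ih₂ =>
    refine .letP ?_ (h₂.sub _) (ih₁ hf) (ih₂ ((hf.lift _ _).lift _ _))
    have : (e₂.sub (liftSub (liftSub f))).cnt 1 = e₂.cnt 1 := by
      rw [Tm.cnt_sub]
      exact (cnt_liftSub (liftSub f) e₂.cnt 0).trans (cnt_liftSub_zero f fun i => e₂.cnt i.succ)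
    rwa [this]
  | guardI _ ih => exact .guardI (ih (hf.entails (entails_cons_self _ _)))
  | letA hk _ _ ih₁ ih₂ =>
    exact .letA (hk.sub f) (ih₁ hf) (ih₂ ((hf.entails (entails_cons_self _ _)).lift _ _))
  | allI _ ih => exact .allI (ih (hf.swk _))
  | letE hk _ _ ih₁ ih₂ => exact .letE (hk.sub _) (ih₁ hf) (ih₂ ((hf.swk _).lift _ _))

/-! ## Change of signature -/

/-- Only the channels that occur in the term matter, and the session type may change to a provably
equal one. The latter is what a cut needs, where two channels with equal session types become one.
-/
theorem Ty.chren {S S' : Sig R} {Γ : List Srt} {n : ℕ} {P : List (STm R Γ .bool)}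
    {G : TCtx R Γ n} {e : Tm R Γ n} {t : STm R Γ (.ty true)} (h : Ty S P G e t) {f : ℕ → ℕ}
    (hf : ∀ x ∈ e.rho, ∀ π, S x.1 = some π → ∃ π', S' (f x.1) = some π' ∧ SEq [] π' π) :
    Ty S' P G (e.chren f) t := by
  induction h with
  | conv _ he ih => exact .conv (ih hf) he
  | var i => exact .var i
  | ep hc =>
    obtain ⟨π', h, h'⟩ := hf _ (Multiset.mem_singleton_self _) _ hc
    exact .conv (.ep h) (.chan (.refl _) (h'.wkc _))
  | opn hc he =>
    obtain ⟨π', h, h'⟩ := hf _ (Multiset.mem_singleton_self _) _ hc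
    exact .opn h ((h'.wkc _).trans he)
  | unit => exact .unit
  | ilit k => exact .ilit k
  | blit b => exact .blit b
  | slit x => exact .slit x
  | lam hk hl _ ih =>
    refine .lam (by rwa [Tm.cnt_chren]) (fun h => ?_) (ih hf)
    simp only [Tm.cnt_chren, Tm.rho_chren, (hl h).2, Multiset.map_zero, and_true]
    exact (hl h).1
  | un ho _ ih => exact .un ho (ih hf)
  | bin ho _ _ ih₁ ih₂ =>
    exact .bin ho (ih₁ fun x hx => hf x (Multiset.mem_add.2 (.inl hx)))
      (ih₂ fun x hx => hf x (Multiset.mem_add.2 (.inr hx)))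
  | letP h₁ h₂ _ _ ih₁ ih₂ =>
    exact .letP (by rwa [Tm.cnt_chren]) (by rwa [Tm.cnt_chren])
      (ih₁ fun x hx => hf x (Multiset.mem_add.2 (.inl hx)))
      (ih₂ fun x hx => hf x (Multiset.mem_add.2 (.inr hx)))
  | guardI _ ih => exact .guardI (ih hf)
  | letA hk _ _ ih₁ ih₂ =>
    exact .letA (by rwa [Tm.cnt_chren])
      (ih₁ fun x hx => hf x (Multiset.mem_add.2 (.inl hx)))
      (ih₂ fun x hx => hf x (Multiset.mem_add.2 (.inr hx)))
  | allI _ ih => exact .allI (ih hf)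
  | letE hk _ _ ih₁ ih₂ =>
    exact .letE (by rwa [Tm.cnt_chren])
      (ih₁ fun x hx => hf x (Multiset.mem_add.2 (.inl hx)))
      (ih₂ fun x hx => hf x (Multiset.mem_add.2 (.inr hx)))

theorem Ty.sig {S S' : Sig R} {Γ : List Srt} {n : ℕ} {P : List (STm R Γ .bool)}
    {G : TCtx R Γ n} {e : Tm R Γ n} {t : STm R Γ (.ty true)} (h : Ty S P G e t)
    (hS : ∀ x ∈ e.rho, S' x.1 = S x.1) : Ty S' P G e t := by
  rw [← Tm.chren_id e]
  exact h.chren fun x hx π hπ => ⟨π, by rw [hS x hx, hπ], .refl _⟩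

/-! ## Values of non-linear types hold no endpoints -/

theorem STm.tag_up {Γ : List Srt} {l : Bool} {t u : STm R Γ (.ty l)} {v : TagEnv Γ}
    (hu : u.up.tag v = true) (h : l = true → u.up.tag v = false) : t.up.tag v = true := by
  cases l with
  | false => rfl
  | true => rw [h rfl] at hu; cases hu

/-- The statement is for arbitrary assumptions and static contexts because values occur under guards
and static abstractions. The tag excludes the linear formers; a non-linear function is empty by its
typing rule, and the remaining cases reduce to components. -/
theorem Ty.rho_eq_zero {S : Sig R} {Γ : List Srt} {n : ℕ} {P : List (STm R Γ .bool)}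
    {G : TCtx R Γ n} {e : Tm R Γ n} {t : STm R Γ (.ty true)} (h : Ty S P G e t) (he : Value e)
    (v : TagEnv Γ) (ht : t.tag v = true) : e.rho = 0 := by
  induction h with
  | conv _ heq ih => exact ih he v ((heq.tag_eq v).trans ht)
  | var i => rfl
  | ep hc => cases ht
  | opn hc hf => cases ht
  | unit => rfl
  | ilit k => rfl
  | blit b => rfl
  | slit x => rfl
  | @lam _ _ _ _ _ l _ _ _ hk hl _ _ =>
    cases l with
    | false => exact (hl rfl).2
    | true => cases ht
  | un ho _ ih =>
    cases ho with
    | asrtI hp =>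
      cases he with
      | asrtI he => exact ih he v (STm.tag_up ht fun h => by subst h; rfl)
    | @exI _ _ l =>
      cases he with
      | exI he =>
        cases l with
        | false => exact ih he v rfl
        | true => cases ht
    | _ => cases he
  | bin ho _ _ ih₁ ih₂ =>
    cases ho with
    | pair =>
      cases he with
      | pair he₁ he₂ =>
        have h₁ := ih₁ he₁ v (STm.tag_up ht fun h => by subst h; rfl)
        have h₂ := ih₂ he₂ v (STm.tag_up ht fun h => by subst h; rfl)
        simp only [Tm.rho, h₁, h₂, add_zero]
    | _ => cases he
  | letP => cases he
  | guardI _ ih =>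
    cases he with
    | guardI he => exact ih he v (STm.tag_up ht fun h => by subst h; rfl)
  | letA => cases he
  | @allI _ _ _ _ a _ l _ _ ih =>
    cases he with
    | allI he =>
      cases l with
      -- The body is again of an embedded non-linear type whatever the static variable stands for,
      -- so any tag serves.
      | false => exact ih he (TagEnv.cons a.tag0 v) rfl
      | true => cases ht
  | letE => cases he

theorem Ty.rho_of_emb {S : Sig R} {G : TCtx R [] 0} {e : CTm R} {t : STm R [] (.ty false)}
    (h : Ty S [] G e (.emb t)) (he : Value e) : e.rho = 0 :=
  h.rho_eq_zero he (fun _ x => nomatch x) rfl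

/-! ## Inversion of typing -/

section Inversion

variable {S : Sig R} {Γ : List Srt} {n : ℕ} {P : List (STm R Γ .bool)} {G : TCtx R Γ n}

/-- Conversion is the only rule not directed by syntax; consecutive conversions at the root combine
into a single equation. The other inversion lemmas work in the same way. -/
theorem Ty.inv_un {o : UOp R Γ} {e : Tm R Γ n} {u : STm R Γ (.ty true)}
    (h : Ty S P G (.un o e) u) : ∃ t u', UTy P o t u' ∧ Ty S P G e t ∧ SEq P u' u := by
  generalize he : Tm.un o e = e' at h
  induction h with
  | conv _ heq ih =>
    obtain ⟨t, u', h₁, h₂, h₃⟩ := ih he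
    exact ⟨t, u', h₁, h₂, h₃.trans heq⟩
  | un ho h _ => cases he; exact ⟨_, _, ho, h, .refl _⟩
  | _ => cases he

theorem Ty.inv_bin {o : BOp R Γ} {e₁ e₂ : Tm R Γ n} {u : STm R Γ (.ty true)}
    (h : Ty S P G (.bin o e₁ e₂) u) :
    ∃ t₁ t₂ u', BTy P o t₁ t₂ u' ∧ Ty S P G e₁ t₁ ∧ Ty S P G e₂ t₂ ∧ SEq P u' u := by
  generalize he : Tm.bin o e₁ e₂ = e' at h
  induction h with
  | conv _ heq ih =>
    obtain ⟨t₁, t₂, u', h₁, h₂, h₃, h₄⟩ := ih he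
    exact ⟨t₁, t₂, u', h₁, h₂, h₃, h₄.trans heq⟩
  | bin ho h₁ h₂ _ _ => cases he; exact ⟨_, _, _, ho, h₁, h₂, .refl _⟩
  | _ => cases he

theorem Ty.inv_lam {e : Tm R Γ (n + 1)} {w : STm R Γ (.ty true)} (h : Ty S P G (.lam e) w) :
    ∃ (l k : Bool) (t u : STm R Γ (.ty true)), UseOk k t (e.cnt 0) ∧
      Ty S P (G.cons k t) e u ∧ SEq P (STm.fn (l := l) t u).up w := by
  generalize he : Tm.lam e = e' at h
  induction h with
  | conv _ heq ih =>
    obtain ⟨l, k, t, u, h₁, h₂, h₃⟩ := ih he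
    exact ⟨l, k, t, u, h₁, h₂, h₃.trans heq⟩
  | lam hk _ h _ => cases he; exact ⟨_, _, _, _, hk, h, .refl _⟩
  | _ => cases he

theorem Ty.inv_ep {c : ℕ} {A : Set R} {t : STm R Γ (.ty true)}
    (h : Ty S P G (.ep c A) t) :
    ∃ π, S c = some π ∧ SEq P (.chan (.setLit A) (π.wkc Γ)) t := by
  generalize he : Tm.ep c A = e' at h
  induction h with
  | conv _ heq ih =>
    obtain ⟨π, h₁, h₂⟩ := ih he
    exact ⟨π, h₁, h₂.trans heq⟩
  | ep hc => cases he; exact ⟨_, hc, .refl _⟩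
  | _ => cases he

theorem Ty.inv_opn {c : ℕ} {A : Set R} {a : Srt} {s : STm R Γ a} {t : STm R Γ (.ty true)}
    (h : Ty S P G (.opn c A s) t) :
    ∃ π, ∃ f : STm R Γ (.arr a .stype), S c = some π ∧ SEq P (π.wkc Γ) (.app f s) ∧
      SEq P (.all (.chan (.setLit A) (.app (f.wk a) (.var .z)))) t := by
  generalize he : Tm.opn c A s = e' at h
  induction h with
  | conv _ heq ih =>
    obtain ⟨π, f, h₁, h₂, h₃⟩ := ih he
    exact ⟨π, f, h₁, h₂, h₃.trans heq⟩
  | opn hc hf => cases he; exact ⟨_, _, hc, hf, .refl _⟩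
  | _ => cases he

theorem Ty.inv_ilit {k : ℤ} {t : STm R Γ (.ty true)} (h : Ty S P G (.ilit k) t) :
    SEq P (.emb (.tint (.intLit k))) t := by
  generalize he : Tm.ilit k = e' at h
  induction h with
  | conv _ heq ih => exact (ih he).trans heq
  | ilit k => cases he; exact .refl _
  | _ => cases he

theorem Ty.inv_letP {e₁ : Tm R Γ n} {e₂ : Tm R Γ (n + 2)} {u : STm R Γ (.ty true)}
    (h : Ty S P G (.letP e₁ e₂) u) :
    ∃ (l k₁ k₂ : Bool) (t₁ t₂ : STm R Γ (.ty l)), UseOk k₁ t₁.up (e₂.cnt 1) ∧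
      UseOk k₂ t₂.up (e₂.cnt 0) ∧ Ty S P G e₁ (STm.pair t₁ t₂).up ∧
      Ty S P ((G.cons k₁ t₁.up).cons k₂ t₂.up) e₂ u := by
  generalize he : Tm.letP e₁ e₂ = e' at h
  induction h with
  | conv _ heq ih =>
    obtain ⟨l, k₁, k₂, t₁, t₂, h₁, h₂, h₃, h₄⟩ := ih he
    exact ⟨l, k₁, k₂, t₁, t₂, h₁, h₂, h₃, .conv h₄ heq⟩
  | letP h₁ h₂ h₃ h₄ _ _ => cases he; exact ⟨_, _, _, _, _, h₁, h₂, h₃, h₄⟩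
  | _ => cases he

theorem Ty.inv_guardI {v : Tm R Γ n} {u : STm R Γ (.ty true)} (h : Ty S P G (.guardI v) u) :
    ∃ (l : Bool) (p : STm R Γ .bool) (t : STm R Γ (.ty l)), Ty S (p :: P) G v t.up ∧
      SEq P (STm.guard p t).up u := by
  generalize he : Tm.guardI v = e' at h
  induction h with
  | conv _ heq ih =>
    obtain ⟨l, p, t, h₁, h₂⟩ := ih he
    exact ⟨l, p, t, h₁, h₂.trans heq⟩
  | guardI h _ => cases he; exact ⟨_, _, _, h, .refl _⟩
  | _ => cases he

theorem Ty.inv_letA {e₁ : Tm R Γ n} {e₂ : Tm R Γ (n + 1)} {u : STm R Γ (.ty true)}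
    (h : Ty S P G (.letA e₁ e₂) u) :
    ∃ (l k : Bool) (p : STm R Γ .bool) (t : STm R Γ (.ty l)), UseOk k t.up (e₂.cnt 0) ∧
      Ty S P G e₁ (STm.asrt p t).up ∧ Ty S (p :: P) (G.cons k t.up) e₂ u := by
  generalize he : Tm.letA e₁ e₂ = e' at h
  induction h with
  | conv _ heq ih =>
    obtain ⟨l, k, p, t, h₁, h₂, h₃⟩ := ih he
    refine ⟨l, k, p, t, h₁, h₂, .conv h₃ ?_⟩
    -- The conversion moves into the body of the binder, where one more assumption is available.
    have := heq.sub (Q := p :: _) (σ := fun _ x => .var x) fun q hq => by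
      rw [STm.sub_var]; exact entails_cons_self _ _ q hq
    rwa [STm.sub_var, STm.sub_var] at this
  | letA h₁ h₂ h₃ _ _ => cases he; exact ⟨_, _, _, _, h₁, h₂, h₃⟩
  | _ => cases he

theorem Ty.inv_allI {a : Srt} {v : Tm R (a :: Γ) n} {u : STm R Γ (.ty true)}
    (h : Ty S P G (.allI a v) u) :
    ∃ (l : Bool) (t : STm R (a :: Γ) (.ty l)), Ty S (P.map (STm.wk a)) (G.wk a) v t.up ∧
      SEq P (STm.all t).up u := by
  generalize he : Tm.allI a v = e' at h
  induction h with
  | conv _ heq ih =>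
    obtain ⟨l, t, h₁, h₂⟩ := ih he
    exact ⟨l, t, h₁, h₂.trans heq⟩
  | allI h _ => cases he; exact ⟨_, _, h, .refl _⟩
  | _ => cases he

theorem Ty.inv_letE {a : Srt} {e₁ : Tm R Γ n} {e₂ : Tm R (a :: Γ) (n + 1)}
    {u : STm R Γ (.ty true)} (h : Ty S P G (.letE a e₁ e₂) u) :
    ∃ (l k : Bool) (t : STm R (a :: Γ) (.ty l)), UseOk k t.up (e₂.cnt 0) ∧
      Ty S P G e₁ (STm.ex t).up ∧
      Ty S (P.map (STm.wk a)) ((G.wk a).cons k t.up) e₂ (u.wk a) := by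
  generalize he : Tm.letE a e₁ e₂ = e' at h
  induction h with
  | conv _ heq ih =>
    obtain ⟨l, k, t, h₁, h₂, h₃⟩ := ih he
    exact ⟨l, k, t, h₁, h₂, .conv h₃ (heq.wk a)⟩
  | letE h₁ h₂ h₃ _ _ => cases he; exact ⟨_, _, _, h₁, h₂, h₃⟩
  | _ => cases he

end Inversion

/-! ## Injectivity of type formers -/

theorem SEq.emb_inj {t u : STm R [] (.ty false)} (h : SEq [] (.emb t) (.emb u)) : SEq [] t u := by
  cases h.head_ty (.emb (.refl _)) (.emb (.refl _)) with
  | emb h => exact h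

/-- Separates linear from non-linear formers: the embedding is itself a former, so it equals no
other head form of the linear sort. -/
theorem SEq.emb_head {t : STm R [] (.ty false)} {u w : STm R [] (.ty true)}
    (h : SEq [] (.emb t) u) (hu : HeadEq u w) : ∃ u', u = .emb u' := by
  cases h.head_ty (.emb (.refl _)) (hu.trans hu.symm) with
  | emb h => exact ⟨_, rfl⟩

theorem SEq.chan_inj {s s' : STm R [] .set} {π π' : STm R [] .stype}
    (h : SEq [] (.chan s π) (.chan s' π')) : SEq [] s s' ∧ SEq [] π π' := by
  cases h.head_ty (.chan (.refl _) (.refl _)) (.chan (.refl _) (.refl _)) with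
  | chan h₁ h₂ => exact ⟨h₁, h₂⟩

/-- The two sides may a priori differ in linearity. Mixed cases would equate an embedded type with a
linear former, which is impossible. The same pattern serves the other formers below. -/
theorem SEq.fn_inj {l l' : Bool} {t u t' u' : STm R [] (.ty true)}
    (h : SEq [] (STm.fn (l := l) t u).up (STm.fn (l := l') t' u').up) :
    SEq [] t t' ∧ SEq [] u u' := by
  have key : ∀ {l : Bool}, SEq [] (STm.fn (l := l) t u) (STm.fn (l := l) t' u') →
      SEq [] t t' ∧ SEq [] u u' := by
    intro l h
    cases h.head_ty (.fn (.refl _) (.refl _)) (.fn (.refl _) (.refl _)) with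
    | fn h₁ h₂ => exact ⟨h₁, h₂⟩
  cases l <;> cases l'
  · exact key h.emb_inj
  · obtain ⟨_, h⟩ := h.emb_head (.fn (.refl _) (.refl _)); cases h
  · obtain ⟨_, h⟩ := h.symm.emb_head (.fn (.refl _) (.refl _)); cases h
  · exact key h

theorem SEq.pair_inj {l l' : Bool} {t u : STm R [] (.ty l)} {t' u' : STm R [] (.ty l')}
    (h : SEq [] (STm.pair t u).up (STm.pair t' u').up) :
    SEq [] t.up t'.up ∧ SEq [] u.up u'.up := by
  have key : ∀ {l : Bool} {t u t' u' : STm R [] (.ty l)},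
      SEq [] (STm.pair t u) (STm.pair t' u') → SEq [] t.up t'.up ∧ SEq [] u.up u'.up := by
    intro l t u t' u' h
    cases h.head_ty (.pair (.refl _) (.refl _)) (.pair (.refl _) (.refl _)) with
    | pair h₁ h₂ => exact ⟨h₁.up, h₂.up⟩
  cases l <;> cases l'
  · exact key h.emb_inj
  · obtain ⟨_, h⟩ := h.emb_head (.pair (.refl _) (.refl _)); cases h
  · obtain ⟨_, h⟩ := h.symm.emb_head (.pair (.refl _) (.refl _)); cases h
  · exact key h

theorem SEq.guard_inj {l l' : Bool} {p p' : STm R [] .bool} {t : STm R [] (.ty l)}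
    {t' : STm R [] (.ty l')} (h : SEq [] (STm.guard p t).up (STm.guard p' t').up) :
    SEq [] p p' ∧ SEq [] t.up t'.up := by
  have key : ∀ {l : Bool} {t t' : STm R [] (.ty l)},
      SEq [] (STm.guard p t) (STm.guard p' t') → SEq [] p p' ∧ SEq [] t.up t'.up := by
    intro l t t' h
    cases h.head_ty (.guard (.refl _) (.refl _)) (.guard (.refl _) (.refl _)) with
    | guard h₁ h₂ => exact ⟨h₁, h₂.up⟩
  cases l <;> cases l'
  · exact key h.emb_inj
  · obtain ⟨_, h⟩ := h.emb_head (.guard (.refl _) (.refl _)); cases h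
  · obtain ⟨_, h⟩ := h.symm.emb_head (.guard (.refl _) (.refl _)); cases h
  · exact key h

theorem SEq.asrt_inj {l l' : Bool} {p p' : STm R [] .bool} {t : STm R [] (.ty l)}
    {t' : STm R [] (.ty l')} (h : SEq [] (STm.asrt p t).up (STm.asrt p' t').up) :
    SEq [] p p' ∧ SEq [] t.up t'.up := by
  have key : ∀ {l : Bool} {t t' : STm R [] (.ty l)},
      SEq [] (STm.asrt p t) (STm.asrt p' t') → SEq [] p p' ∧ SEq [] t.up t'.up := by
    intro l t t' h
    cases h.head_ty (.asrt (.refl _) (.refl _)) (.asrt (.refl _) (.refl _)) with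
    | asrt h₁ h₂ => exact ⟨h₁, h₂.up⟩
  cases l <;> cases l'
  · exact key h.emb_inj
  · obtain ⟨_, h⟩ := h.emb_head (.asrt (.refl _) (.refl _)); cases h
  · obtain ⟨_, h⟩ := h.symm.emb_head (.asrt (.refl _) (.refl _)); cases h
  · exact key h

theorem SEq.all_inj {l l' : Bool} {a : Srt} {t : STm R [a] (.ty l)}
    {t' : STm R [a] (.ty l')} (h : SEq [] (STm.all t).up (STm.all t').up) (s : STm R [] a) :
    SEq [] (t.inst s).up (t'.inst s).up := by
  have key : ∀ {l : Bool} {t t' : STm R [a] (.ty l)},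
      SEq [] (STm.all t) (STm.all t') → SEq [] (t.inst s).up (t'.inst s).up := by
    intro l t t' h
    cases h.head_ty (.all (.refl _)) (.all (.refl _)) with
    | all h => exact (h.inst s).up
  cases l <;> cases l'
  · exact key h.emb_inj
  · obtain ⟨_, h⟩ := h.emb_head (.all (.refl _)); cases h
  · obtain ⟨_, h⟩ := h.symm.emb_head (.all (.refl _)); cases h
  · exact key h

theorem SEq.ex_inj {l l' : Bool} {a : Srt} {t : STm R [a] (.ty l)}
    {t' : STm R [a] (.ty l')} (h : SEq [] (STm.ex t).up (STm.ex t').up) (s : STm R [] a) :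
    SEq [] (t.inst s).up (t'.inst s).up := by
  have key : ∀ {l : Bool} {t t' : STm R [a] (.ty l)},
      SEq [] (STm.ex t) (STm.ex t') → SEq [] (t.inst s).up (t'.inst s).up := by
    intro l t t' h
    cases h.head_ty (.ex (.refl _)) (.ex (.refl _)) with
    | ex h => exact (h.inst s).up
  cases l <;> cases l'
  · exact key h.emb_inj
  · obtain ⟨_, h⟩ := h.emb_head (.ex (.refl _)); cases h
  · obtain ⟨_, h⟩ := h.symm.emb_head (.ex (.refl _)); cases h
  · exact key h

theorem SEq.tint_inj {i j : STm R [] .int} (h : SEq [] (.emb (.tint i)) (.emb (.tint j))) :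
    i.val = j.val := by
  cases h.emb_inj.head_ty (.tint (.refl _)) (.tint (.refl _)) with
  | tint h => exact h.val_eq

/-! ## Contraction preserves types and endpoints -/

section Contraction

variable {S : Sig R} {G : TCtx R [] 0}

/-- Either there is exactly one copy, or the value is non-linear and has no endpoints, so that the
number of copies is irrelevant. -/
theorem UseOk.smul_rho {k : Bool} {t : STm R [] (.ty true)} {m : ℕ} (h : UseOk k t m) {v : CTm R}
    (hv : Value v) (ht : Ty S [] G v t) : m • v.rho = v.rho := by
  cases k with
  | true => rw [h.1 rfl, one_smul]
  | false =>
    obtain ⟨t', rfl⟩ := h.2 rfl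
    rw [ht.rho_of_emb hv, smul_zero]

theorem UseOk.rho_eq {t : STm R [] (.ty true)} {m : ℕ} (h : UseOk false t m) {v : CTm R}
    (hv : Value v) (ht : Ty S [] G v t) : v.rho = 0 := by
  obtain ⟨t', rfl⟩ := h.2 rfl
  exact ht.rho_of_emb hv

/-- Besides preserving types, substituting a value for a bound variable preserves the total of
endpoints exactly. -/
theorem Ty.inst {P : List (STm R [] .bool)} {k : Bool} {t u : STm R [] (.ty true)}
    {e : Tm R [] 1} (he : Ty S P (G.cons k t) e u) (hk : UseOk k t (e.cnt 0)) {v : CTm R}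
    (hv : Value v) (ht : Ty S [] G v t) :
    Ty S P G (e.inst v) u ∧ (e.inst v).rho = e.rho + v.rho := by
  constructor
  · refine he.sub ⟨fun i => ?_, fun i hi => ?_, fun _ _ j => j.elim0⟩
    · cases i using Fin.cases with
      | zero => exact ht.entails (by simp)
      | succ i => exact i.elim0
    · cases i using Fin.cases with
      | zero =>
        have hi : k = false := hi
        subst hi
        exact hk.rho_eq hv ht
      | succ i => exact i.elim0
  · rw [Tm.inst, Tm.rho_sub]
    simp only [Fin.sum_univ_succ, Fin.sum_univ_zero, add_zero, hk.smul_rho hv ht]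

/-- Index 0 is the innermost binder, hence the second component of the pair. -/
theorem Ty.inst₂ {k₁ k₂ : Bool} {t₁ t₂ u : STm R [] (.ty true)} {e : Tm R [] 2}
    (he : Ty S [] ((G.cons k₁ t₁).cons k₂ t₂) e u) (h₁ : UseOk k₁ t₁ (e.cnt 1))
    (h₂ : UseOk k₂ t₂ (e.cnt 0)) {v w : CTm R} (hv : Value v) (hw : Value w)
    (hvt : Ty S [] G v t₁) (hwt : Ty S [] G w t₂) :
    Ty S [] G (e.sub ![w, v]) u ∧ (e.sub ![w, v]).rho = e.rho + (v.rho + w.rho) := by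
  constructor
  · refine he.sub ⟨fun i => ?_, fun i hi => ?_, fun _ _ j => j.elim0⟩
    · match i with
      | 0 => exact hwt
      | 1 => exact hvt
    · match i with
      | 0 =>
        have hi : k₂ = false := hi
        subst hi
        exact h₂.rho_eq hw hwt
      | 1 =>
        have hi : k₁ = false := hi
        subst hi
        exact h₁.rho_eq hv hvt
  · rw [Tm.rho_sub, Fin.sum_univ_two]
    change e.rho + (e.cnt 0 • w.rho + e.cnt 1 • v.rho) = _
    rw [h₁.smul_rho hv hvt, h₂.smul_rho hw hwt, add_comm w.rho]

theorem Ty.inv_pair {v w : CTm R} {l : Bool} {t u : STm R [] (.ty l)}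
    (h : Ty S [] G (.bin .pair v w) (STm.pair t u).up) : Ty S [] G v t.up ∧ Ty S [] G w u.up := by
  obtain ⟨t₁, t₂, u', ho, h₁, h₂, heq⟩ := h.inv_bin
  cases ho with
  | pair => exact ⟨.conv h₁ heq.pair_inj.1, .conv h₂ heq.pair_inj.2⟩

theorem Ty.inv_lam_fn {e : Tm R [] 1} {l : Bool} {t u : STm R [] (.ty true)}
    (h : Ty S [] G (.lam e) (STm.fn (l := l) t u).up) : ∃ k t', UseOk k t' (e.cnt 0) ∧
      Ty S [] (G.cons k t') e u ∧ SEq [] t t' := by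
  obtain ⟨l', k, t', u', hk, he, heq⟩ := h.inv_lam
  exact ⟨k, t', hk, .conv he heq.fn_inj.2, heq.fn_inj.1.symm⟩

theorem TCtx.eq_nil (G H : TCtx R [] 0) : G = H := funext fun i => i.elim0

/-- Subject reduction for one thread. Equality of endpoint multisets shows that a local step does
not change the graph of the pool; for projections the discarded component is non-linear and thus
empty. -/
theorem Contract.preserves {e e' : CTm R} (h : Contract e e') {t : STm R [] (.ty true)}
    (ht : Ty S [] G e t) : Ty S [] G e' t ∧ e'.rho = e.rho := by
  cases h with
  | beta hv =>
    obtain ⟨t₁, t₂, u, ho, h₁, h₂, heq⟩ := ht.inv_bin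
    cases ho with
    | app =>
      obtain ⟨k, t', hk, he, htt⟩ := h₁.inv_lam_fn
      have := he.inst hk hv (.conv h₂ htt)
      exact ⟨.conv this.1 heq, this.2⟩
  | letP hv hw =>
    obtain ⟨l, k₁, k₂, t₁, t₂, h₁, h₂, hp, he⟩ := ht.inv_letP
    have := he.inst₂ h₁ h₂ hv hw hp.inv_pair.1 hp.inv_pair.2
    exact ⟨this.1, this.2.trans (add_comm _ _)⟩
  | fst hv hw =>
    obtain ⟨t₁, u, ho, h₁, heq⟩ := ht.inv_un
    cases ho with
    | @fst t₁ t₂ =>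
      have := Ty.inv_pair (l := false) (t := t₁) (u := t₂) h₁
      refine ⟨.conv this.1 heq, ?_⟩
      simp only [Tm.rho, this.2.rho_of_emb hw, add_zero]
  | snd hv hw =>
    obtain ⟨t₁, u, ho, h₁, heq⟩ := ht.inv_un
    cases ho with
    | @snd t₁ t₂ =>
      have := Ty.inv_pair (l := false) (t := t₁) (u := t₂) h₁
      refine ⟨.conv this.2 heq, ?_⟩
      simp only [Tm.rho, this.1.rho_of_emb hv, zero_add]
  | guard hv =>
    obtain ⟨t₁, u, ho, h₁, heq⟩ := ht.inv_un
    cases ho with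
    | guardE hp =>
      obtain ⟨l, p, t', h₂, heq'⟩ := h₁.inv_guardI
      obtain ⟨e₁, e₂⟩ := heq'.guard_inj
      -- The proposition assumed by the value equals the one established at its elimination, so it
      -- is true and the assumption can be dropped.
      refine ⟨.conv (.conv (h₂.entails fun q hq => ?_) e₂) heq, rfl⟩
      obtain rfl := List.mem_singleton.1 hq
      rw [entails_nil] at hp ⊢
      rwa [e₁.val_eq]
  | asrt hv =>
    obtain ⟨l, k, p, t₁, hk, h₁, h₂⟩ := ht.inv_letA
    obtain ⟨t₂, u, ho, h₃, heq⟩ := h₁.inv_un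
    generalize hw : (STm.asrt p t₁).up = w at heq
    cases ho with
    | asrtI hp =>
      subst hw
      obtain ⟨e₁, e₂⟩ := heq.asrt_inj
      have := h₂.inst hk hv (.conv h₃ e₂)
      refine ⟨this.1.entails fun q hq => ?_, this.2.trans (add_comm _ _)⟩
      obtain rfl := List.mem_singleton.1 hq
      rw [entails_nil] at hp ⊢
      rwa [← e₁.val_eq]
  | @all _ s _ hv =>
    obtain ⟨t₁, u, ho, h₁, heq⟩ := ht.inv_un
    cases ho with
    | allE =>
      obtain ⟨l, t', h₂, heq'⟩ := h₁.inv_allI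
      have := h₂.ssub (Q := []) (σ := SSub.single s) (EntailsSub.nil _ _)
      rw [STm.up_sub, TCtx.eq_nil (TCtx.ssub _ _) G] at this
      exact ⟨.conv (.conv this (heq'.all_inj s)) heq, Tm.rho_ssub _ _⟩
  | @allOpn _ s c A =>
    obtain ⟨t₁, u, ho, h₁, heq⟩ := ht.inv_un
    cases ho with
    | allE =>
      obtain ⟨π, f, hc, hf, heq'⟩ := h₁.inv_opn
      have := SEq.all_inj (l := true) heq' s
      -- The witness stored in the term is the one supplied by the instantiation, and the channel
      -- already has a session type equal to `f s`.
      refine ⟨.conv (.conv (.conv (.ep hc) (.chan (.refl _) hf)) ?_) heq, rfl⟩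
      have h : ((STm.chan (.setLit A) (.app (f.wk _) (.var .z))).inst s).up =
          .chan (.setLit A) (.app ((f.wk _).inst s) s) := rfl
      rw [STm.wk_inst] at h
      rwa [h] at this
  | @ex _ s _ _ hv =>
    obtain ⟨l, k, t₁, hk, h₁, h₂⟩ := ht.inv_letE
    obtain ⟨t₂, u, ho, h₃, heq⟩ := h₁.inv_un
    cases ho with
    | exI =>
      have h₄ := h₂.ssub (Q := []) (σ := SSub.single s) (EntailsSub.nil _ _)
      rw [TCtx.ssub_cons, TCtx.eq_nil (TCtx.ssub _ _) G, STm.up_sub] at h₄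
      have hk := hk.ssub (SSub.single s)
      rw [STm.up_sub, ← Tm.cnt_ssub _ (SSub.single s)] at hk
      have := h₄.inst hk hv (.conv h₃ (heq.ex_inj s))
      rw [Tm.rho_ssub] at this
      have hu : (t.wk _).sub (SSub.single s) = t := t.wk_inst s
      rw [hu] at this
      exact ⟨this.1, this.2.trans (add_comm _ _)⟩
  | @arith _ f i j _ =>
    obtain ⟨t₁, t₂, u, ho, h₁, h₂, heq⟩ := ht.inv_bin
    cases ho with
    | arith =>
      refine ⟨.conv (.conv (.ilit _) (.emb (.tint (.data trivial fun v _ => ?_)))) heq, rfl⟩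
      have e₁ := h₁.inv_ilit.tint_inj
      have e₂ := h₂.inv_ilit.tint_inj
      rw [STm.eval_nil, STm.eval_nil]
      change f i j = f _ _
      exact congr (congrArg f e₁) e₂

end Contraction

/-! ## Evaluation contexts -/

/-- The endpoints in one layer of an evaluation context. -/
def Frame.rho : Frame R → Multiset (ℕ × Set R)
  | .un _ => 0
  | .binL _ e => e.rho
  | .binR _ v _ => v.rho
  | .letP e => e.rho
  | .letA e => e.rho
  | .letE _ e => e.rho

/-- The endpoints in an evaluation context. -/
def ECtx.rho (E : ECtx R) : Multiset (ℕ × Set R) := E.foldr (fun F m => F.rho + m) 0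

theorem Frame.rho_fill (F : Frame R) (e : CTm R) : (F.fill e).rho = F.rho + e.rho := by
  cases F <;> simp only [Frame.fill, Frame.rho, Tm.rho, add_comm, zero_add]

theorem ECtx.rho_plug (E : ECtx R) (e : CTm R) : (E.plug e).rho = E.rho + e.rho := by
  induction E with
  | nil => exact (zero_add _).symm
  | cons F E ih =>
    change (F.fill (ECtx.plug E e)).rho = F.rho + ECtx.rho E + e.rho
    rw [Frame.rho_fill, ih, add_assoc]

/-- The hole has a type that depends only on the frame, and the new content may be typed under
another signature that agrees on the channels of the frame. This is needed because synchronisations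
and new channels alter the signature. -/
theorem Frame.ty_fill {S : Sig R} {G : TCtx R [] 0} (F : Frame R) {e : CTm R}
    {t : STm R [] (.ty true)} (h : Ty S [] G (F.fill e) t) :
    ∃ u, Ty S [] G e u ∧ ∀ (S' : Sig R) (e' : CTm R), (∀ x ∈ F.rho, S' x.1 = S x.1) →
      Ty S' [] G e' u → Ty S' [] G (F.fill e') t := by
  cases F with
  | un o =>
    obtain ⟨t', u, ho, h₁, heq⟩ := Ty.inv_un h
    exact ⟨t', h₁, fun S' e' _ h' => .conv (.un ho h') heq⟩
  | binL o e₂ =>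
    obtain ⟨t₁, t₂, u, ho, h₁, h₂, heq⟩ := Ty.inv_bin h
    exact ⟨t₁, h₁, fun S' e' hS h' => .conv (.bin ho h' (h₂.sig hS)) heq⟩
  | binR o v hv =>
    obtain ⟨t₁, t₂, u, ho, h₁, h₂, heq⟩ := Ty.inv_bin h
    exact ⟨t₂, h₂, fun S' e' hS h' => .conv (.bin ho (h₁.sig hS) h') heq⟩
  | letP e₂ =>
    obtain ⟨l, k₁, k₂, t₁, t₂, h₁, h₂, hp, he⟩ := Ty.inv_letP h
    exact ⟨_, hp, fun S' e' hS h' => .letP h₁ h₂ h' (he.sig hS)⟩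
  | letA e₂ =>
    obtain ⟨l, k, p, t₁, hk, h₁, h₂⟩ := Ty.inv_letA h
    exact ⟨_, h₁, fun S' e' hS h' => .letA hk h' (h₂.sig hS)⟩
  | letE a e₂ =>
    obtain ⟨l, k, t₁, hk, h₁, h₂⟩ := Ty.inv_letE h
    exact ⟨_, h₁, fun S' e' hS h' => .letE hk h' (h₂.sig hS)⟩

theorem ECtx.ty_plug {S : Sig R} {G : TCtx R [] 0} (E : ECtx R) {e : CTm R}
    {t : STm R [] (.ty true)} (h : Ty S [] G (E.plug e) t) :
    ∃ u, Ty S [] G e u ∧ ∀ (S' : Sig R) (e' : CTm R), (∀ x ∈ E.rho, S' x.1 = S x.1) →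
      Ty S' [] G e' u → Ty S' [] G (E.plug e') t := by
  induction E generalizing t with
  | nil => exact ⟨t, h, fun S' e' _ h' => h'⟩
  | cons F E ih =>
    obtain ⟨u, h₁, h₂⟩ := F.ty_fill h
    obtain ⟨w, h₃, h₄⟩ := ih h₁
    exact ⟨w, h₃, fun S' e' hS h' => h₂ S' _ (fun x hx => hS x (Multiset.mem_add.2 (.inl hx)))
      (h₄ S' e' (fun x hx => hS x (Multiset.mem_add.2 (.inr hx))) h')⟩

/-! ## Sub-multisets -/

/-- A set of edges of a union of graphs is divided among the parts; this is the first move in every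
argument about cores. -/
theorem le_add_decomp {α : Type} [DecidableEq α] {F A B : Multiset α} (h : F ≤ A + B) :
    ∃ F₁ ≤ A, ∃ F₂ ≤ B, F = F₁ + F₂ :=
  ⟨F ∩ A, Multiset.inter_le_right, F - A, by rwa [tsub_le_iff_left], by
    rw [add_comm, Multiset.sub_add_inter]⟩

theorem le_add_singleton_decomp {α : Type} {F A : Multiset α} {e : α} (h : F ≤ A + {e}) :
    ∃ F₁ ≤ A, ∃ d ≤ 1, F = F₁ + Multiset.replicate d e := by
  classical
  obtain ⟨F₁, h₁, F₂, h₂, rfl⟩ := le_add_decomp h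
  rcases Multiset.le_singleton.1 h₂ with rfl | rfl
  · exact ⟨F₁, h₁, 0, by simp, by simp⟩
  · exact ⟨F₁, h₁, 1, le_refl _, by simp⟩

theorem le_map_decomp {α β : Type} {f : α → β} {M : Multiset α} {F : Multiset β}
    (h : F ≤ M.map f) : ∃ F₀ ≤ M, F = F₀.map f := by
  classical
  induction M using Multiset.induction_on generalizing F with
  | empty => exact ⟨0, le_refl _, by simpa using h⟩
  | cons a M ih =>
    rw [Multiset.map_cons, ← Multiset.singleton_add] at h
    obtain ⟨F₁, h₁, F₂, h₂, rfl⟩ := le_add_decomp h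
    obtain ⟨F₀, h₀, rfl⟩ := ih h₂
    rcases Multiset.le_singleton.1 h₁ with rfl | rfl
    · exact ⟨F₀, h₀.trans (Multiset.le_cons_self _ _), by simp⟩
    · exact ⟨a ::ₘ F₀, Multiset.cons_le_cons _ h₀, by simp⟩

theorem replicate_le_singleton {α : Type} {d : ℕ} (hd : d ≤ 1) (e : α) :
    Multiset.replicate d e ≤ {e} :=
  Multiset.replicate_mono e hd

theorem two_le_countP {α : Type} {p : α → Prop} [DecidablePred p] {F : Multiset α} {x y : α}
    (hx : x ∈ F) (hy : y ∈ F) (hxy : x ≠ y) (px : p x) (py : p y) : 2 ≤ F.countP p := by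
  obtain ⟨F, rfl⟩ := Multiset.exists_cons_of_mem hx
  obtain ⟨F, rfl⟩ := Multiset.exists_cons_of_mem ((Multiset.mem_cons.1 hy).resolve_left hxy.symm)
  rw [Multiset.countP_cons_of_pos _ px, Multiset.countP_cons_of_pos _ py]
  omega

theorem countP_replicate {α : Type} (p : α → Prop) [DecidablePred p] (d : ℕ) (e : α) :
    (Multiset.replicate d e).countP p = if p e then d else 0 := by
  induction d with
  | zero => simp
  | succ d ih => rw [Multiset.replicate_succ, Multiset.countP_cons, ih]; split_ifs <;> rfl

/-! ## The graph of threads and channels -/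

/-- An edge: the thread holds an endpoint of the channel with the given roles. -/
abbrev Edge (R : Type) : Type := ℕ × ℕ × Set R

/-- The number of edges at a thread. -/
def degT (M : Multiset (Edge R)) (t : ℕ) : ℕ := M.countP fun x => x.1 = t

/-- The number of edges at a channel. -/
def degC (M : Multiset (Edge R)) (c : ℕ) : ℕ := M.countP fun x => x.2.1 = c

theorem degT_add (M N : Multiset (Edge R)) (t : ℕ) : degT (M + N) t = degT M t + degT N t :=
  Multiset.countP_add ..

theorem degC_add (M N : Multiset (Edge R)) (c : ℕ) : degC (M + N) c = degC M c + degC N c :=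
  Multiset.countP_add ..

theorem degT_replicate (d : ℕ) (e : Edge R) (t : ℕ) :
    degT (Multiset.replicate d e) t = if e.1 = t then d else 0 := countP_replicate ..

theorem degC_replicate (d : ℕ) (e : Edge R) (c : ℕ) :
    degC (Multiset.replicate d e) c = if e.2.1 = c then d else 0 := countP_replicate ..

theorem degT_le_card (M : Multiset (Edge R)) (t : ℕ) : degT M t ≤ M.card :=
  Multiset.countP_le_card ..

theorem degC_le_card (M : Multiset (Edge R)) (c : ℕ) : degC M c ≤ M.card :=
  Multiset.countP_le_card ..

theorem degT_map_mk (N : Multiset (ℕ × Set R)) (t s : ℕ) :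
    degT (N.map (Prod.mk t)) s = if t = s then N.card else 0 := by
  induction N using Multiset.induction_on with
  | empty => simp [degT]
  | cons a N ih =>
    simp only [degT] at ih ⊢
    rw [Multiset.map_cons, Multiset.countP_cons, ih, Multiset.card_cons]
    split_ifs <;> rfl

theorem degC_map_mk (N : Multiset (ℕ × Set R)) (t c : ℕ) :
    degC (N.map (Prod.mk t)) c = N.countP fun x => x.1 = c := by
  rw [degC, Multiset.countP_map, Multiset.countP_eq_card_filter]

theorem degC_eq_zero {M F : Multiset (Edge R)} {c : ℕ} (hM : ∀ x ∈ M, x.2.1 ≠ c) (h : F ≤ M) :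
    degC F c = 0 := Multiset.countP_eq_zero.2 fun x hx => hM x (Multiset.mem_of_le h hx)

/-- A nonempty graph in which no thread and no channel has degree one. -/
structure IsCore (F : Multiset (Edge R)) : Prop where
  pos : 0 < F.card
  thr : ∀ t, degT F t ≠ 1
  chn : ∀ c, degC F c ≠ 1

/-- The multigraph of threads and channels has no cycle. -/
def Acyc (M : Multiset (Edge R)) : Prop := ∀ F ≤ M, ¬ IsCore F

/-! ### Operations on graphs that preserve acyclicity -/

theorem Acyc.mono {M N : Multiset (Edge R)} (h : Acyc M) (hN : N ≤ M) : Acyc N :=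
  fun F hF => h F (hF.trans hN)

/-- Two parallel edges form a core: both of their ends have degree two. -/
theorem Acyc.simple {M : Multiset (Edge R)} {t c : ℕ} {A B : Set R}
    (h : Acyc (M + {(t, c, A)} + {(t, c, B)})) : False := by
  refine h ({(t, c, A)} + {(t, c, B)}) (by rw [add_assoc]; exact Multiset.le_add_left _ _)
    ⟨by simp, fun s => ?_, fun d => ?_⟩
  · rw [degT_add, ← Multiset.replicate_one, ← Multiset.replicate_one, degT_replicate,
      degT_replicate]
    split_ifs <;> omega
  · rw [degC_add, ← Multiset.replicate_one, ← Multiset.replicate_one, degC_replicate,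
      degC_replicate]
    split_ifs <;> omega

/-- Merge the thread `t'` into the thread `t`. -/
def mergeT (t t' : ℕ) (x : Edge R) : Edge R := (if x.1 = t' then t else x.1, x.2)

theorem degT_mergeT {t t' : ℕ} (h : t ≠ t') (F : Multiset (Edge R)) (s : ℕ) :
    degT (F.map (mergeT t t')) s =
      if s = t then degT F t + degT F t' else if s = t' then 0 else degT F s := by
  induction F using Multiset.induction_on with
  | empty => simp [degT]
  | cons a F ih =>
    simp only [degT] at ih ⊢
    simp only [Multiset.map_cons, Multiset.countP_cons, ih, mergeT]
    split_ifs <;> omega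

theorem degC_mergeT (t t' : ℕ) (F : Multiset (Edge R)) (c : ℕ) :
    degC (F.map (mergeT t t')) c = degC F c := by
  rw [degC, Multiset.countP_map, degC, Multiset.countP_eq_card_filter]
  rfl

/-- The degrees of `t` and `t'` add up under merging, and two natural numbers different from 1 do
not have sum 1. -/
theorem Acyc.of_mergeT {t t' : ℕ} (htt : t ≠ t') {M : Multiset (Edge R)}
    (h : Acyc (M.map (mergeT t t'))) : Acyc M := by
  intro F hF hc
  refine h _ (Multiset.map_le_map hF) ⟨by rw [Multiset.card_map]; exact hc.pos, fun s => ?_,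
    fun c => by rw [degC_mergeT]; exact hc.chn c⟩
  rw [degT_mergeT htt]
  have h₁ := hc.thr t
  have h₂ := hc.thr t'
  have h₃ := hc.thr s
  split_ifs <;> omega

/-- The vertex `t` is split into two vertices joined by a path through the new channel `c`. A core
contains both edges of the path or none, since `c` has no others. If it contains both, then `t` and
`t'` each have a further edge, and merging them leaves degree at least two. -/
theorem Acyc.fork {t t' c : ℕ} {A B : Set R} (htt : t ≠ t') {M : Multiset (Edge R)}
    (h : Acyc (M.map (mergeT t t'))) (hc : ∀ x ∈ M, x.2.1 ≠ c) :
    Acyc (M + {(t, c, A)} + {(t', c, B)}) := by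
  intro F hF hF'
  obtain ⟨F, hF₁, d', hd', rfl⟩ := le_add_singleton_decomp hF
  obtain ⟨F, hF₃, d, hd, rfl⟩ := le_add_singleton_decomp hF₁
  have hz := degC_eq_zero hc hF₃
  have h₁ := hF'.thr t
  have h₂ := hF'.thr t'
  have h₄ := hF'.chn c
  have h₅ := hF'.pos
  have h₆ := degT_le_card F t
  have h₇ := degT_le_card F t'
  simp only [degT_add, degC_add, degT_replicate, degC_replicate, if_true, if_neg htt,
    if_neg htt.symm, Multiset.card_add, Multiset.card_replicate, hz] at h₁ h₂ h₄ h₅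
  refine h _ (Multiset.map_le_map hF₃) ⟨?_, fun s => ?_, fun b => ?_⟩
  · rw [Multiset.card_map]; omega
  · rw [degT_mergeT htt]
    have h₃ := hF'.thr s
    simp only [degT_add, degT_replicate] at h₃
    split_ifs at h₃ ⊢ <;> omega
  · rw [degC_mergeT]
    have h₃ := hF'.chn b
    simp only [degC_add, degC_replicate] at h₃
    split_ifs at h₃ with hb
    · subst hb; omega
    · omega

/-- The same splitting of `t`, except that `c` may have other edges; the two new edges replace the
one edge between `t` and `c`. -/
theorem Acyc.split {t t' c : ℕ} {A B C : Set R} (htt : t ≠ t') {M : Multiset (Edge R)}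
    (h : Acyc (M.map (mergeT t t') + {(t, c, C)})) :
    Acyc (M + {(t, c, A)} + {(t', c, B)}) := by
  intro F hF hF'
  obtain ⟨F, hF₁, d', hd', rfl⟩ := le_add_singleton_decomp hF
  obtain ⟨F, hF₃, d, hd, rfl⟩ := le_add_singleton_decomp hF₁
  have h₁ := hF'.thr t
  have h₂ := hF'.thr t'
  have h₄ := hF'.chn c
  have h₅ := hF'.pos
  have h₆ := degT_le_card F t
  have h₇ := degT_le_card F t'
  simp only [degT_add, degC_add, degT_replicate, degC_replicate, if_true, if_neg htt,
    if_neg htt.symm, Multiset.card_add, Multiset.card_replicate] at h₁ h₂ h₄ h₅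
  -- `ε` decides whether the core of the merged graph includes the edge from `t` to `c`. One of the
  -- two choices meets all degree conditions.
  obtain ⟨ε, hε, k₁, k₂, k₃⟩ : ∃ ε ≤ 1, degT F t + degT F t' + ε ≠ 1 ∧ degC F c + ε ≠ 1 ∧
      0 < F.card + ε := by
    by_contra hcon
    push Not at hcon
    have e₀ := hcon 0 (by omega)
    have e₁ := hcon 1 (by omega)
    omega
  refine h _ (add_le_add (Multiset.map_le_map hF₃) (replicate_le_singleton hε _))
    ⟨?_, fun s => ?_, fun b => ?_⟩
  · rw [Multiset.card_add, Multiset.card_map, Multiset.card_replicate]; omega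
  · rw [degT_add, degT_mergeT htt, degT_replicate]
    have h₃ := hF'.thr s
    simp only [degT_add, degT_replicate] at h₃
    split_ifs at h₃ ⊢ <;> omega
  · rw [degC_add, degC_mergeT, degC_replicate]
    have h₃ := hF'.chn b
    simp only [degC_add, degC_replicate] at h₃
    split_ifs at h₃ ⊢ with hb
    · subst hb; omega
    · omega

/-- Merge the channels `c₁` and `c₂` into the channel `c`. -/
def mergeC (c₁ c₂ c : ℕ) (x : ℕ) : ℕ := if x = c₁ ∨ x = c₂ then c else x

theorem degT_mapC (f : ℕ → ℕ) (F : Multiset (Edge R)) (t : ℕ) :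
    degT (F.map fun x => (x.1, f x.2.1, x.2.2)) t = degT F t := by
  rw [degT, Multiset.countP_map, degT, Multiset.countP_eq_card_filter]

theorem degC_mergeC {c₁ c₂ c : ℕ} (h : c₁ ≠ c₂) (h₁ : c ≠ c₁) (h₂ : c ≠ c₂)
    (F : Multiset (Edge R)) (b : ℕ) :
    degC (F.map fun x => (x.1, mergeC c₁ c₂ c x.2.1, x.2.2)) b =
      if b = c then degC F c + degC F c₁ + degC F c₂ else
        if b = c₁ ∨ b = c₂ then 0 else degC F b := by
  induction F using Multiset.induction_on with
  | empty => simp [degC]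
  | cons a F ih =>
    simp only [degC, mergeC] at ih ⊢
    simp only [Multiset.map_cons, Multiset.countP_cons, ih]
    split_ifs <;> omega

/-- The path from `c₁` through `t` to `c₂` is contracted to a single edge from `t` to `c`. A core of
the result is undone by restoring a suitable selection of the two edges of the path. -/
theorem Acyc.cut {t c₁ c₂ c : ℕ} {A B C : Set R} (hne : c₁ ≠ c₂) (hc₁ : c ≠ c₁) (hc₂ : c ≠ c₂)
    {M : Multiset (Edge R)} (h : Acyc (M + {(t, c₁, A)} + {(t, c₂, B)}))
    (hc : ∀ x ∈ M, x.2.1 ≠ c) :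
    Acyc ((M.map fun x => (x.1, mergeC c₁ c₂ c x.2.1, x.2.2)) + {(t, c, C)}) := by
  intro F hF hF'
  obtain ⟨F, hF₁, d, hd, rfl⟩ := le_add_singleton_decomp hF
  obtain ⟨F, hF₃, rfl⟩ := le_map_decomp hF₁
  have hz := degC_eq_zero hc hF₃
  have h₁ := hF'.thr t
  have h₂ := hF'.chn c
  have h₅ := hF'.pos
  have h₆ := degC_le_card F c₁
  have h₇ := degC_le_card F c₂
  simp only [degT_add, degC_add, degT_replicate, degC_replicate, if_true, degT_mapC,
    degC_mergeC hne hc₁ hc₂, Multiset.card_add, Multiset.card_replicate, Multiset.card_map,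
    hz] at h₁ h₂ h₅
  -- Each of the edges from `t` to `c₁` and to `c₂` may be included or left out. If all four choices
  -- failed, the degrees at `t` and `c` in the given core would be contradictory.
  obtain ⟨ε, hε, ε', hε', k₁, k₂, k₃, k₄⟩ : ∃ ε ≤ 1, ∃ ε' ≤ 1, degT F t + ε + ε' ≠ 1 ∧
      degC F c₁ + ε ≠ 1 ∧ degC F c₂ + ε' ≠ 1 ∧ 0 < F.card + ε + ε' := by
    by_contra hcon
    push Not at hcon
    have e₀ := hcon 0 (by omega) 0 (by omega)
    have e₁ := hcon 0 (by omega) 1 (by omega)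
    have e₂ := hcon 1 (by omega) 0 (by omega)
    have e₃ := hcon 1 (by omega) 1 (by omega)
    omega
  refine h _ (add_le_add (add_le_add hF₃ (replicate_le_singleton hε _))
    (replicate_le_singleton hε' _)) ⟨?_, fun s => ?_, fun b => ?_⟩
  · simp only [Multiset.card_add, Multiset.card_replicate]; omega
  · have h₃ := hF'.thr s
    simp only [degT_add, degT_mapC, degT_replicate] at h₃ ⊢
    split_ifs at h₃ ⊢ with hs
    · subst hs; omega
    · omega
  · have h₃ := hF'.chn b
    simp only [degC_add, degC_mergeC hne hc₁ hc₂, degC_replicate] at h₃ ⊢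
    by_cases hb₁ : b = c₁
    · subst hb₁; simp only [if_true, if_neg hne.symm]; omega
    · by_cases hb₂ : b = c₂
      · subst hb₂; simp only [if_true, if_neg hne]; omega
      · by_cases hb : b = c
        · subst hb; simp only [if_neg hc₁.symm, if_neg hc₂.symm]; omega
        · simp only [hb, hb₁, hb₂, Ne.symm hb, Ne.symm hb₁, Ne.symm hb₂, if_false,
            or_self] at h₃ ⊢
          omega

/-- The threads `t₁` and `t₂` are joined by a path through `c`, so edges may slide from one end to
the other without closing a cycle. This is the transmission of a linear message that contains
endpoints. -/
theorem Acyc.move {t₁ t₂ c : ℕ} {A B : Set R} (htt : t₁ ≠ t₂) {M : Multiset (Edge R)}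
    {N : Multiset (ℕ × Set R)}
    (h : Acyc (M + N.map (Prod.mk t₁) + {(t₁, c, A)} + {(t₂, c, B)})) :
    Acyc (M + N.map (Prod.mk t₂) + {(t₁, c, A)} + {(t₂, c, B)}) := by
  classical
  intro F hF hF'
  obtain ⟨F, hF₁, d', hd', rfl⟩ := le_add_singleton_decomp hF
  obtain ⟨F, hF₂, d, hd, rfl⟩ := le_add_singleton_decomp hF₁
  obtain ⟨F, hF₃, N', hN₁, rfl⟩ := le_add_decomp hF₂
  obtain ⟨N', hN', rfl⟩ := le_map_decomp hN₁
  have h₁ := hF'.thr t₁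
  have h₂ := hF'.thr t₂
  have h₃ := hF'.chn c
  have h₄ := hF'.pos
  simp only [degT_add, degC_add, degT_replicate, degC_replicate, if_true, degT_map_mk,
    degC_map_mk, if_neg htt, if_neg htt.symm, Multiset.card_add, Multiset.card_replicate,
    Multiset.card_map] at h₁ h₂ h₃ h₄
  -- The edges in `N'` go back to `t₁`; the two edges of the path are included or not so as to
  -- repair the degrees of `t₁`, `t₂` and `c`.
  obtain ⟨ε, hε, ε', hε', k₁, k₂, k₃, k₄⟩ : ∃ ε ≤ 1, ∃ ε' ≤ 1, degT F t₁ + N'.card + ε ≠ 1 ∧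
      degT F t₂ + ε' ≠ 1 ∧ degC F c + N'.countP (fun x => x.1 = c) + ε + ε' ≠ 1 ∧
      0 < F.card + N'.card + ε + ε' := by
    by_contra hcon
    push Not at hcon
    have e₀ := hcon 0 (by omega) 0 (by omega)
    have e₁ := hcon 0 (by omega) 1 (by omega)
    have e₂ := hcon 1 (by omega) 0 (by omega)
    have e₃ := hcon 1 (by omega) 1 (by omega)
    omega
  refine h _ (add_le_add (add_le_add (add_le_add hF₃ (Multiset.map_le_map hN'))
    (replicate_le_singleton hε _)) (replicate_le_singleton hε' _)) ⟨?_, fun s => ?_, fun b => ?_⟩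
  · simp only [Multiset.card_add, Multiset.card_replicate, Multiset.card_map]; omega
  · have h₅ := hF'.thr s
    simp only [degT_add, degT_replicate, degT_map_mk] at h₅ ⊢
    by_cases hs : t₁ = s
    · subst hs; simp only [if_true, if_neg htt.symm]; omega
    · by_cases hs' : t₂ = s
      · subst hs'; simp only [if_true, if_neg htt]; omega
      · simp only [hs, hs', if_false] at h₅ ⊢; omega
  · have h₅ := hF'.chn b
    simp only [degC_add, degC_replicate, degC_map_mk] at h₅ ⊢
    by_cases hb : c = b
    · subst hb; simp only [if_true]; omega
    · simp only [hb, if_false] at h₅ ⊢; omega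

/-- If every thread of an acyclic graph is blocked on one of its channels, then there is a channel
on which all adjacent threads are blocked. -/
theorem Acyc.exists_channel {M : Multiset (Edge R)} (h : Acyc M) (hM : M ≠ 0) (b : ℕ → ℕ)
    (hb : ∀ x ∈ M, ∃ A, (x.1, b x.1, A) ∈ M) :
    ∃ c, (∃ x ∈ M, x.2.1 = c) ∧ ∀ x ∈ M, x.2.1 = c → b x.1 = c := by
  classical
  by_contra hcon
  push Not at hcon
  -- A neighbour of `c` that is blocked elsewhere; off the graph the value is immaterial.
  have hg : ∀ c, ∃ t, (∃ x ∈ M, x.2.1 = c) → (∃ A, (t, c, A) ∈ M) ∧ b t ≠ c := by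
    intro c
    by_cases hc : ∃ x ∈ M, x.2.1 = c
    · obtain ⟨y, hy, rfl, hne⟩ := hcon c hc
      exact ⟨y.1, fun _ => ⟨⟨y.2.2, hy⟩, hne⟩⟩
    · exact ⟨0, fun h => absurd h hc⟩
  choose g hg using hg
  let C : Finset ℕ := (M.map fun x => x.2.1).toFinset
  have hC : ∀ c, c ∈ C ↔ ∃ x ∈ M, x.2.1 = c := fun c => by simp [C]
  -- The nonempty sets of channels closed under passing from `c` to the channel on which `g c` is
  -- blocked. A smallest such set plays the role of a cycle.
  let good : Finset (Finset ℕ) :=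
    C.powerset.filter fun s => s.Nonempty ∧ s.image (fun c => b (g c)) ⊆ s
  have hstep : ∀ c ∈ C, b (g c) ∈ C := by
    intro c hc
    obtain ⟨⟨A, hA⟩, _⟩ := hg c ((hC c).1 hc)
    obtain ⟨B, hB⟩ := hb _ hA
    exact (hC _).2 ⟨_, hB, rfl⟩
  have hgood : good.Nonempty := by
    obtain ⟨x, hx⟩ := Multiset.exists_mem_of_ne_zero hM
    refine ⟨C, Finset.mem_filter.2 ⟨Finset.mem_powerset_self _, ⟨x.2.1, (hC _).2 ⟨x, hx, rfl⟩⟩, ?_⟩⟩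
    intro c hc
    obtain ⟨d, hd, rfl⟩ := Finset.mem_image.1 hc
    exact hstep d hd
  obtain ⟨s, hs, hmin⟩ := good.exists_min_image Finset.card hgood
  obtain ⟨hsC, hne, himg⟩ := Finset.mem_filter.1 hs
  rw [Finset.mem_powerset] at hsC
  -- The image of a closed set is closed, so minimality makes the map onto.
  have hsurj : s.image (fun c => b (g c)) = s := by
    refine Finset.eq_of_subset_of_card_le himg (hmin _ (Finset.mem_filter.2 ⟨?_, ?_, ?_⟩))
    · exact Finset.mem_powerset.2 (himg.trans hsC)
    · exact hne.image _
    · exact Finset.image_subset_image himg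
  have hmem : ∀ c ∈ s, ∀ t ∈ s.image g, ∀ A, (t, c, A) ∈ M →
      (t, c, A) ∈ M.filter fun x : Edge R => x.2.1 ∈ s ∧ x.1 ∈ s.image g :=
    fun c hc t ht A hA => Multiset.mem_filter.2 ⟨hA, hc, ht⟩
  have hown : ∀ c ∈ s, ∃ A, (g c, c, A) ∈
      M.filter fun x : Edge R => x.2.1 ∈ s ∧ x.1 ∈ s.image g := by
    intro c hc
    obtain ⟨⟨A, hA⟩, _⟩ := hg c ((hC c).1 (hsC hc))
    exact ⟨A, hmem c hc _ (Finset.mem_image_of_mem g hc) A hA⟩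
  have hnext : ∀ c ∈ s, ∃ A, (g c, b (g c), A) ∈
      M.filter fun x : Edge R => x.2.1 ∈ s ∧ x.1 ∈ s.image g := by
    intro c hc
    obtain ⟨⟨A, hA⟩, _⟩ := hg c ((hC c).1 (hsC hc))
    obtain ⟨B, hB⟩ := hb _ hA
    exact ⟨B, hmem _ (himg (Finset.mem_image_of_mem _ hc)) _ (Finset.mem_image_of_mem g hc) B hB⟩
  have hdiff : ∀ c ∈ s, b (g c) ≠ c := fun c hc => (hg c ((hC c).1 (hsC hc))).2
  -- The edges between the channels in `s` and the threads chosen for them form a core.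
  refine h (M.filter fun x => x.2.1 ∈ s ∧ x.1 ∈ s.image g) (Multiset.filter_le _ _)
    ⟨?_, fun t ht => ?_, fun c hc => ?_⟩
  · obtain ⟨c, hc⟩ := hne
    obtain ⟨A, hA⟩ := hown c hc
    exact Multiset.card_pos_iff_exists_mem.2 ⟨_, hA⟩
  -- A thread `g c` has an edge to `c` and one to the different channel on which it is blocked.
  · obtain ⟨x, hx, rfl⟩ := Multiset.countP_pos.1 (ht ▸ Nat.one_pos : 0 < degT _ t)
    obtain ⟨c, hc, hcx⟩ := Finset.mem_image.1 (Multiset.mem_filter.1 hx).2.2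
    obtain ⟨A, hA⟩ := hown c hc
    obtain ⟨B, hB⟩ := hnext c hc
    have := two_le_countP (p := fun y : Edge R => y.1 = x.1) hA hB (by
      intro he
      simp only [Prod.mk.injEq] at he
      exact hdiff c hc he.2.1.symm) hcx hcx
    rw [degT] at ht
    omega
  -- By surjectivity a channel `c` in `s` is the one on which some `g d` is blocked. Its neighbours
  -- `g c` and `g d` are distinct, because `g c` is blocked elsewhere.
  · obtain ⟨x, hx, rfl⟩ := Multiset.countP_pos.1 (hc ▸ Nat.one_pos : 0 < degC _ c)
    have hxs := (Multiset.mem_filter.1 hx).2.1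
    obtain ⟨A, hA⟩ := hown _ hxs
    have hxs' := hxs
    rw [← hsurj] at hxs'
    obtain ⟨d, hd, hdx⟩ := Finset.mem_image.1 hxs'
    obtain ⟨B, hB⟩ := hnext d hd
    have := two_le_countP (p := fun y : Edge R => y.2.1 = x.2.1) hA hB (by
      intro he
      simp only [Prod.mk.injEq] at he
      have h' := hdiff _ hxs
      rw [he.1] at h'
      exact h' hdx) rfl hdx
    rw [degC] at hc
    omega

/-! ## Partitions of the roles -/

/-- The number of endpoints of a channel. -/
def numC (N : Multiset (ℕ × Set R)) (c : ℕ) : ℕ := N.countP fun x => x.1 = c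

open Classical in
/-- The number of endpoints of a channel that play a given role. -/
noncomputable def numR (N : Multiset (ℕ × Set R)) (c : ℕ) (r : R) : ℕ :=
  N.countP fun x => x.1 = c ∧ r ∈ x.2

/-- Every role of a channel in use is played by exactly one endpoint. -/
def Part (N : Multiset (ℕ × Set R)) : Prop := ∀ c, numC N c ≠ 0 → ∀ r, numR N c r = 1

theorem numC_add (M N : Multiset (ℕ × Set R)) (c : ℕ) : numC (M + N) c = numC M c + numC N c :=
  Multiset.countP_add ..

theorem numR_add (M N : Multiset (ℕ × Set R)) (c : ℕ) (r : R) :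
    numR (M + N) c r = numR M c r + numR N c r := by
  classical exact Multiset.countP_add _ _ _

theorem numC_singleton (x : ℕ × Set R) (c : ℕ) : numC {x} c = if x.1 = c then 1 else 0 := by
  rw [numC, ← Multiset.replicate_one, countP_replicate]

open Classical in
theorem numR_singleton (x : ℕ × Set R) (c : ℕ) (r : R) :
    numR {x} c r = if x.1 = c ∧ r ∈ x.2 then 1 else 0 := by
  rw [numR, ← Multiset.replicate_one, countP_replicate]

theorem numC_eq_zero {N : Multiset (ℕ × Set R)} {c : ℕ} : numC N c = 0 ↔ ∀ x ∈ N, x.1 ≠ c :=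
  Multiset.countP_eq_zero

theorem numR_le_numC (N : Multiset (ℕ × Set R)) (c : ℕ) (r : R) : numR N c r ≤ numC N c := by
  classical
  rw [numC, numR, Multiset.countP_eq_card_filter, Multiset.countP_eq_card_filter]
  exact Multiset.card_le_card (Multiset.monotone_filter_right _ fun x h => h.1)

/-! ### Partitions of the roles under the steps of a pool -/

theorem Part.fork {N : Multiset (ℕ × Set R)} (h : Part N) {c : ℕ} {A B : Set R}
    (hc : numC N c = 0) (hd : B ∩ A = ∅) (hu : B ∪ A = Set.univ) :
    Part (N + {(c, A)} + {(c, B)}) := by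
  intro b hb r
  have hb' := h b
  simp only [numC_add, numC_singleton, numR_add, numR_singleton] at hb ⊢
  by_cases hcb : c = b
  · subst hcb
    have h₀ : numR N c r = 0 := Nat.le_zero.1 (hc ▸ numR_le_numC N c r)
    have h₁ : r ∈ B ∨ r ∈ A := (Set.mem_union ..).1 (hu ▸ Set.mem_univ r)
    have h₂ : ¬ (r ∈ B ∧ r ∈ A) := fun h => (hd ▸ (Set.mem_inter_iff ..).2 h : r ∈ (∅ : Set R))
    clear hd hu
    by_cases hA : r ∈ A <;> by_cases hB : r ∈ B <;> simp_all
  · simp only [hcb, if_false, false_and] at hb ⊢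
    exact hb' hb r

theorem Part.split {N : Multiset (ℕ × Set R)} {c : ℕ} {A B : Set R}
    (h : Part (N + {(c, B ∪ A)})) (hd : B ∩ A = ∅) : Part (N + {(c, A)} + {(c, B)}) := by
  intro b hb r
  have hb' := h b
  simp only [numC_add, numC_singleton, numR_add, numR_singleton] at hb hb' ⊢
  have h₂ : ¬ (r ∈ B ∧ r ∈ A) := fun h => (hd ▸ (Set.mem_inter_iff ..).2 h : r ∈ (∅ : Set R))
  clear hd
  by_cases hcb : c = b
  · subst hcb
    have h₃ := hb' (by simp) r
    by_cases hA : r ∈ A <;> by_cases hB : r ∈ B <;> simp_all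
  · simp only [hcb, if_false, false_and] at hb hb' ⊢
    exact hb' hb r

/-- An endpoint with the empty role set plays no role; if it was the last one of its channel,
nothing remains to be shown. -/
theorem Part.elim {N : Multiset (ℕ × Set R)} {c : ℕ} (h : Part (N + {(c, ∅)})) : Part N := by
  intro b hb r
  have := h b (by rw [numC_add]; omega) r
  rw [numR_add, numR_singleton] at this
  simpa using this

theorem Part.filter {N : Multiset (ℕ × Set R)} (h : Part N) (c : ℕ) :
    Part (N.filter fun x => x.1 ≠ c) := by
  classical
  intro b hb r
  by_cases hbc : b = c
  · refine absurd (numC_eq_zero.2 fun x hx => ?_) hb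
    rw [hbc]; exact (Multiset.mem_filter.1 hx).2
  · have h₁ : numC (N.filter fun x => x.1 ≠ c) b = numC N b := by
      rw [numC, Multiset.countP_filter]
      refine Multiset.countP_congr rfl fun x _ => ?_
      simp only [ne_eq, and_iff_left_iff_imp, eq_iff_iff]
      rintro rfl; exact hbc
    have h₂ : numR (N.filter fun x => x.1 ≠ c) b r = numR N b r := by
      rw [numR, Multiset.countP_filter]
      refine Multiset.countP_congr rfl fun x _ => ?_
      simp only [ne_eq, and_iff_left_iff_imp, eq_iff_iff]
      rintro ⟨rfl, _⟩; exact hbc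
    rw [h₂]
    exact h b (h₁ ▸ hb) r

theorem numC_mergeC {c₁ c₂ c : ℕ} (h : c₁ ≠ c₂) (h₁ : c ≠ c₁) (h₂ : c ≠ c₂)
    (N : Multiset (ℕ × Set R)) (b : ℕ) :
    numC (N.map fun x => (mergeC c₁ c₂ c x.1, x.2)) b =
      if b = c then numC N c + numC N c₁ + numC N c₂ else
        if b = c₁ ∨ b = c₂ then 0 else numC N b := by
  induction N using Multiset.induction_on with
  | empty => simp [numC]
  | cons a N ih =>
    simp only [numC, mergeC] at ih ⊢
    simp only [Multiset.map_cons, Multiset.countP_cons, ih]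
    split_ifs <;> omega

theorem numR_mergeC {c₁ c₂ c : ℕ} (h : c₁ ≠ c₂) (h₁ : c ≠ c₁) (h₂ : c ≠ c₂)
    (N : Multiset (ℕ × Set R)) (b : ℕ) (r : R) :
    numR (N.map fun x => (mergeC c₁ c₂ c x.1, x.2)) b r =
      if b = c then numR N c r + numR N c₁ r + numR N c₂ r else
        if b = c₁ ∨ b = c₂ then 0 else numR N b r := by
  induction N using Multiset.induction_on with
  | empty => simp [numR]
  | cons a N ih =>
    simp only [numR, mergeC] at ih ⊢
    simp only [Multiset.map_cons, Multiset.countP_cons, ih]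
    by_cases hr : r ∈ a.2
    · simp only [hr, and_true]
      split_ifs <;> omega
    · simp only [hr, and_false, if_false, add_zero]

/-- A role in both `A` and `B` is played by the new endpoint and by no other. A role in only one of
them, say `A`, is played on the side of `c₂` by exactly one other endpoint. The covering condition
excludes roles in neither, which would be played twice. -/
theorem Part.cut {N : Multiset (ℕ × Set R)} {c₁ c₂ c : ℕ} {A B : Set R} (hne : c₁ ≠ c₂)
    (hc₁ : c ≠ c₁) (hc₂ : c ≠ c₂) (h : Part (N + {(c₁, A)} + {(c₂, B)})) (hc : numC N c = 0)
    (hu : A ∪ B = Set.univ) :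
    Part ((N.map fun x => (mergeC c₁ c₂ c x.1, x.2)) + {(c, A ∩ B)}) := by
  intro b hb r
  have h₀ : numR N c r = 0 := Nat.le_zero.1 (hc ▸ numR_le_numC N c r)
  have k₁ := h c₁ (by simp [numC_add, numC_singleton]) r
  have k₂ := h c₂ (by simp [numC_add, numC_singleton]) r
  have k₃ := fun h' => h b h' r
  have hr : r ∈ A ∨ r ∈ B := (Set.mem_union ..).1 (hu ▸ Set.mem_univ r)
  simp only [numR_add, numR_singleton, true_and, hne, hne.symm, false_and,
    if_false] at k₁ k₂
  simp only [numC_add, numR_add, numC_singleton, numR_singleton, numC_mergeC hne hc₁ hc₂,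
    numR_mergeC hne hc₁ hc₂] at hb k₃ ⊢
  by_cases hb' : b = c
  · subst hb'
    simp only [eq_self, if_true, true_and, Set.mem_inter_iff]
    by_cases hA : r ∈ A <;> by_cases hB : r ∈ B <;>
      simp [hA, hB] at k₁ k₂ hr ⊢ <;> omega
  · by_cases hb₁ : b = c₁ ∨ b = c₂
    · simp [hb', Ne.symm hb', hb₁] at hb
    · have hb₂ := hb₁
      push Not at hb₂
      simp only [hb', Ne.symm hb', hb₁, Ne.symm hb₂.1, Ne.symm hb₂.2, if_false,
        false_and, add_zero] at hb k₃ ⊢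
      exact k₃ hb

/-! ## Typing of partial redexes -/

/-- The empty typing context. -/
abbrev TCtx.nil : TCtx R [] 0 := Fin.elim0

theorem entails_mem {r : STm R [] .role} {rs : STm R [] .set} {A : Set R}
    (h : Entails [] (.mem r rs)) (hA : SEq [] (.setLit A) rs) : r.val ∈ A := by
  rw [show A = (STm.setLit A : STm R [] .set).val from rfl, hA.val_eq]
  exact entails_nil.1 h

theorem entails_notMem {r : STm R [] .role} {rs : STm R [] .set} {A : Set R}
    (h : Entails [] (.notMem r rs)) (hA : SEq [] (.setLit A) rs) : r.val ∉ A := by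
  rw [show A = (STm.setLit A : STm R [] .set).val from rfl, hA.val_eq]
  exact entails_nil.1 h

theorem Ty.inv_ep_chan {S : Sig R} {c : ℕ} {A : Set R} {rs : STm R [] .set}
    {π : STm R [] .stype} (h : Ty S [] TCtx.nil (.ep c A) (.chan rs π)) :
    ∃ π₀, S c = some π₀ ∧ SEq [] (.setLit A) rs ∧ SEq [] π₀ π := by
  obtain ⟨π₀, hc, heq⟩ := h.inv_ep
  rw [STm.wkc_nil] at heq
  exact ⟨π₀, hc, heq.chan_inj⟩

theorem Ty.ep_chan {S : Sig R} {c : ℕ} {A : Set R} {rs : STm R [] .set} {π π₀ : STm R [] .stype}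
    (hc : S c = some π₀) (hA : rs.val = A) (hπ : SEq [] π₀ π) :
    Ty S [] TCtx.nil (.ep c A) (.chan rs π) := by
  refine .conv (.ep hc) (.chan (.data trivial fun v _ => ?_) (by rwa [STm.wkc_nil]))
  rw [STm.eval_nil, STm.eval_nil, hA]
  rfl

/-- Typing of the partial redex of an action on an endpoint with roles `A` and session type `π`. -/
def Act.HasTy (S : Sig R) (A : Set R) (π : STm R [] .stype) (u : STm R [] (.ty true)) :
    Act R → Prop
  | .bsend v => ∃ r t π', r.val ∈ A ∧ SEq [] π (.bmsg r t π') ∧ Ty S [] TCtx.nil v (.emb t) ∧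
      SEq [] (.chan (.setLit A) π') u
  | .brecv => ∃ r t π', r.val ∉ A ∧ SEq [] π (.bmsg r t π') ∧
      SEq [] (.pair (.chan (.setLit A) π') (.emb t)) u
  | .send v => ∃ r q t π', (r.val ∈ A ∧ q.val ∉ A) ∧ SEq [] π (.msg r q t π') ∧
      Ty S [] TCtx.nil v t ∧ SEq [] (.chan (.setLit A) π') u
  | .recv => ∃ r q t π', (r.val ∉ A ∧ q.val ∈ A) ∧ SEq [] π (.msg r q t π') ∧
      SEq [] (.pair (.chan (.setLit A) π') t) u
  | .skip => ∃ r q t π', (r.val ∈ A ↔ q.val ∈ A) ∧ SEq [] π (.msg r q t π') ∧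
      SEq [] (.chan (.setLit A) π') u
  | .close => ∃ r, r.val ∈ A ∧ SEq [] π (.fin r) ∧ SEq [] unitT u
  | .wait => ∃ r, r.val ∉ A ∧ SEq [] π (.fin r) ∧ SEq [] unitT u
  | .unify a => ∃ r, ∃ f : STm R [] (.arr a .stype), r.val ∈ A ∧ SEq [] π (.quan r f) ∧
      SEq [] (.all (.chan (.setLit A) (.app (f.wk a) (.var .z)))) u
  | .exify a => ∃ r, ∃ f : STm R [] (.arr a .stype), r.val ∉ A ∧ SEq [] π (.quan r f) ∧
      SEq [] (.ex (.chan (.setLit A) (.app (f.wk a) (.var .z)))) u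

/-- The side conditions of the typing rules speak of a static term for the role set; they are
transferred to the actual role set `A` of the endpoint, and the type of its channel is exposed. -/
theorem Ty.inv_redex {S : Sig R} {c : ℕ} {A : Set R} {a : Act R} {u : STm R [] (.ty true)}
    (h : Ty S [] TCtx.nil (a.redex c A) u) : ∃ π, S c = some π ∧ a.HasTy S A π u := by
  cases a with
  | bsend v =>
    obtain ⟨t₁, t₂, u', ho, h₁, h₂, heq⟩ := Ty.inv_bin h
    cases ho with
    | bsend hm =>
      obtain ⟨π, hc, hA, hπ⟩ := h₁.inv_ep_chan
      exact ⟨π, hc, _, _, _, entails_mem hm hA, hπ, h₂, (SEq.chan hA (.refl _)).trans heq⟩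
  | brecv =>
    obtain ⟨t₁, u', ho, h₁, heq⟩ := Ty.inv_un h
    cases ho with
    | brecv hm =>
      obtain ⟨π, hc, hA, hπ⟩ := h₁.inv_ep_chan
      exact ⟨π, hc, _, _, _, entails_notMem hm hA, hπ,
        (SEq.pair (.chan hA (.refl _)) (.refl _)).trans heq⟩
  | send v =>
    obtain ⟨t₁, t₂, u', ho, h₁, h₂, heq⟩ := Ty.inv_bin h
    cases ho with
    | send hm =>
      obtain ⟨π, hc, hA, hπ⟩ := h₁.inv_ep_chan
      have hm := entails_nil.1 hm
      exact ⟨π, hc, _, _, _, _, ⟨entails_mem (entails_nil.2 hm.1) hA,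
        entails_notMem (entails_nil.2 hm.2) hA⟩, hπ, h₂, (SEq.chan hA (.refl _)).trans heq⟩
  | recv =>
    obtain ⟨t₁, u', ho, h₁, heq⟩ := Ty.inv_un h
    cases ho with
    | recv hm =>
      obtain ⟨π, hc, hA, hπ⟩ := h₁.inv_ep_chan
      have hm := entails_nil.1 hm
      exact ⟨π, hc, _, _, _, _, ⟨entails_notMem (entails_nil.2 hm.1) hA,
        entails_mem (entails_nil.2 hm.2) hA⟩, hπ,
        (SEq.pair (.chan hA (.refl _)) (.refl _)).trans heq⟩
  | skip =>
    obtain ⟨t₁, u', ho, h₁, heq⟩ := Ty.inv_un h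
    cases ho with
    | skip hm =>
      obtain ⟨π, hc, hA, hπ⟩ := h₁.inv_ep_chan
      refine ⟨π, hc, _, _, _, _, ?_, hπ, (SEq.chan hA (.refl _)).trans heq⟩
      rcases entails_nil.1 hm with hm | hm
      · exact iff_of_true (entails_mem (entails_nil.2 hm.1) hA)
          (entails_mem (entails_nil.2 hm.2) hA)
      · exact iff_of_false (entails_notMem (entails_nil.2 hm.1) hA)
          (entails_notMem (entails_nil.2 hm.2) hA)
  | close =>
    obtain ⟨t₁, u', ho, h₁, heq⟩ := Ty.inv_un h
    cases ho with
    | close hm =>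
      obtain ⟨π, hc, hA, hπ⟩ := h₁.inv_ep_chan
      exact ⟨π, hc, _, entails_mem hm hA, hπ, heq⟩
  | wait =>
    obtain ⟨t₁, u', ho, h₁, heq⟩ := Ty.inv_un h
    cases ho with
    | wait hm =>
      obtain ⟨π, hc, hA, hπ⟩ := h₁.inv_ep_chan
      exact ⟨π, hc, _, entails_notMem hm hA, hπ, heq⟩
  | unify a =>
    obtain ⟨t₁, u', ho, h₁, heq⟩ := Ty.inv_un h
    cases ho with
    | unify hm =>
      obtain ⟨π, hc, hA, hπ⟩ := h₁.inv_ep_chan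
      exact ⟨π, hc, _, _, entails_mem hm hA, hπ,
        (SEq.all (.chan (hA.wk a) (.refl _))).trans heq⟩
  | exify a =>
    obtain ⟨t₁, u', ho, h₁, heq⟩ := Ty.inv_un h
    cases ho with
    | exify hm =>
      obtain ⟨π, hc, hA, hπ⟩ := h₁.inv_ep_chan
      exact ⟨π, hc, _, _, entails_notMem hm hA, hπ,
        (SEq.ex (.chan (hA.wk a) (.refl _))).trans heq⟩

/-! ### The session type and the role set determine the action -/

theorem SEq.bmsg_inj {r r' : STm R [] .role} {t t' : STm R [] (.ty false)}
    {π π' : STm R [] .stype} (h : SEq [] (.bmsg r t π) (.bmsg r' t' π')) :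
    r.val = r'.val ∧ SEq [] t t' ∧ SEq [] π π' := by
  cases h.head_stype (.bmsg (.refl _) (.refl _) (.refl _)) (.bmsg (.refl _) (.refl _) (.refl _)) with
  | bmsg h₁ h₂ h₃ => exact ⟨h₁.val_eq, h₂, h₃⟩

theorem SEq.msg_inj {r r' q q' : STm R [] .role} {t t' : STm R [] (.ty true)}
    {π π' : STm R [] .stype} (h : SEq [] (.msg r q t π) (.msg r' q' t' π')) :
    r.val = r'.val ∧ q.val = q'.val ∧ SEq [] t t' ∧ SEq [] π π' := by
  cases h.head_stype (.msg (.refl _) (.refl _) (.refl _) (.refl _))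
    (.msg (.refl _) (.refl _) (.refl _) (.refl _)) with
  | msg h₁ h₂ h₃ h₄ => exact ⟨h₁.val_eq, h₂.val_eq, h₃, h₄⟩

theorem SEq.quan_inj {a : Srt} {r r' : STm R [] .role} {f f' : STm R [] (.arr a .stype)}
    (h : SEq [] (.quan r f) (.quan r' f')) : r.val = r'.val ∧ SEq [] f f' := by
  cases h.head_stype (.quan (.refl _) (.refl _)) (.quan (.refl _) (.refl _)) with
  | quan h₁ h₂ => exact ⟨h₁.val_eq, h₂⟩

/-- On a broadcast, the action is determined by whether the endpoint plays the sender. -/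
theorem Act.HasTy.of_bmsg {S : Sig R} {A : Set R} {π : STm R [] .stype}
    {u : STm R [] (.ty true)} {a : Act R} (h : a.HasTy S A π u) {r : STm R [] .role}
    {t : STm R [] (.ty false)} {π' : STm R [] .stype} (hπ : SEq [] π (.bmsg r t π')) :
    (r.val ∈ A ∧ ∃ v, a = .bsend v) ∨ (r.val ∉ A ∧ a = .brecv) := by
  have hh := HeadEq.bmsg (SEq.refl r) (SEq.refl t) (SEq.refl π')
  cases a with
  | bsend v =>
    obtain ⟨r', t', π'', hr, h, -⟩ := h
    rw [← (hπ.symm.trans h).bmsg_inj.1] at hr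
    exact .inl ⟨hr, v, rfl⟩
  | brecv =>
    obtain ⟨r', t', π'', hr, h, -⟩ := h
    rw [← (hπ.symm.trans h).bmsg_inj.1] at hr
    exact .inr ⟨hr, rfl⟩
  | send v =>
    obtain ⟨r', q, t', π'', hr, h, -⟩ := h
    cases (hπ.symm.trans h).head_stype hh (.msg (.refl _) (.refl _) (.refl _) (.refl _))
  | recv =>
    obtain ⟨r', q, t', π'', hr, h, -⟩ := h
    cases (hπ.symm.trans h).head_stype hh (.msg (.refl _) (.refl _) (.refl _) (.refl _))
  | skip =>
    obtain ⟨r', q, t', π'', hr, h, -⟩ := h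
    cases (hπ.symm.trans h).head_stype hh (.msg (.refl _) (.refl _) (.refl _) (.refl _))
  | close =>
    obtain ⟨r', hr, h, -⟩ := h
    cases (hπ.symm.trans h).head_stype hh (.fin (.refl _))
  | wait =>
    obtain ⟨r', hr, h, -⟩ := h
    cases (hπ.symm.trans h).head_stype hh (.fin (.refl _))
  | unify b =>
    obtain ⟨r', f, hr, h, -⟩ := h
    cases (hπ.symm.trans h).head_stype hh (.quan (.refl _) (.refl _))
  | exify b =>
    obtain ⟨r', f, hr, h, -⟩ := h
    cases (hπ.symm.trans h).head_stype hh (.quan (.refl _) (.refl _))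

/-- On a message, the action is determined by which of sender and receiver the endpoint plays. -/
theorem Act.HasTy.of_msg {S : Sig R} {A : Set R} {π : STm R [] .stype}
    {u : STm R [] (.ty true)} {a : Act R} (h : a.HasTy S A π u) {r q : STm R [] .role}
    {t : STm R [] (.ty true)} {π' : STm R [] .stype} (hπ : SEq [] π (.msg r q t π')) :
    ((r.val ∈ A ∧ q.val ∉ A) ∧ ∃ v, a = .send v) ∨ ((r.val ∉ A ∧ q.val ∈ A) ∧ a = .recv) ∨
      ((r.val ∈ A ↔ q.val ∈ A) ∧ a = .skip) := by
  have hh := HeadEq.msg (SEq.refl r) (SEq.refl q) (SEq.refl t) (SEq.refl π')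
  cases a with
  | bsend v =>
    obtain ⟨r', t', π'', hr, h, -⟩ := h
    cases (hπ.symm.trans h).head_stype hh (.bmsg (.refl _) (.refl _) (.refl _))
  | brecv =>
    obtain ⟨r', t', π'', hr, h, -⟩ := h
    cases (hπ.symm.trans h).head_stype hh (.bmsg (.refl _) (.refl _) (.refl _))
  | send v =>
    obtain ⟨r', q', t', π'', hr, h, -⟩ := h
    rw [← (hπ.symm.trans h).msg_inj.1, ← (hπ.symm.trans h).msg_inj.2.1] at hr
    exact .inl ⟨hr, v, rfl⟩
  | recv =>
    obtain ⟨r', q', t', π'', hr, h, -⟩ := h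
    rw [← (hπ.symm.trans h).msg_inj.1, ← (hπ.symm.trans h).msg_inj.2.1] at hr
    exact .inr (.inl ⟨hr, rfl⟩)
  | skip =>
    obtain ⟨r', q', t', π'', hr, h, -⟩ := h
    rw [← (hπ.symm.trans h).msg_inj.1, ← (hπ.symm.trans h).msg_inj.2.1] at hr
    exact .inr (.inr ⟨hr, rfl⟩)
  | close =>
    obtain ⟨r', hr, h, -⟩ := h
    cases (hπ.symm.trans h).head_stype hh (.fin (.refl _))
  | wait =>
    obtain ⟨r', hr, h, -⟩ := h
    cases (hπ.symm.trans h).head_stype hh (.fin (.refl _))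
  | unify b =>
    obtain ⟨r', f, hr, h, -⟩ := h
    cases (hπ.symm.trans h).head_stype hh (.quan (.refl _) (.refl _))
  | exify b =>
    obtain ⟨r', f, hr, h, -⟩ := h
    cases (hπ.symm.trans h).head_stype hh (.quan (.refl _) (.refl _))

/-- At the end, the action is determined by whether the endpoint plays the closing role. -/
theorem Act.HasTy.of_fin {S : Sig R} {A : Set R} {π : STm R [] .stype}
    {u : STm R [] (.ty true)} {a : Act R} (h : a.HasTy S A π u) {r : STm R [] .role}
    (hπ : SEq [] π (.fin r)) : (r.val ∈ A ∧ a = .close) ∨ (r.val ∉ A ∧ a = .wait) := by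
  have hh := HeadEq.fin (SEq.refl r)
  have inj : ∀ {r' : STm R [] .role}, SEq [] (.fin r) (.fin r') → r.val = r'.val := by
    intro r' h
    cases h.head_stype (.fin (.refl _)) (.fin (.refl _)) with
    | fin h => exact h.val_eq
  cases a with
  | bsend v =>
    obtain ⟨r', t', π'', hr, h, -⟩ := h
    cases (hπ.symm.trans h).head_stype hh (.bmsg (.refl _) (.refl _) (.refl _))
  | brecv =>
    obtain ⟨r', t', π'', hr, h, -⟩ := h
    cases (hπ.symm.trans h).head_stype hh (.bmsg (.refl _) (.refl _) (.refl _))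
  | send v =>
    obtain ⟨r', q, t', π'', hr, h, -⟩ := h
    cases (hπ.symm.trans h).head_stype hh (.msg (.refl _) (.refl _) (.refl _) (.refl _))
  | recv =>
    obtain ⟨r', q, t', π'', hr, h, -⟩ := h
    cases (hπ.symm.trans h).head_stype hh (.msg (.refl _) (.refl _) (.refl _) (.refl _))
  | skip =>
    obtain ⟨r', q, t', π'', hr, h, -⟩ := h
    cases (hπ.symm.trans h).head_stype hh (.msg (.refl _) (.refl _) (.refl _) (.refl _))
  | close =>
    obtain ⟨r', hr, h, -⟩ := h
    rw [← inj (hπ.symm.trans h)] at hr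
    exact .inl ⟨hr, rfl⟩
  | wait =>
    obtain ⟨r', hr, h, -⟩ := h
    rw [← inj (hπ.symm.trans h)] at hr
    exact .inr ⟨hr, rfl⟩
  | unify b =>
    obtain ⟨r', f, hr, h, -⟩ := h
    cases (hπ.symm.trans h).head_stype hh (.quan (.refl _) (.refl _))
  | exify b =>
    obtain ⟨r', f, hr, h, -⟩ := h
    cases (hπ.symm.trans h).head_stype hh (.quan (.refl _) (.refl _))

/-- On a quantifier, the action is determined by whether the endpoint plays the given role. -/
theorem Act.HasTy.of_quan {S : Sig R} {A : Set R} {π : STm R [] .stype}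
    {u : STm R [] (.ty true)} {a : Act R} (h : a.HasTy S A π u) {b : Srt} {r : STm R [] .role}
    {f : STm R [] (.arr b .stype)} (hπ : SEq [] π (.quan r f)) :
    (r.val ∈ A ∧ a = .unify b) ∨ (r.val ∉ A ∧ a = .exify b) := by
  have hh := HeadEq.quan (SEq.refl r) (SEq.refl f)
  have inj : ∀ {b' : Srt} {r' : STm R [] .role} {f' : STm R [] (.arr b' .stype)},
      SEq [] (.quan r f) (.quan r' f') → r.val = r'.val ∧ b' = b := by
    intro b' r' f' h
    cases h.head_stype (.quan (.refl _) (.refl _)) (.quan (.refl _) (.refl _)) with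
    | quan h₁ h₂ => exact ⟨h₁.val_eq, rfl⟩
  cases a with
  | bsend v =>
    obtain ⟨r', t', π'', hr, h, -⟩ := h
    cases (hπ.symm.trans h).head_stype hh (.bmsg (.refl _) (.refl _) (.refl _))
  | brecv =>
    obtain ⟨r', t', π'', hr, h, -⟩ := h
    cases (hπ.symm.trans h).head_stype hh (.bmsg (.refl _) (.refl _) (.refl _))
  | send v =>
    obtain ⟨r', q, t', π'', hr, h, -⟩ := h
    cases (hπ.symm.trans h).head_stype hh (.msg (.refl _) (.refl _) (.refl _) (.refl _))
  | recv =>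
    obtain ⟨r', q, t', π'', hr, h, -⟩ := h
    cases (hπ.symm.trans h).head_stype hh (.msg (.refl _) (.refl _) (.refl _) (.refl _))
  | skip =>
    obtain ⟨r', q, t', π'', hr, h, -⟩ := h
    cases (hπ.symm.trans h).head_stype hh (.msg (.refl _) (.refl _) (.refl _) (.refl _))
  | close =>
    obtain ⟨r', hr, h, -⟩ := h
    cases (hπ.symm.trans h).head_stype hh (.fin (.refl _))
  | wait =>
    obtain ⟨r', hr, h, -⟩ := h
    cases (hπ.symm.trans h).head_stype hh (.fin (.refl _))
  | unify b =>
    obtain ⟨r', f, hr, h, -⟩ := h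
    obtain ⟨e, rfl⟩ := inj (hπ.symm.trans h)
    rw [← e] at hr
    exact .inl ⟨hr, rfl⟩
  | exify b =>
    obtain ⟨r', f, hr, h, -⟩ := h
    obtain ⟨e, rfl⟩ := inj (hπ.symm.trans h)
    rw [← e] at hr
    exact .inr ⟨hr, rfl⟩

/-- If the role sets of the threads partition the set of all roles, then the typed actions of the
threads match. -/
theorem matching_of_hasTy {S : Sig R} {π : STm R [] .stype} {T : Finset ℕ} {A : ℕ → Set R}
    {a : ℕ → Act R} (hT : T.Nonempty) (hp : ∀ r : R, ∃! t, t ∈ T ∧ r ∈ A t)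
    (h : ∀ t ∈ T, ∃ u, (a t).HasTy S (A t) π u) : Matching T a := by
  have bcast : ∀ {r t π'}, SEq [] π (.bmsg r t π') → Matching T a := by
    intro r _ _ hπ
    obtain ⟨t₁, ⟨ht, hr⟩, huniq⟩ := hp r.val
    have key : ∀ t ∈ T, _ := fun t ht => (h t ht).elim fun u hu => hu.of_bmsg hπ
    obtain ⟨_, v, hv⟩ := (key t₁ ht).resolve_right fun h => h.1 hr
    exact .inl ⟨t₁, v, ht, hv, fun t ht hne =>
      ((key t ht).resolve_left fun h => hne (huniq t ⟨ht, h.1⟩)).2⟩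
  have msg : ∀ {r q t π'}, SEq [] π (.msg r q t π') → Matching T a := by
    intro r q _ _ hπ
    obtain ⟨t₁, ⟨ht₁, hr₁⟩, huniq₁⟩ := hp r.val
    obtain ⟨t₂, ⟨ht₂, hr₂⟩, huniq₂⟩ := hp q.val
    have key : ∀ t ∈ T, _ := fun t ht => (h t ht).elim fun u hu => hu.of_msg hπ
    -- If one block contains both sender and receiver, no other block contains either of them, and
    -- every endpoint skips.
    by_cases htt : t₁ = t₂
    · subst htt
      refine .inr (.inr (.inl fun t ht => ?_))
      rcases key t ht with ⟨⟨k₁, k₂⟩, _⟩ | ⟨⟨k₁, k₂⟩, _⟩ | ⟨_, k⟩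
      · obtain rfl := huniq₁ t ⟨ht, k₁⟩; exact absurd hr₂ k₂
      · obtain rfl := huniq₂ t ⟨ht, k₂⟩; exact absurd hr₁ k₁
      · exact k
    · have h₁ : q.val ∉ A t₁ := fun hq => htt (huniq₂ t₁ ⟨ht₁, hq⟩)
      have h₂ : r.val ∉ A t₂ := fun hr => htt (huniq₁ t₂ ⟨ht₂, hr⟩).symm
      have k₁ : ∃ v, a t₁ = .send v := by
        rcases key t₁ ht₁ with ⟨_, k⟩ | ⟨⟨k, _⟩, _⟩ | ⟨k, _⟩
        · exact k
        · exact absurd hr₁ k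
        · exact absurd (k.1 hr₁) h₁
      have k₂ : a t₂ = .recv := by
        rcases key t₂ ht₂ with ⟨⟨k, _⟩, _⟩ | ⟨_, k⟩ | ⟨k, _⟩
        · exact absurd k h₂
        · exact k
        · exact absurd (k.2 hr₂) h₂
      obtain ⟨v, hv⟩ := k₁
      refine .inr (.inl ⟨t₁, t₂, v, ht₁, ht₂, htt, hv, k₂, fun t ht hne₁ hne₂ => ?_⟩)
      rcases key t ht with ⟨⟨k, _⟩, _⟩ | ⟨⟨_, k⟩, _⟩ | ⟨_, k⟩
      · exact absurd (huniq₁ t ⟨ht, k⟩) hne₁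
      · exact absurd (huniq₂ t ⟨ht, k⟩) hne₂
      · exact k
  have fin : ∀ {r}, SEq [] π (.fin r) → Matching T a := by
    intro r hπ
    obtain ⟨t₁, ⟨ht, hr⟩, huniq⟩ := hp r.val
    have key : ∀ t ∈ T, _ := fun t ht => (h t ht).elim fun u hu => hu.of_fin hπ
    exact .inr (.inr (.inr (.inl ⟨t₁, ht, ((key t₁ ht).resolve_right fun h => h.1 hr).2,
      fun t ht hne => ((key t ht).resolve_left fun h => hne (huniq t ⟨ht, h.1⟩)).2⟩)))
  have quan : ∀ {b : Srt} {r} {f : STm R [] (.arr b .stype)}, SEq [] π (.quan r f) →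
      Matching T a := by
    intro b r _ hπ
    obtain ⟨t₁, ⟨ht, hr⟩, huniq⟩ := hp r.val
    have key : ∀ t ∈ T, _ := fun t ht => (h t ht).elim fun u hu => hu.of_quan hπ
    exact .inr (.inr (.inr (.inr ⟨t₁, b, ht, ((key t₁ ht).resolve_right fun h => h.1 hr).2,
      fun t ht hne => ((key t ht).resolve_left fun h => hne (huniq t ⟨ht, h.1⟩)).2⟩)))
  -- Any single action reveals the head of the common session type `π`.
  obtain ⟨t₀, ht₀⟩ := hT
  obtain ⟨u, hu⟩ := h t₀ ht₀
  generalize a t₀ = a₀ at hu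
  cases a₀ with
  | bsend v => obtain ⟨_, _, _, _, hπ, _⟩ := hu; exact bcast hπ
  | brecv => obtain ⟨_, _, _, _, hπ, _⟩ := hu; exact bcast hπ
  | send v => obtain ⟨_, _, _, _, _, hπ, _⟩ := hu; exact msg hπ
  | recv => obtain ⟨_, _, _, _, _, hπ, _⟩ := hu; exact msg hπ
  | skip => obtain ⟨_, _, _, _, _, hπ, _⟩ := hu; exact msg hπ
  | close => obtain ⟨_, _, hπ, _⟩ := hu; exact fin hπ
  | wait => obtain ⟨_, _, hπ, _⟩ := hu; exact fin hπ
  | unify b => obtain ⟨_, _, _, hπ, _⟩ := hu; exact quan hπ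
  | exify b => obtain ⟨_, _, _, hπ, _⟩ := hu; exact quan hπ

/-! ## The graph of a pool -/

/-- The graph of a pool: a thread is joined to a channel by every endpoint that it holds. -/
def Pool.edges (Q : Pool R) : Multiset (Edge R) := ∑ t ∈ Q.dom, (Q.thr t).rho.map (Prod.mk t)

/-- The endpoints held by threads other than `t`. -/
def Pool.rest (Q : Pool R) (t : ℕ) : Multiset (Edge R) :=
  ∑ s ∈ Q.dom.erase t, (Q.thr s).rho.map (Prod.mk s)

theorem map_snd_map_mk (N : Multiset (ℕ × Set R)) (t : ℕ) :
    (N.map (Prod.mk t)).map Prod.snd = N := by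
  rw [Multiset.map_map]
  exact Multiset.map_id N

theorem Pool.map_snd_edges (Q : Pool R) : Q.edges.map Prod.snd = Q.rho := by
  rw [Pool.edges, ← Multiset.coe_mapAddMonoidHom, map_sum]
  exact Finset.sum_congr rfl fun t _ => map_snd_map_mk _ _

theorem Pool.mem_edges {Q : Pool R} {x : Edge R} :
    x ∈ Q.edges ↔ x.1 ∈ Q.dom ∧ x.2 ∈ (Q.thr x.1).rho := by
  rw [Pool.edges, Multiset.mem_sum]
  constructor
  · rintro ⟨t, ht, hx⟩
    obtain ⟨y, hy, rfl⟩ := Multiset.mem_map.1 hx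
    exact ⟨ht, hy⟩
  · rintro ⟨ht, hx⟩
    exact ⟨x.1, ht, Multiset.mem_map.2 ⟨x.2, hx, rfl⟩⟩

theorem Pool.mem_rest {Q : Pool R} {t : ℕ} {x : Edge R} :
    x ∈ Q.rest t ↔ (x.1 ≠ t ∧ x.1 ∈ Q.dom) ∧ x.2 ∈ (Q.thr x.1).rho := by
  rw [Pool.rest, Multiset.mem_sum]
  constructor
  · rintro ⟨s, hs, hx⟩
    obtain ⟨y, hy, rfl⟩ := Multiset.mem_map.1 hx
    exact ⟨Finset.mem_erase.1 hs, hy⟩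
  · rintro ⟨ht, hx⟩
    exact ⟨x.1, Finset.mem_erase.2 ht, Multiset.mem_map.2 ⟨x.2, hx, rfl⟩⟩

theorem Pool.edges_eq {Q : Pool R} {t : ℕ} (ht : t ∈ Q.dom) :
    Q.edges = Q.rest t + (Q.thr t).rho.map (Prod.mk t) := (Finset.sum_erase_add _ _ ht).symm

theorem Pool.rest_le (Q : Pool R) (t : ℕ) : Q.rest t ≤ Q.edges :=
  Finset.sum_le_sum_of_subset (Finset.erase_subset _ _)

/-- Valid for a present and for a new thread alike, as `Q.rest t` disregards `t`. -/
theorem Pool.edges_set (Q : Pool R) (t : ℕ) (e : CTm R) :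
    (Q.set t e).edges = Q.rest t + e.rho.map (Prod.mk t) := by
  rw [Pool.edges_eq (t := t) (Finset.mem_insert_self _ _)]
  congr 1
  · simp only [Pool.rest, Pool.set, Finset.erase_insert_eq_erase]
    refine Finset.sum_congr rfl fun s hs => ?_
    rw [Function.update_of_ne (Finset.ne_of_mem_erase hs)]
  · simp only [Pool.set, Function.update_self]

theorem Pool.rest_eq {Q : Pool R} {t : ℕ} (ht : t ∉ Q.dom) : Q.rest t = Q.edges := by
  rw [Pool.rest, Finset.erase_eq_of_notMem ht, Pool.edges]

theorem Pool.edges_set_set {Q : Pool R} {t t' : ℕ} (ht : t ∈ Q.dom) (ht' : t' ∉ Q.dom)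
    (e e' : CTm R) : ((Q.set t e).set t' e').edges =
      Q.rest t + e.rho.map (Prod.mk t) + e'.rho.map (Prod.mk t') := by
  rw [Pool.edges_set, Pool.rest_eq, Pool.edges_set]
  simp only [Pool.set, Finset.mem_insert, not_or]
  exact ⟨fun h => ht' (h ▸ ht), ht'⟩

theorem Pool.edges_chren (Q : Pool R) (f : ℕ → ℕ) :
    (Q.chren f).edges = Q.edges.map fun x => (x.1, f x.2.1, x.2.2) := by
  rw [Pool.edges, Pool.edges, ← Multiset.coe_mapAddMonoidHom, map_sum]
  refine Finset.sum_congr rfl fun t _ => ?_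
  simp only [Pool.chren, Tm.rho_chren, Multiset.coe_mapAddMonoidHom, Multiset.map_map]
  rfl

theorem Pool.Fresh.ne {Q : Pool R} {c : ℕ} (h : Q.Fresh c) {x : Edge R} (hx : x ∈ Q.edges) :
    x.2.1 ≠ c := by
  have hx : x.2 ∈ Q.rho := Q.map_snd_edges ▸ Multiset.mem_map_of_mem _ hx
  exact Multiset.filter_eq_nil.1 h _ hx

theorem map_mergeT_eq_self {t t' : ℕ} {M : Multiset (Edge R)} (h : ∀ x ∈ M, x.1 ≠ t') :
    M.map (mergeT t t') = M := by
  conv_rhs => rw [← Multiset.map_id M]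
  refine Multiset.map_congr rfl fun x hx => ?_
  rw [mergeT, if_neg (h x hx)]
  rfl

theorem map_mergeT_map_mk (t t' : ℕ) (N : Multiset (ℕ × Set R)) :
    (N.map (Prod.mk t')).map (mergeT t t') = N.map (Prod.mk t) := by
  rw [Multiset.map_map]
  refine Multiset.map_congr rfl fun x _ => ?_
  simp [mergeT]

/-- Merging the new thread `t'` back into the thread `t`. -/
theorem Pool.map_mergeT {Q : Pool R} {t t' : ℕ} (ht : t ∈ Q.dom) (ht' : t' ∉ Q.dom)
    (N N' : Multiset (ℕ × Set R)) :
    (Q.rest t + N.map (Prod.mk t) + N'.map (Prod.mk t')).map (mergeT t t') =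
      Q.rest t + (N + N').map (Prod.mk t) := by
  rw [Multiset.map_add, Multiset.map_add, map_mergeT_map_mk, Multiset.map_add, ← add_assoc]
  congr 2
  · exact map_mergeT_eq_self fun x hx h => ht' (h ▸ (Pool.mem_rest.1 hx).1.2)
  · refine map_mergeT_eq_self fun x hx h => ht' ?_
    obtain ⟨y, hy, rfl⟩ := Multiset.mem_map.1 hx
    exact h ▸ ht

/-! ## The invariant -/

/-- The threads of a pool have the given types. -/
def Pool.Ty (S : Sig R) (Q : Pool R) (τ : ℕ → STm R [] (.ty true)) : Prop :=
  ∀ i ∈ Q.dom, MPST.Ty S [] TCtx.nil (Q.thr i) (τ i)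

/-- The invariant of pool reduction: the pool is typed, the role sets of the endpoints of every
channel partition the set of all roles, and the graph of the pool is acyclic. -/
structure Pool.Inv (Q : Pool R) : Prop where
  zero_mem : 0 ∈ Q.dom
  ty : ∃ S τ, (∀ i ≠ 0, τ i = unitT) ∧ Q.Ty S τ
  part : Part (Q.edges.map Prod.snd)
  acyc : Acyc Q.edges

theorem Acyc.zero : Acyc (0 : Multiset (Edge R)) := fun F hF h => by
  have := h.pos
  rw [Multiset.le_zero.1 hF] at this
  simp at this

theorem Part.zero : Part (0 : Multiset (ℕ × Set R)) := fun _ hc => absurd rfl hc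

/-- Without endpoints the graph is empty and no channel is in use, so only the passage to the
counting judgement has content. -/
theorem Pool.WellTyped.inv {Q : Pool R} (h : Q.WellTyped) (h₀ : Q.rho = 0) : Q.Inv := by
  obtain ⟨S, t, h0, ht, hi⟩ := h
  have he : Q.edges = 0 := by rw [← Multiset.map_eq_zero (f := Prod.snd), Q.map_snd_edges, h₀]
  have key : ∀ {e : CTm R} {t}, MPST.HasTy S [] Fin.elim0 e t → MPST.Ty S [] TCtx.nil e t :=
    fun h => (h.ty (H := TCtx.nil) fun i => i.elim0).1
  refine ⟨h0, ⟨S, fun i => if i = 0 then t else unitT, fun i hi => if_neg hi, fun i hid => ?_⟩,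
    by rw [he]; exact Part.zero, by rw [he]; exact Acyc.zero⟩
  by_cases h : i = 0
  · subst h; exact key ht
  · simp only [if_neg h]; exact key (hi i hid h)

/-! ### Preservation of the invariant by steps without synchronisation -/

theorem Pool.Ty.set {S S' : Sig R} {Q : Pool R} {τ : ℕ → STm R [] (.ty true)} (h : Q.Ty S τ)
    {t : ℕ} {e : CTm R} (he : MPST.Ty S' [] TCtx.nil e (τ t))
    (hS : ∀ x ∈ Q.rest t, S' x.2.1 = S x.2.1) : (Q.set t e).Ty S' τ := by
  intro i hi
  by_cases hit : i = t
  · subst hit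
    simpa only [Pool.set, Function.update_self] using he
  · have hi := (Finset.mem_insert.1 hi).resolve_left hit
    simp only [Pool.set, Function.update_of_ne hit]
    exact (h i hi).sig fun x hx => hS (i, x) (Pool.mem_rest.2 ⟨⟨hit, hi⟩, hx⟩)

theorem Part.map_add_singleton {M : Multiset (Edge R)} {x : Edge R} :
    (M + {x}).map Prod.snd = M.map Prod.snd + {x.2} := by
  rw [Multiset.map_add, Multiset.map_singleton]

/-- A replacement that keeps both type and endpoints leaves the graph as it is, so the partition and
acyclicity carry over. -/
theorem Pool.Inv.lift {Q : Pool R} (hQ : Q.Inv) {t : ℕ} {E : ECtx R} {e e' : CTm R}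
    (ht : t ∈ Q.dom) (h : Q.thr t = E.plug e)
    (he : ∀ S u, MPST.Ty S [] TCtx.nil e u → MPST.Ty S [] TCtx.nil e' u ∧ e'.rho = e.rho) :
    (Q.set t (E.plug e')).Inv := by
  obtain ⟨h0, ⟨S, τ, hτ, hS⟩, hp, ha⟩ := hQ
  obtain ⟨u, hu, hE⟩ := ECtx.ty_plug E (h ▸ hS t ht)
  obtain ⟨hu', hr⟩ := he S u hu
  have hed : (Q.set t (E.plug e')).edges = Q.edges := by
    rw [Pool.edges_set, Pool.edges_eq ht, h, ECtx.rho_plug, ECtx.rho_plug, hr]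
  exact ⟨Finset.mem_insert_of_mem h0, ⟨S, τ, hτ, hS.set (hE S e' (fun _ _ => rfl) hu')
    fun _ _ => rfl⟩, hed ▸ hp, hed ▸ ha⟩

theorem Pool.Inv.gc {Q : Pool R} (hQ : Q.Inv) {t : ℕ} (ht : t ∈ Q.dom) (h0 : t ≠ 0)
    (h : Q.thr t = .unit) : (Q.del t).Inv := by
  obtain ⟨hz, ⟨S, τ, hτ, hS⟩, hp, ha⟩ := hQ
  have hed : (Q.del t).edges = Q.edges := by
    rw [Pool.edges_eq ht, h]
    simp [Pool.edges, Pool.rest, Pool.del, Tm.rho]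
  exact ⟨Finset.mem_erase.2 ⟨h0.symm, hz⟩, ⟨S, τ, hτ, fun i hi => hS i (Finset.mem_of_mem_erase hi)⟩,
    hed ▸ hp, hed ▸ ha⟩

/-- The identifier of the new thread is not 0, which is in use; hence the type required of it is
unit. -/
theorem Pool.Ty.set_set {S S' : Sig R} {Q : Pool R} {τ : ℕ → STm R [] (.ty true)} (h : Q.Ty S τ)
    (hτ : ∀ i ≠ 0, τ i = unitT) (h0 : 0 ∈ Q.dom) {t t' : ℕ} (ht' : t' ∉ Q.dom) {e e' : CTm R}
    (he : MPST.Ty S' [] TCtx.nil e (τ t)) (he' : MPST.Ty S' [] TCtx.nil e' unitT)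
    (hS : ∀ x ∈ Q.rest t, S' x.2.1 = S x.2.1) : ((Q.set t e).set t' e').Ty S' τ :=
  (h.set he hS).set (by rwa [hτ t' fun h => ht' (h ▸ h0)]) fun _ _ => rfl

/-- The endpoints captured by the body pass to the new thread. Merging both threads gives the old
graph back, so no cycle can have arisen. -/
theorem Pool.Inv.spawn {Q : Pool R} (hQ : Q.Inv) {t t' : ℕ} {E : ECtx R} {e : Tm R [] 1}
    (ht : t ∈ Q.dom) (ht' : t' ∉ Q.dom) (h : Q.thr t = E.plug (.un .spawn (.lam e))) :
    ((Q.set t (E.plug .unit)).set t' (e.inst .unit)).Inv := by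
  obtain ⟨h0, ⟨S, τ, hτ, hS⟩, hp, ha⟩ := hQ
  have htt : t ≠ t' := fun h => ht' (h ▸ ht)
  obtain ⟨u, hu, hE⟩ := ECtx.ty_plug E (h ▸ hS t ht)
  obtain ⟨w, u', ho, hl, heq⟩ := hu.inv_un
  cases ho
  obtain ⟨k, t₁, hk, he, h₁⟩ := Ty.inv_lam_fn (l := true) hl
  obtain ⟨hi, hr⟩ := he.inst hk .unit (.conv .unit h₁)
  have hed : ((Q.set t (E.plug .unit)).set t' (e.inst .unit)).edges =
      Q.rest t + E.rho.map (Prod.mk t) + e.rho.map (Prod.mk t') := by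
    rw [Pool.edges_set_set ht ht', hr, ECtx.rho_plug]
    simp [Tm.rho]
  have hold : Q.edges = Q.rest t + (E.rho + e.rho).map (Prod.mk t) := by
    rw [Pool.edges_eq ht, h, ECtx.rho_plug]; rfl
  refine ⟨Finset.mem_insert_of_mem (Finset.mem_insert_of_mem h0), ⟨S, τ, hτ, hS.set_set hτ h0 ht'
    (hE S _ (fun _ _ => rfl) (.conv .unit heq)) hi fun _ _ => rfl⟩, ?_, ?_⟩
  · rw [hed]
    rw [hold] at hp
    simpa only [Multiset.map_add, map_snd_map_mk, add_assoc] using hp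
  · rw [hed]
    refine Acyc.of_mergeT htt ?_
    rwa [Pool.map_mergeT ht ht', ← hold]

theorem update_eq_of_ne {S : Sig R} {c : ℕ} {π : STm R [] .stype} {M : Multiset (Edge R)}
    (h : ∀ x ∈ M, x.2.1 ≠ c) : ∀ x ∈ M, Function.update S c (some π) x.2.1 = S x.2.1 :=
  fun x hx => Function.update_of_ne (h x hx) _ _

theorem update_eq_of_ne' {S : Sig R} {c : ℕ} {π : STm R [] .stype} {N : Multiset (ℕ × Set R)}
    (h : ∀ x ∈ N, x.1 ≠ c) : ∀ x ∈ N, Function.update S c (some π) x.1 = S x.1 :=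
  fun x hx => Function.update_of_ne (h x hx) _ _

/-- The signature is extended by the session type of the fresh channel; freshness keeps the typing
of everything already present. The premises of the typing rule are precisely that the two role sets
partition `R`. -/
theorem Pool.Inv.fork {Q : Pool R} (hQ : Q.Inv) {t t' c : ℕ} {E : ECtx R} {e : Tm R [] 1}
    {rs₁ rs₂ : STm R [] .set} {A₁ A₂ : Set R} (hA₁ : rs₁.val = A₁) (hA₂ : rs₂.val = A₂)
    (ht : t ∈ Q.dom) (ht' : t' ∉ Q.dom) (hc : Q.Fresh c)
    (h : Q.thr t = E.plug (.un (.fork rs₁ rs₂) (.lam e))) :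
    ((Q.set t (E.plug (.ep c A₂))).set t' (e.inst (.ep c A₁))).Inv := by
  obtain ⟨h0, ⟨S, τ, hτ, hS⟩, hp, ha⟩ := hQ
  have htt : t ≠ t' := fun h => ht' (h ▸ ht)
  obtain ⟨u, hu, hE⟩ := ECtx.ty_plug E (h ▸ hS t ht)
  obtain ⟨w, u', ho, hl, heq⟩ := hu.inv_un
  cases ho with
  | @fork _ _ π hent =>
  have hd : A₁ ∩ A₂ = ∅ := by rw [← hA₁, ← hA₂]; exact (entails_nil.1 hent).1
  have hcov : A₁ ∪ A₂ = Set.univ := by rw [← hA₁, ← hA₂]; exact (entails_nil.1 hent).2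
  obtain ⟨k, t₁, hk, he, h₁⟩ := Ty.inv_lam_fn (l := true) hl
  have hold : Q.edges = Q.rest t + (E.rho + e.rho).map (Prod.mk t) := by
    rw [Pool.edges_eq ht, h, ECtx.rho_plug]; rfl
  have hfr : ∀ x ∈ E.rho + e.rho, x.1 ≠ c := fun x hx => hc.ne (x := (t, x)) (by
    rw [hold]
    exact Multiset.mem_add.2 (.inr (Multiset.mem_map_of_mem _ hx)))
  have hrest : ∀ x ∈ Q.rest t, x.2.1 ≠ c := fun x hx =>
    hc.ne (Multiset.mem_of_le (Q.rest_le t) hx)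
  have hSc : Function.update S c (some π) c = some π := Function.update_self ..
  obtain ⟨hi, hr⟩ := (he.sig (update_eq_of_ne' fun x hx => hfr x (Multiset.mem_add.2 (.inr hx)))).inst
    hk (.ep c A₁) (.conv (.ep_chan hSc hA₁ (.refl _)) h₁)
  have hed : ((Q.set t (E.plug (.ep c A₂))).set t' (e.inst (.ep c A₁))).edges =
      Q.rest t + E.rho.map (Prod.mk t) + e.rho.map (Prod.mk t') + {(t, c, A₂)} +
        {(t', c, A₁)} := by
    rw [Pool.edges_set_set ht ht', hr, ECtx.rho_plug]
    simp only [Tm.rho, Multiset.map_add, Multiset.map_singleton]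
    abel
  have hmem : ∀ x ∈ Q.rest t + E.rho.map (Prod.mk t) + e.rho.map (Prod.mk t'), x.2.1 ≠ c := by
    intro x hx
    rcases Multiset.mem_add.1 hx with hx | hx
    · rcases Multiset.mem_add.1 hx with hx | hx
      · exact hrest x hx
      · obtain ⟨y, hy, rfl⟩ := Multiset.mem_map.1 hx
        exact hfr y (Multiset.mem_add.2 (.inl hy))
    · obtain ⟨y, hy, rfl⟩ := Multiset.mem_map.1 hx
      exact hfr y (Multiset.mem_add.2 (.inr hy))
  refine ⟨Finset.mem_insert_of_mem (Finset.mem_insert_of_mem h0), ⟨Function.update S c (some π), τ,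
    hτ, hS.set_set hτ h0 ht' (hE _ _ (update_eq_of_ne' fun x hx =>
      hfr x (Multiset.mem_add.2 (.inl hx))) (.conv (.ep_chan hSc hA₂ (.refl _)) heq)) hi
      (update_eq_of_ne hrest)⟩, ?_, ?_⟩
  · rw [hed, Part.map_add_singleton, Part.map_add_singleton]
    rw [hold] at hp
    refine Part.fork ?_ (numC_eq_zero.2 fun x hx => ?_) hd hcov
    · simpa only [Multiset.map_add, map_snd_map_mk, add_assoc] using hp
    · obtain ⟨y, hy, rfl⟩ := Multiset.mem_map.1 hx
      exact hmem y hy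
  · rw [hed]
    refine Acyc.fork htt ?_ hmem
    rwa [Pool.map_mergeT ht ht', ← hold]

/-- The signature stays the same: one endpoint is replaced by two of the same channel, whose role
sets divide the old one, and one of these goes to the new thread. -/
theorem Pool.Inv.split {Q : Pool R} (hQ : Q.Inv) {t t' c : ℕ} {E : ECtx R} {e : Tm R [] 1}
    {rs₁ rs₂ : STm R [] .set} {A A₁ A₂ : Set R} (hA₁ : rs₁.val = A₁) (hA₂ : rs₂.val = A₂)
    (ht : t ∈ Q.dom) (ht' : t' ∉ Q.dom)
    (hA : A = (STm.union rs₁ rs₂).val)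
    (h : Q.thr t = E.plug (.bin (.split rs₁ rs₂) (.ep c A) (.lam e))) :
    ((Q.set t (E.plug (.ep c A₂))).set t' (e.inst (.ep c A₁))).Inv := by
  obtain ⟨h0, ⟨S, τ, hτ, hS⟩, hp, ha⟩ := hQ
  have htt : t ≠ t' := fun h => ht' (h ▸ ht)
  obtain ⟨u, hu, hE⟩ := ECtx.ty_plug E (h ▸ hS t ht)
  obtain ⟨w₁, w₂, u', ho, hep, hl, heq⟩ := hu.inv_bin
  cases ho with
  | @split _ _ π hent =>
  have hd : A₁ ∩ A₂ = ∅ := by rw [← hA₁, ← hA₂]; exact entails_nil.1 hent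
  have hA : A = A₁ ∪ A₂ := by rw [hA, ← hA₁, ← hA₂]; rfl
  obtain ⟨π₀, hSc, -, hπ⟩ := hep.inv_ep_chan
  obtain ⟨k, t₁, hk, he, h₁⟩ := Ty.inv_lam_fn (l := true) hl
  have hold : Q.edges = Q.rest t + (E.rho + e.rho).map (Prod.mk t) + {(t, c, A)} := by
    rw [Pool.edges_eq ht, h, ECtx.rho_plug]
    simp only [Tm.rho, Multiset.map_add, Multiset.map_singleton]
    abel
  obtain ⟨hi, hr⟩ := he.inst hk (.ep c A₁) (.conv (.ep_chan hSc hA₁ hπ) h₁)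
  have hed : ((Q.set t (E.plug (.ep c A₂))).set t' (e.inst (.ep c A₁))).edges =
      Q.rest t + E.rho.map (Prod.mk t) + e.rho.map (Prod.mk t') + {(t, c, A₂)} +
        {(t', c, A₁)} := by
    rw [Pool.edges_set_set ht ht', hr, ECtx.rho_plug]
    simp only [Tm.rho, Multiset.map_add, Multiset.map_singleton]
    abel
  refine ⟨Finset.mem_insert_of_mem (Finset.mem_insert_of_mem h0), ⟨S, τ,
    hτ, hS.set_set hτ h0 ht' (hE _ _ (fun _ _ => rfl) (.conv (.ep_chan hSc hA₂ hπ) heq)) hi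
      fun _ _ => rfl⟩, ?_, ?_⟩
  · rw [hed, Part.map_add_singleton, Part.map_add_singleton]
    rw [hold, Part.map_add_singleton, hA] at hp
    refine Part.split ?_ hd
    simpa only [Multiset.map_add, map_snd_map_mk, add_assoc] using hp
  · rw [hed]
    refine Acyc.split htt ?_ (C := A)
    rwa [Pool.map_mergeT ht ht', ← hold]

/-- The step deletes one edge from the graph. -/
theorem Pool.Inv.elim {Q : Pool R} (hQ : Q.Inv) {t c : ℕ} {E : ECtx R} (ht : t ∈ Q.dom)
    (h : Q.thr t = E.plug (.un .elim (.ep c ∅))) : (Q.set t (E.plug .unit)).Inv := by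
  obtain ⟨h0, ⟨S, τ, hτ, hS⟩, hp, ha⟩ := hQ
  obtain ⟨u, hu, hE⟩ := ECtx.ty_plug E (h ▸ hS t ht)
  obtain ⟨w, u', ho, hl, heq⟩ := hu.inv_un
  cases ho
  have hed : Q.edges = (Q.set t (E.plug .unit)).edges + {(t, c, ∅)} := by
    rw [Pool.edges_set, Pool.edges_eq ht, h, ECtx.rho_plug, ECtx.rho_plug]
    simp only [Tm.rho, Multiset.map_add, Multiset.map_singleton, Multiset.map_zero]
    abel
  refine ⟨Finset.mem_insert_of_mem h0, ⟨S, τ, hτ, hS.set (hE S _ (fun _ _ => rfl)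
    (.conv .unit heq)) fun _ _ => rfl⟩, ?_, ha.mono (hed ▸ Multiset.le_add_right _ _)⟩
  rw [hed, Part.map_add_singleton] at hp
  exact hp.elim

theorem Pool.Inv.cutComm {Q : Pool R} (hQ : Q.Inv) {t : ℕ} {E : ECtx R} {v w : CTm R}
    (ht : t ∈ Q.dom) (h : Q.thr t = E.plug (.bin .cut v w)) :
    (Q.set t (E.plug (.bin .cut w v))).Inv := by
  refine hQ.lift ht h fun S u hu => ⟨?_, add_comm _ _⟩
  obtain ⟨w₁, w₂, u', ho, h₁, h₂, heq⟩ := hu.inv_bin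
  cases ho with
  | @cut rs₁ rs₂ π hent =>
  have hcov : (rs₁.val ∪ rs₂.val : Set R) = Set.univ := entails_nil.1 hent
  refine .conv (.bin (.cut (rs₁ := rs₂) (rs₂ := rs₁) (entails_nil.2 ?_)) h₂ h₁)
    (.trans (.chan (.data trivial fun v _ => ?_) (.refl _)) heq)
  · exact (Set.union_comm (α := R) rs₂.val rs₁.val).trans hcov
  · exact Set.inter_comm (α := R) (rs₂.eval v) (rs₁.eval v)

theorem Pool.Inv.cut {Q : Pool R} (hQ : Q.Inv) {t c₁ c₂ c : ℕ} {E : ECtx R} {A₁ A₂ : Set R}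
    (ht : t ∈ Q.dom) (hne : c₁ ≠ c₂) (hc : Q.Fresh c)
    (h : Q.thr t = E.plug (.bin .cut (.ep c₁ A₁) (.ep c₂ A₂))) :
    ((Q.set t (E.plug (.ep c (A₁ ∩ A₂)))).chren (mergeC c₁ c₂ c)).Inv := by
  obtain ⟨h0, ⟨S, τ, hτ, hS⟩, hp, ha⟩ := hQ
  obtain ⟨u, hu, hE⟩ := ECtx.ty_plug E (h ▸ hS t ht)
  obtain ⟨w₁, w₂, u', ho, h₁, h₂, heq⟩ := hu.inv_bin
  cases ho with
  | @cut rs₁ rs₂ π hent =>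
  have hcov : (rs₁.val ∪ rs₂.val : Set R) = Set.univ := entails_nil.1 hent
  obtain ⟨π₁, hS₁, hA₁, hπ₁⟩ := h₁.inv_ep_chan
  obtain ⟨π₂, hS₂, hA₂, hπ₂⟩ := h₂.inv_ep_chan
  have hA₁ : A₁ = rs₁.val := hA₁.val_eq
  have hA₂ : A₂ = rs₂.val := hA₂.val_eq
  have hold : Q.edges = Q.rest t + E.rho.map (Prod.mk t) + {(t, c₁, A₁)} + {(t, c₂, A₂)} := by
    rw [Pool.edges_eq ht, h, ECtx.rho_plug]
    simp only [Tm.rho, Multiset.map_add, Multiset.map_singleton]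
    abel
  have hfr : ∀ x ∈ Q.rest t + E.rho.map (Prod.mk t), x.2.1 ≠ c := fun x hx => hc.ne (by
    rw [hold, add_assoc]
    exact Multiset.mem_add.2 (.inl hx))
  -- Both cut channels occur in the pool, so the fresh one differs from them.
  have hc₁ : c ≠ c₁ := fun hcc => hc.ne (x := (t, c₁, A₁)) (by simp [hold]) hcc.symm
  have hc₂ : c ≠ c₂ := fun hcc => hc.ne (x := (t, c₂, A₂)) (by simp [hold]) hcc.symm
  have hmc : mergeC c₁ c₂ c c = c := by simp [mergeC, hc₁, hc₂]
  have hSc : Function.update S c (some π) c = some π := Function.update_self ..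
  -- Before the renaming, the new endpoint is typed under the signature extended by `c`, while `c₁`
  -- and `c₂` are still present.
  have hset : (Q.set t (E.plug (.ep c (A₁ ∩ A₂)))).Ty (Function.update S c (some π)) τ := by
    refine hS.set (hE _ _ (update_eq_of_ne' fun x hx => ?_)
      (.conv (.ep_chan hSc ?_ (.refl _)) heq)) (update_eq_of_ne fun x hx => ?_)
    · exact hfr (t, x) (Multiset.mem_add.2 (.inr (Multiset.mem_map_of_mem _ hx)))
    · rw [hA₁, hA₂]; rfl
    · exact hfr x (Multiset.mem_add.2 (.inl hx))
  have hed : ((Q.set t (E.plug (.ep c (A₁ ∩ A₂)))).chren (mergeC c₁ c₂ c)).edges =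
      ((Q.rest t + E.rho.map (Prod.mk t)).map fun x => (x.1, mergeC c₁ c₂ c x.2.1, x.2.2)) +
        {(t, c, A₁ ∩ A₂)} := by
    rw [Pool.edges_chren, Pool.edges_set, ECtx.rho_plug]
    simp only [Tm.rho, Multiset.map_add, Multiset.map_singleton, hmc]
    abel
  -- The renaming is admissible because the session types of `c₁` and `c₂` both equal `π`, by the
  -- typing of the cut.
  refine ⟨Finset.mem_insert_of_mem h0, ⟨Function.update S c (some π), τ, hτ, fun i hi =>
    (hset i hi).chren fun x _ π₀ hx => ?_⟩, ?_, ?_⟩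
  · unfold mergeC
    split_ifs with hxc
    · refine ⟨π, hSc, ?_⟩
      rcases hxc with hxc | hxc
      · rw [hxc, Function.update_of_ne hc₁.symm, hS₁] at hx
        cases hx
        exact hπ₁.symm
      · rw [hxc, Function.update_of_ne hc₂.symm, hS₂] at hx
        cases hx
        exact hπ₂.symm
    · exact ⟨π₀, hx, .refl _⟩
  · rw [hed, Part.map_add_singleton]
    rw [hold, Part.map_add_singleton, Part.map_add_singleton] at hp
    have := Part.cut hne hc₁ hc₂ hp (numC_eq_zero.2 fun x hx => by
      obtain ⟨y, hy, rfl⟩ := Multiset.mem_map.1 hx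
      exact hfr y hy) (by rw [hA₁, hA₂]; exact hcov)
    simpa only [Multiset.map_map, Function.comp_def] using this
  · rw [hed]
    rw [hold] at ha
    exact Acyc.cut hne hc₁ hc₂ ha hfr

/-! ## Synchronisation -/

theorem filter_sum {ι α : Type} (p : α → Prop) [DecidablePred p] (s : Finset ι)
    (f : ι → Multiset α) : (∑ i ∈ s, f i).filter p = ∑ i ∈ s, (f i).filter p :=
  map_sum (⟨⟨Multiset.filter p, Multiset.filter_zero p⟩, Multiset.filter_add p⟩ :
    Multiset α →+ Multiset α) f s

/-- The endpoints in the message of an action. -/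
def Act.pay : Act R → Multiset (ℕ × Set R)
  | .bsend v => v.rho
  | .send v => v.rho
  | _ => 0

theorem Act.rho_redex (a : Act R) (c : ℕ) (A : Set R) : (a.redex c A).rho = {(c, A)} + a.pay := by
  cases a <;> simp [Act.redex, Act.pay, Tm.rho]

namespace Pool.AllBlockedOn

variable {Q : Pool R} {c : ℕ} {T : Finset ℕ} {E : ℕ → ECtx R} {A : ℕ → Set R} {a : ℕ → Act R}

theorem rho_thr (h : Q.AllBlockedOn c T E A a) {t : ℕ} (ht : t ∈ T) :
    (Q.thr t).rho = (E t).rho + ({(c, A t)} + (a t).pay) := by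
  rw [h.thr t ht, ECtx.rho_plug, Act.rho_redex]

/-- Each thread in `T` holds at least one endpoint of `c`, namely that of its redex, and there are
as many endpoints of `c` as threads in `T`. So each of these holds exactly one and all other threads
hold none. -/
theorem numC_thr (h : Q.AllBlockedOn c T E A a) {t : ℕ} (ht : t ∈ Q.dom) :
    numC (Q.thr t).rho c = if t ∈ T then 1 else 0 := by
  have hle : ∀ s ∈ Q.dom, (if s ∈ T then 1 else 0) ≤ numC (Q.thr s).rho c := by
    intro s _
    split_ifs with hs
    · rw [h.rho_thr hs, numC_add, numC_add, numC_singleton, if_pos rfl]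
      omega
    · exact Nat.zero_le _
  have hsum : ∑ s ∈ Q.dom, (if s ∈ T then 1 else 0) = ∑ s ∈ Q.dom, numC (Q.thr s).rho c := by
    have h₁ : numC Q.rho c = ∑ s ∈ Q.dom, numC (Q.thr s).rho c := by
      rw [Pool.rho]
      exact map_sum (Multiset.countPAddMonoidHom fun x : ℕ × Set R => x.1 = c) _ _
    have h₂ : numC Q.rho c = T.card := by
      rw [numC, Multiset.countP_eq_card_filter]
      exact (congrArg Multiset.card h.endpoints).trans (Multiset.card_map _ _)
    rw [← h₁, h₂, ← Finset.sum_filter, Finset.filter_mem_eq_inter,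
      Finset.inter_eq_right.2 h.sub, Finset.sum_const, smul_eq_mul, mul_one]
  exact ((Finset.sum_eq_sum_iff_of_le hle).1 hsum t ht).symm

theorem ne_of_mem_thr (h : Q.AllBlockedOn c T E A a) {t : ℕ} (ht : t ∈ Q.dom) (hT : t ∉ T)
    {x : ℕ × Set R} (hx : x ∈ (Q.thr t).rho) : x.1 ≠ c :=
  numC_eq_zero.1 ((h.numC_thr ht).trans (if_neg hT)) x hx

/-- The one endpoint of `c` in the thread is that of the redex. Contexts and messages therefore
remain typed when the session type of `c` changes. -/
theorem numC_ctx (h : Q.AllBlockedOn c T E A a) {t : ℕ} (ht : t ∈ T) :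
    numC (E t).rho c = 0 ∧ numC (a t).pay c = 0 := by
  have := h.numC_thr (h.sub ht)
  rw [h.rho_thr ht, numC_add, numC_add, numC_singleton, if_pos rfl, if_pos ht] at this
  omega

theorem ne_of_mem_ctx (h : Q.AllBlockedOn c T E A a) {t : ℕ} (ht : t ∈ T)
    {x : ℕ × Set R} (hx : x ∈ (E t).rho) : x.1 ≠ c := numC_eq_zero.1 (h.numC_ctx ht).1 x hx

theorem ne_of_mem_pay (h : Q.AllBlockedOn c T E A a) {t : ℕ} (ht : t ∈ T)
    {x : ℕ × Set R} (hx : x ∈ (a t).pay) : x.1 ≠ c := numC_eq_zero.1 (h.numC_ctx ht).2 x hx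

/-- The session type of the channel, and the typing of the actions. -/
theorem exists_hasTy (h : Q.AllBlockedOn c T E A a) {S : Sig R} {τ : ℕ → STm R [] (.ty true)}
    (hQ : Q.Ty S τ) : ∃ π, S c = some π ∧ ∀ t ∈ T, ∃ u, (a t).HasTy S (A t) π u := by
  have key : ∀ t ∈ T, ∃ u π, S c = some π ∧ (a t).HasTy S (A t) π u := fun t ht => by
    obtain ⟨u, hu, -⟩ := ECtx.ty_plug (E t) (h.thr t ht ▸ hQ t (h.sub ht))
    exact ⟨u, hu.inv_redex⟩
  obtain ⟨t₀, ht₀⟩ := h.nonempty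
  obtain ⟨-, π, hπ, -⟩ := key t₀ ht₀
  refine ⟨π, hπ, fun t ht => ?_⟩
  obtain ⟨u, π', hπ', hu⟩ := key t ht
  rw [hπ, Option.some_inj] at hπ'
  exact ⟨u, hπ' ▸ hu⟩

/-- Typing of the pool after a synchronisation which changes the session type to `π'`. -/
theorem ty_upd (h : Q.AllBlockedOn c T E A a) {S : Sig R} {τ : ℕ → STm R [] (.ty true)}
    (hQ : Q.Ty S τ) {π π' : STm R [] .stype} (hπ : S c = some π) {g : ℕ → CTm R}
    (hg : ∀ t ∈ T, ∀ u, (a t).HasTy S (A t) π u →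
      MPST.Ty (Function.update S c (some π')) [] TCtx.nil (g t) u) :
    (Q.upd T fun t => (E t).plug (g t)).Ty (Function.update S c (some π')) τ := by
  intro t ht
  by_cases hT : t ∈ T
  · simp only [Pool.upd, if_pos hT]
    obtain ⟨u, hu, hE⟩ := ECtx.ty_plug (E t) (h.thr t hT ▸ hQ t ht)
    obtain ⟨π₀, hπ₀, hu⟩ := hu.inv_redex
    rw [hπ, Option.some_inj] at hπ₀
    exact hE _ _ (update_eq_of_ne' fun x hx => h.ne_of_mem_ctx hT hx) (hg t hT u (hπ₀ ▸ hu))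
  · simp only [Pool.upd, if_neg hT]
    exact (hQ t ht).sig (update_eq_of_ne' fun x hx => h.ne_of_mem_thr ht hT hx)

/-- Typing of a message after a synchronisation. -/
theorem ty_pay (h : Q.AllBlockedOn c T E A a) {t : ℕ} (ht : t ∈ T) {S : Sig R}
    {π' : STm R [] .stype} {v : CTm R} {u : STm R [] (.ty true)} (hv : (a t).pay = v.rho)
    (hu : MPST.Ty S [] TCtx.nil v u) :
    MPST.Ty (Function.update S c (some π')) [] TCtx.nil v u :=
  hu.sig (update_eq_of_ne' fun _ hx => h.ne_of_mem_pay ht (hv ▸ hx))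

theorem edges_upd (h : Q.AllBlockedOn c T E A a) {g : ℕ → CTm R}
    (hg : ∀ t ∈ T, (g t).rho = {(c, A t)} + (a t).pay) :
    (Q.upd T fun t => (E t).plug (g t)).edges = Q.edges := by
  refine Finset.sum_congr rfl fun t ht => ?_
  by_cases hT : t ∈ T
  · simp only [Pool.upd, if_pos hT, ECtx.rho_plug, h.rho_thr hT, hg t hT]
  · simp only [Pool.upd, if_neg hT]

/-- The pattern of those synchronisations in which every thread keeps its endpoints: the graph is
unchanged, and only the session type of `c` advances. -/
theorem inv_upd (h : Q.AllBlockedOn c T E A a) (hQ : Q.Inv) {g : ℕ → CTm R}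
    (hg : ∀ t ∈ T, (g t).rho = {(c, A t)} + (a t).pay)
    (hty : ∀ S π, S c = some π → (∀ t ∈ T, ∃ u, (a t).HasTy S (A t) π u) →
      ∃ π', ∀ t ∈ T, ∀ u, (a t).HasTy S (A t) π u →
        MPST.Ty (Function.update S c (some π')) [] TCtx.nil (g t) u) :
    (Q.upd T fun t => (E t).plug (g t)).Inv := by
  obtain ⟨h0, ⟨S, τ, hτ, hS⟩, hp, ha⟩ := hQ
  obtain ⟨π, hπ, hac⟩ := h.exists_hasTy hS
  obtain ⟨π', hg'⟩ := hty S π hπ hac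
  exact ⟨h0, ⟨_, τ, hτ, h.ty_upd hS hπ hg'⟩, (h.edges_upd hg).symm ▸ hp,
    (h.edges_upd hg).symm ▸ ha⟩

theorem inv_skip (h : Q.AllBlockedOn c T E A a) (hQ : Q.Inv) (hm : IsSkip T a) :
    (Q.upd T fun t => (E t).plug (.ep c (A t))).Inv := by
  refine h.inv_upd hQ (fun t ht => by simp [hm t ht, Act.pay, Tm.rho]) fun S π hπ hac => ?_
  obtain ⟨t₀, ht₀⟩ := h.nonempty
  obtain ⟨u₀, hu₀⟩ := hac t₀ ht₀
  rw [hm t₀ ht₀] at hu₀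
  obtain ⟨r, q, w, π', -, h₁, -⟩ := hu₀
  refine ⟨π', fun t ht u hu => ?_⟩
  rw [hm t ht] at hu
  obtain ⟨r', q', w', π'', -, h₂, heq⟩ := hu
  exact .conv (.ep_chan (Function.update_self ..) rfl (h₁.symm.trans h₂).msg_inj.2.2.2) heq

theorem inv_bmsg (h : Q.AllBlockedOn c T E A a) (hQ : Q.Inv) {t₁ : ℕ} {v : CTm R}
    (hm : IsBcast T a t₁ v) : (Q.upd T fun t => (E t).plug
      (if t = t₁ then .ep c (A t) else .bin .pair (.ep c (A t)) v)).Inv := by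
  obtain ⟨ht₁, ha₁, ha⟩ := hm
  have hval : Value v := by simpa only [ha₁, Act.Valid] using h.valid t₁ ht₁
  -- A broadcast value has a non-linear type and so holds no endpoints; it can be copied to all
  -- receivers without changing the graph.
  have hv : v.rho = 0 := by
    obtain ⟨S, τ, -, hS⟩ := hQ.ty
    obtain ⟨π, -, hac⟩ := h.exists_hasTy hS
    obtain ⟨u, hu⟩ := hac t₁ ht₁
    rw [ha₁] at hu
    obtain ⟨r, w, π', -, -, hvt, -⟩ := hu
    exact hvt.rho_of_emb hval
  refine h.inv_upd hQ (fun t ht => ?_) fun S π hπ hac => ?_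
  · split_ifs with h
    · rw [h, ha₁]; simp [Act.pay, Tm.rho, hv]
    · rw [ha t ht h]; simp [Act.pay, Tm.rho, hv]
  · obtain ⟨u, hu⟩ := hac t₁ ht₁
    rw [ha₁] at hu
    obtain ⟨r, w, π', -, h₁, hvt, -⟩ := hu
    refine ⟨π', fun t ht u hu => ?_⟩
    split_ifs with htt
    · rw [htt, ha₁] at hu
      obtain ⟨r', w', π'', -, h₂, -, heq⟩ := hu
      exact .conv (.ep_chan (Function.update_self ..) rfl (h₁.symm.trans h₂).bmsg_inj.2.2)
        (htt ▸ heq)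
    · rw [ha t ht htt] at hu
      obtain ⟨r', w', π'', -, h₂, heq⟩ := hu
      have hin := (h₁.symm.trans h₂).bmsg_inj
      refine .conv (.bin (.pair (l := true)) (.ep_chan (Function.update_self ..) rfl hin.2.2)
        (.conv (h.ty_pay ht₁ ?_ hvt) (.emb hin.2.1))) heq
      rw [ha₁]; rfl

/-- The channel goes on with the session type `f s`. The threads may have typed their actions with
different functions, but these are provably equal by injectivity of `quan`. -/
theorem inv_quan (h : Q.AllBlockedOn c T E A a) (hQ : Q.Inv) {t₁ : ℕ} {b : Srt}
    (hm : IsQuan T a t₁ b) (s : STm R [] b) : (Q.upd T fun t => (E t).plug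
      (if t = t₁ then .opn c (A t) s else .un (.exI b s) (.ep c (A t)))).Inv := by
  obtain ⟨ht₁, ha₁, ha⟩ := hm
  refine h.inv_upd hQ (fun t ht => ?_) fun S π hπ hac => ?_
  · split_ifs with h
    · rw [h, ha₁]; simp [Act.pay, Tm.rho]
    · rw [ha t ht h]; simp [Act.pay, Tm.rho]
  · obtain ⟨u, hu⟩ := hac t₁ ht₁
    rw [ha₁] at hu
    obtain ⟨r, f, -, h₁, -⟩ := hu
    refine ⟨.app f s, fun t ht u hu => ?_⟩
    split_ifs with htt
    · rw [htt, ha₁] at hu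
      obtain ⟨r', f', -, h₂, heq⟩ := hu
      have hin := (h₁.symm.trans h₂).quan_inj
      refine .conv (.opn (f := f') (Function.update_self ..) ?_) (htt ▸ heq)
      rw [STm.wkc_nil]
      exact .app hin.2 (.refl _)
    · rw [ha t ht htt] at hu
      obtain ⟨r', f', -, h₂, heq⟩ := hu
      have hin := (h₁.symm.trans h₂).quan_inj
      refine .conv (.un (.exI (l := true)) ?_) heq
      have : ((STm.chan (.setLit (A t)) (.app (f'.wk b) (.var .z))).inst s).up =
          STm.chan (.setLit (A t)) (.app f' s) := by
        change STm.chan (.setLit (A t)) (.app ((f'.wk b).inst s) s) = _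
        rw [STm.wk_inst]
      rw [this]
      exact .ep_chan (Function.update_self ..) rfl (.app hin.2 (.refl _))

/-- Since `c` does not occur in the contexts and these actions carry no message, the step removes
exactly the edges at `c`. -/
theorem inv_fin (h : Q.AllBlockedOn c T E A a) (hQ : Q.Inv) {t₁ : ℕ} (hm : IsEnd T a t₁) :
    (Q.upd T fun t => (E t).plug .unit).Inv := by
  have hpay : ∀ t ∈ T, (a t).pay = 0 ∧ ∀ S π u, (a t).HasTy S (A t) π u → SEq [] unitT u := by
    intro t ht
    by_cases htt : t = t₁
    · rw [htt, hm.2.1]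
      exact ⟨rfl, fun S π u hu => hu.choose_spec.2.2⟩
    · rw [hm.2.2 t ht htt]
      exact ⟨rfl, fun S π u hu => hu.choose_spec.2.2⟩
  obtain ⟨h0, ⟨S, τ, hτ, hS⟩, hp, ha⟩ := hQ
  obtain ⟨π, hπ, hac⟩ := h.exists_hasTy hS
  have hed : ∀ t ∈ Q.dom, ((Q.upd T fun t => (E t).plug .unit).thr t).rho =
      (Q.thr t).rho.filter fun x => x.1 ≠ c := by
    intro t ht
    by_cases hT : t ∈ T
    · simp only [Pool.upd, if_pos hT, ECtx.rho_plug, h.rho_thr hT, (hpay t hT).1,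
        Multiset.filter_add]
      rw [Multiset.filter_eq_self.2 fun x hx => h.ne_of_mem_ctx hT hx]
      simp [Tm.rho]
    · simp only [Pool.upd, if_neg hT]
      exact (Multiset.filter_eq_self.2 fun x hx => h.ne_of_mem_thr ht hT hx).symm
  -- The channel has disappeared, so its entry in the signature can stay the same.
  refine ⟨h0, ⟨_, τ, hτ, h.ty_upd (π' := π) hS hπ fun t ht u hu =>
    .conv .unit ((hpay t ht).2 _ _ _ hu)⟩, ?_, ha.mono (Finset.sum_le_sum fun t ht =>
      Multiset.map_le_map ((hed t ht).trans_le (Multiset.filter_le _ _)))⟩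
  rw [Pool.map_snd_edges] at hp ⊢
  have : (Q.upd T fun t => (E t).plug .unit).rho = Q.rho.filter fun x => x.1 ≠ c := by
    rw [Pool.rho, Pool.rho, filter_sum]
    exact Finset.sum_congr rfl hed
  rw [this]
  exact hp.filter c

/-- The message may contain endpoints, whose edges move from `t₁` to `t₂`. As both threads are
adjacent to `c`, the graph remains acyclic by `Acyc.move`. -/
theorem inv_msg (h : Q.AllBlockedOn c T E A a) (hQ : Q.Inv) {t₁ t₂ : ℕ} {v : CTm R}
    (hm : IsMsg T a t₁ t₂ v) : (Q.upd T fun t => (E t).plug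
      (if t = t₂ then .bin .pair (.ep c (A t)) v else .ep c (A t))).Inv := by
  obtain ⟨ht₁, ht₂, htt, ha₁, ha₂, has⟩ := hm
  obtain ⟨h0, ⟨S, τ, hτ, hS⟩, hp, ha⟩ := hQ
  obtain ⟨π, hπ, hac⟩ := h.exists_hasTy hS
  obtain ⟨u₁, hu₁⟩ := hac t₁ ht₁
  rw [ha₁] at hu₁
  obtain ⟨r, q, w, π', -, h₁, hvt, -⟩ := hu₁
  have hty : ∀ t ∈ T, ∀ u, (a t).HasTy S (A t) π u →
      MPST.Ty (Function.update S c (some π')) [] TCtx.nil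
        (if t = t₂ then .bin .pair (.ep c (A t)) v else .ep c (A t)) u := by
    intro t ht u hu
    split_ifs with ht'
    · rw [ht', ha₂] at hu
      obtain ⟨r', q', w', π'', -, h₂, heq⟩ := hu
      have hin := (h₁.symm.trans h₂).msg_inj
      refine .conv (.bin (.pair (l := true)) (.ep_chan (Function.update_self ..) rfl hin.2.2.2)
        (.conv (h.ty_pay ht₁ ?_ hvt) hin.2.2.1)) (ht' ▸ heq)
      rw [ha₁]; rfl
    · by_cases ht'' : t = t₁
      · rw [ht'', ha₁] at hu
        obtain ⟨r', q', w', π'', -, h₂, -, heq⟩ := hu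
        exact .conv (.ep_chan (Function.update_self ..) rfl (h₁.symm.trans h₂).msg_inj.2.2.2)
          (ht'' ▸ heq)
      · rw [has t ht ht'' ht'] at hu
        obtain ⟨r', q', w', π'', -, h₂, heq⟩ := hu
        exact .conv (.ep_chan (Function.update_self ..) rfl (h₁.symm.trans h₂).msg_inj.2.2.2) heq
  set Q' := Q.upd T fun t => (E t).plug
    (if t = t₂ then .bin .pair (.ep c (A t)) v else .ep c (A t)) with hQ'
  have hsplit : ∀ f : ℕ → Multiset (Edge R), ∑ t ∈ Q.dom, f t =
      ∑ t ∈ (Q.dom.erase t₁).erase t₂, f t + f t₂ + f t₁ := fun f => by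
    rw [Finset.sum_erase_add _ _ (Finset.mem_erase.2 ⟨htt.symm, h.sub ht₂⟩),
      Finset.sum_erase_add _ _ (h.sub ht₁)]
  -- The edges of all threads other than sender and receiver, which the step leaves untouched.
  set K := ∑ t ∈ (Q.dom.erase t₁).erase t₂, (Q.thr t).rho.map (Prod.mk t) with hK
  have hold : Q.edges = (K + (E t₁).rho.map (Prod.mk t₁) + (E t₂).rho.map (Prod.mk t₂)) +
      v.rho.map (Prod.mk t₁) + {(t₁, c, A t₁)} + {(t₂, c, A t₂)} := by
    rw [Pool.edges, hsplit, ← hK, h.rho_thr ht₁, h.rho_thr ht₂, ha₁, ha₂]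
    simp only [Act.pay, Multiset.map_add, Multiset.map_singleton, add_zero]
    abel
  have hK' : ∑ t ∈ (Q.dom.erase t₁).erase t₂, (Q'.thr t).rho.map (Prod.mk t) = K := by
    refine Finset.sum_congr rfl fun t ht => ?_
    have ht2 := Finset.ne_of_mem_erase ht
    have ht1 := Finset.ne_of_mem_erase (Finset.mem_of_mem_erase ht)
    by_cases hT : t ∈ T
    · simp only [hQ', Pool.upd, if_pos hT, ECtx.rho_plug, h.rho_thr hT, has t hT ht1 ht2,
        if_neg ht2, Act.pay, Tm.rho, add_zero]
    · simp only [hQ', Pool.upd, if_neg hT]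
  have hnew : Q'.edges = (K + (E t₁).rho.map (Prod.mk t₁) + (E t₂).rho.map (Prod.mk t₂)) +
      v.rho.map (Prod.mk t₂) + {(t₁, c, A t₁)} + {(t₂, c, A t₂)} := by
    rw [Pool.edges, show Q'.dom = Q.dom from rfl, hsplit, hK']
    simp only [hQ', Pool.upd, if_pos ht₁, if_pos ht₂, if_neg htt, if_true, ECtx.rho_plug, Tm.rho,
      Multiset.map_add, Multiset.map_singleton]
    abel
  refine ⟨h0, ⟨_, τ, hτ, h.ty_upd hS hπ hty⟩, ?_, ?_⟩
  · rw [hnew]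
    rw [hold] at hp
    simpa only [Multiset.map_add, map_snd_map_mk] using hp
  · rw [hnew]
    rw [hold] at ha
    exact Acyc.move htt ha

end Pool.AllBlockedOn

theorem Step.inv {Q Q' : Pool R} (h : Step Q Q') (hQ : Q.Inv) : Q'.Inv := by
  cases h with
  | lift ht h he => exact hQ.lift ht h fun S u hu => he.preserves hu
  | gc ht h0 h => exact hQ.gc ht h0 h
  | spawn ht ht' h => exact hQ.spawn ht ht' h
  | fork ht ht' hc h => exact hQ.fork rfl rfl ht ht' hc h
  | cut ht hne hc h => exact hQ.cut ht hne hc h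
  | cutComm ht hv hw h => exact hQ.cutComm ht h
  | elim ht h => exact hQ.elim ht h
  | split ht ht' hA h => exact hQ.split rfl rfl ht ht' hA h
  | bmsg h hm => exact h.inv_bmsg hQ hm
  | msg h hm => exact h.inv_msg hQ hm
  | skip h hm => exact h.inv_skip hQ hm
  | fin h hm => exact h.inv_fin hQ hm
  | quan h hm s => exact h.inv_quan hQ hm s

/-! ## Deadlock freedom -/

theorem Pool.Inv.exists_match {Q : Pool R} (hQ : Q.Inv)
    (hb : ∀ t ∈ Q.dom, (Q.thr t).rho = 0 ∨ Blocked (Q.thr t))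
    (hsome : ∃ t ∈ Q.dom, Blocked (Q.thr t)) : ∃ T : Finset ℕ, Q.Match T := by
  classical
  have hex : ∀ t, ∃ (E : ECtx R) (c : ℕ) (A : Set R) (a : Act R),
      t ∈ Q.dom → (Q.thr t).rho ≠ 0 → a.Valid ∧ Q.thr t = E.plug (a.redex c A) := fun t => by
    by_cases ht : t ∈ Q.dom ∧ (Q.thr t).rho ≠ 0
    · obtain ⟨E, c, A, a, h⟩ := (hb t ht.1).resolve_left ht.2
      exact ⟨E, c, A, a, fun _ _ => h⟩
    -- A thread without endpoints is an isolated vertex, and the default values assigned to it are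
    -- never used.
    · exact ⟨[], 0, ∅, .skip, fun h h' => absurd ⟨h, h'⟩ ht⟩
  choose E b A a hE using hex
  have hrho : ∀ {t}, t ∈ Q.dom → (Q.thr t).rho ≠ 0 →
      (Q.thr t).rho = (E t).rho + ({(b t, A t)} + (a t).pay) := fun {t} ht h0 => by
    rw [(hE t ht h0).2, ECtx.rho_plug, Act.rho_redex]
  have hmem : ∀ {x : ℕ × Set R} {N : Multiset (ℕ × Set R)}, x ∈ N → N ≠ 0 := by
    rintro x _ hx rfl
    exact Multiset.notMem_zero x hx
  -- The graph is nonempty because a blocked thread holds the endpoint of its redex; for the same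
  -- reason each thread is adjacent to the channel on which it is blocked.
  obtain ⟨c, ⟨x₀, hx₀, hx₀c⟩, hc⟩ := hQ.acyc.exists_channel (fun h => by
      obtain ⟨t, ht, E', c', A', a', -, heq⟩ := hsome
      have : (t, c', A') ∈ Q.edges := Pool.mem_edges.2 ⟨ht, by
        simp [heq, ECtx.rho_plug, Act.rho_redex]⟩
      rw [h] at this
      exact Multiset.notMem_zero _ this) b fun x hx => by
    obtain ⟨ht, hx⟩ := Pool.mem_edges.1 hx
    refine ⟨A x.1, Pool.mem_edges.2 ⟨ht, ?_⟩⟩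
    simp [hrho ht (hmem hx)]
  set T := Q.dom.filter fun t => ∃ B, (c, B) ∈ (Q.thr t).rho with hT
  have hTd : ∀ {t}, t ∈ T → t ∈ Q.dom ∧ (Q.thr t).rho ≠ 0 ∧ b t = c := fun {t} ht => by
    obtain ⟨ht, B, hB⟩ := Finset.mem_filter.1 ht
    exact ⟨ht, hmem hB, hc (t, c, B) (Pool.mem_edges.2 ⟨ht, hB⟩) rfl⟩
  have hfil : ∀ t ∈ Q.dom, (Q.thr t).rho.filter (fun x => x.1 = c) =
      if t ∈ T then {(c, A t)} else 0 := by
    intro t ht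
    split_ifs with htT
    · obtain ⟨-, h0, hbt⟩ := hTd htT
      have hr := hrho ht h0
      rw [hbt, add_left_comm, add_comm] at hr
      rw [hr, Multiset.filter_add, Multiset.filter_singleton, if_pos rfl,
        Multiset.filter_eq_nil.2, zero_add]
      rintro ⟨d, B⟩ hx rfl
      obtain ⟨N, hN⟩ := Multiset.exists_cons_of_mem hx
      -- A further endpoint of `c` in the same thread would be an edge parallel to that of the
      -- redex.
      refine Acyc.simple (M := Q.rest t + N.map (Prod.mk t)) (t := t) (c := d) (A := A t) (B := B) ?_
      have hac := hQ.acyc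
      rw [Pool.edges_eq ht, hr, hN, Multiset.map_add, Multiset.map_cons, Multiset.map_singleton,
        ← Multiset.singleton_add] at hac
      convert hac using 1
      abel
    · refine Multiset.filter_eq_nil.2 ?_
      rintro ⟨d, B⟩ hx rfl
      exact htT (Finset.mem_filter.2 ⟨ht, B, hx⟩)
  have hend : Q.endpoints c = T.val.map fun t => (c, A t) := by
    have : Q.endpoints c = ∑ t ∈ Q.dom, (Q.thr t).rho.filter fun x => x.1 = c :=
      filter_sum _ _ _
    rw [this, Finset.sum_congr rfl hfil, ← Finset.sum_filter,
      Finset.filter_mem_eq_inter, Finset.inter_eq_right.2 (Finset.filter_subset _ _)]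
    rw [← Multiset.sum_map_singleton (T.val.map _), Multiset.map_map]
    rfl
  have hne : T.Nonempty := by
    obtain ⟨ht, hx⟩ := Pool.mem_edges.1 hx₀
    exact ⟨x₀.1, Finset.mem_filter.2 ⟨ht, x₀.2.2, hx₀c ▸ hx⟩⟩
  have hpart : ∀ r : R, ∃! t, t ∈ T ∧ r ∈ A t := by
    intro r
    have hp := hQ.part
    rw [Pool.map_snd_edges] at hp
    have h0 : numC Q.rho c ≠ 0 := by
      rw [numC, Multiset.countP_eq_card_filter]
      change (Q.endpoints c).card ≠ 0
      rw [hend, Multiset.card_map]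
      exact Finset.card_ne_zero.2 hne
    have h1 := hp c h0 r
    -- There is one endpoint of `c` for each thread in `T`, so counting the endpoints that play `r`
    -- amounts to counting threads.
    have h2 : numR Q.rho c r = (T.filter fun t => r ∈ A t).card := by
      have : numR Q.rho c r = (Q.endpoints c).countP fun x => r ∈ x.2 := by
        rw [Pool.endpoints, Multiset.countP_filter, numR]
        exact Multiset.countP_congr rfl fun x _ => by rw [and_comm]
      rw [this, hend, Multiset.countP_map]
      rfl
    rw [h2, Finset.card_eq_one] at h1
    obtain ⟨t, ht⟩ := h1
    refine ⟨t, Finset.mem_filter.1 (ht ▸ Finset.mem_singleton_self t), fun s hs => ?_⟩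
    exact Finset.mem_singleton.1 (ht ▸ Finset.mem_filter.2 hs)
  have hall : Q.AllBlockedOn c T E A a := by
    refine ⟨hne, Finset.filter_subset _ _, fun t ht => ?_, fun t ht => ?_, hend, hpart⟩
    · obtain ⟨h₁, h₂, -⟩ := hTd ht
      exact (hE t h₁ h₂).1
    · obtain ⟨h₁, h₂, h₃⟩ := hTd ht
      rw [← h₃]
      exact (hE t h₁ h₂).2
  obtain ⟨S, τ, -, hS⟩ := hQ.ty
  obtain ⟨π, -, hac⟩ := hall.exists_hasTy hS
  exact ⟨T, c, E, A, a, hall, matching_of_hasTy hne hpart hac⟩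

end MPST

theorem mainTheorem3 {R : Type} (Q₀ Q : MPST.Pool R)
    (hty₀ : Q₀.WellTyped) (hinit : Q₀.rho = 0)
    (hreach : Relation.ReflTransGen MPST.Step Q₀ Q)
    (hty : Q.WellTyped)
    (hmain : (MPST.Value (Q.thr 0) ∧ (Q.thr 0).rho = 0) ∨ MPST.Blocked (Q.thr 0))
    (hothers : ∀ t ∈ Q.dom, t ≠ 0 → MPST.Blocked (Q.thr t))
    (hsome : ∃ t ∈ Q.dom, MPST.Blocked (Q.thr t)) :
    ∃ T : Finset ℕ, Q.Match T := by
  have hinv : Q.Inv := by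
    clear hty hmain hothers hsome
    induction hreach with
    | refl => exact hty₀.inv hinit
    | tail _ hstep ih => exact hstep.inv ih
  -- If thread 0 is a value without endpoints, it is an isolated vertex of the graph and need not be
  -- blocked.
  refine hinv.exists_match (fun t ht => ?_) hsome
  by_cases h : t = 0
  · subst h
    exact hmain.imp And.right id
  · exact .inr (hothers t ht h)
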